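/- Let $n\ge 2$ and $q\in[0,1)$. Let $A_q=A_q(n)=C(SU_q(n+1))$ be the universal unital $C^*$-algebra generated by $z_{i,j}$, $1\le i,j\le n+1$, subject to the following relations. If $0<q<1$: the matrix $(z_{i,j})$ is unitary; $z_{i,j}z_{i,l}=q\,z_{i,l}z_{i,j}$ for $j<l$; $z_{i,j}z_{k,j}=q\,z_{k,j}z_{i,j}$ for $i<k$; $z_{i,l}z_{k,j}=z_{k,j}z_{i,l}$ and $z_{i,j}z_{k,l}-z_{k,l}z_{i,j}=(q-q^{-1})z_{i,l}z_{k,j}$ for $i<k$, $j<l$; and $\sum_{\sigma\in\mathcal S_{n+1}}(-q)^{\ell(\sigma)}z_{1,\sigma(1)}\cdots z_{n+1,\sigma(n+1)}=1$, where $\ell$ is the number of inversions. If $q=0$ (the crystallized algebra): $z_{i,j}z_{i,l}=0$ for $j<l$; $z_{i,j}z_{k,j}=0$ for $i<k$; for $i<k$, $j<l$ one has $z_{i,l}z_{k,j}=z_{k,j}z_{i,l}$, and $z_{i,l}z_{k,j}=0$ if $\max\{i,j\}\ge\min\{k,l\}$, $z_{i,j}z_{k,l}-z_{k,l}z_{i,j}=z_{i,l}z_{k,j}$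 if $\max\{i,j\}+1=\min\{k,l\}$, $z_{i,j}z_{k,l}=z_{k,l}z_{i,j}$ if $\max\{i,j\}+1<\min\{k,l\}$; $z_{1,1}\cdots z_{n+1,n+1}=1$; and $z_{r,s}^*=\prod_{p=1}^{n}z_{\alpha_r(p),\alpha_s(p)}$ (factors in increasing order of $p$), where $\alpha_r(p)=p$ for $p<r$ and $\alpha_r(p)=p+1$ for $p\ge r$. Let $\hat A_q$ be the set of unitary equivalence classes of non-zero irreducible representations of $A_q$, with the pullback, along $[\pi]\mapsto\ker\pi$, of the Jacobson topology on the set of primitive ideals, whose closed sets are the sets of all primitive ideals that contain a given subset of $A_q$. Let $S$ be the backward shift on $\ell^2(\mathbb N)$ with basis $(e_m)_{m\ge0}$, $N e_m=m e_m$ and $P_0=I-S^*S$. For the transposition $s_r=(r,r+1)$, $1\le r\le n$, let $\pi^{(q)}_{s_r}$ send $z_{r,r}$, $z_{r+1,r+1}$, $z_{r,r+1}$, $z_{r+1,r}$ to $S\sqrt{1-q^{2N}}$, $\sqrt{1-q^{2N}}S^*$, $-q^{N+1}$, $q^N$ if $q>0$ and to $S$, $S^*$, $P_0$, $P_0$ if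 $q=0$, and every other $z_{i,j}$ to $\delta_{i,j}I$. Convolution of representations is $(\pi*\rho)(z_{i,j})=\sum_k\pi(z_{i,k})\otimes\rho(z_{k,j})$, where $k$ runs over $1,\dots,n+1$ if $q>0$ and over $\min\{i,j\}\le k\le\max\{i,j\}$ if $q=0$. Every $w\in\mathcal S_{n+1}$ has a unique reduced expression $w=s_{[a_k,b_k]}\cdots s_{[a_1,b_1]}$ with $b_k<\cdots<b_1$, $a_i\le b_i$ and $s_{[a,b]}=s_bs_{b-1}\cdots s_a$; let $\pi^{(q)}_w$ be the convolution of the $\pi^{(q)}_{s_r}$ along this expression, a representation on $\ell^2(\mathbb N)^{\otimes l(w)}$. For $t=(t_1,\dots,t_n)$ in the torus $\mathbb T=\{u\in\mathbb C:|u|=1\}^n$ let $\chi_t(z_{i,j})=\delta_{i,j}\,\overline{t_{i-1}}\,t_i$ (with $t_0=t_{n+1}=1$) and $\pi^{(q)}_{t,w}=\chi_t*\pi^{(q)}_w$. Then the topological space $\hat A_q$ is not Hausdorff. Indeed, for every $t\in\mathbb T$ and every $w\in\mathcal S_{n+1}$, $w\ne1$ (that is, every $w$ that has a strictly smaller element below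 it in the Bruhat order), $\pi^{(q)}_{t,w}$ is an irreducible representation of $A_q$ and the singleton $\{[\pi^{(q)}_{t,w}]\}\subseteq\hat A_q$ is not closed. -/

import Mathlib

open scoped ENNReal

noncomputable section

/-! ### Irreducible representations, the spectrum and the Jacobson topology -/

section Spectrum

/-- A `*`-homomorphism `A → B(H)` is an irreducible representation if it is non-zero and has no
closed invariant subspaces besides `0` and `H`. -/
structure IsIrredRep {A : Type*} [NonUnitalCStarAlgebra A] {H : Type*} [NormedAddCommGroup H]
    [InnerProductSpace ℂ H] [CompleteSpace H] (π : A →⋆ₙₐ[ℂ] (H →L[ℂ] H)) : Prop where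
  ne_zero : π ≠ 0
  irred : ∀ K : Submodule ℂ H, IsClosed (K : Set H) → (∀ a : A, ∀ v ∈ K, π a v ∈ K) →
    K = ⊥ ∨ K = ⊤

/-- The irreducible representations of `A` on Hilbert spaces. -/
structure IrredRep (A : Type*) [NonUnitalCStarAlgebra A] where
  H : Type
  [normed : NormedAddCommGroup H]
  [inner : InnerProductSpace ℂ H]
  [complete : CompleteSpace H]
  hom : A →⋆ₙₐ[ℂ] (H →L[ℂ] H)
  isIrred : IsIrredRep hom

attribute [instance] IrredRep.normed IrredRep.inner IrredRep.complete

variable {A : Type*} [NonUnitalCStarAlgebra A]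

/-- Unitary equivalence of irreducible representations. -/
def IrredRep.Equivalent (π ρ : IrredRep A) : Prop :=
  ∃ U : π.H ≃ₗᵢ[ℂ] ρ.H, ∀ (a : A) (v : π.H), U (π.hom a v) = ρ.hom a (U v)

instance IrredRep.setoid (A : Type*) [NonUnitalCStarAlgebra A] : Setoid (IrredRep A) where
  r := IrredRep.Equivalent
  iseqv :=
    { refl := fun π => ⟨LinearIsometryEquiv.refl ℂ π.H, fun _ _ => rfl⟩
      symm := by
        rintro π ρ ⟨U, hU⟩
        refine ⟨U.symm, fun a v => ?_⟩
        apply U.injective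
        rw [hU]
        simp
      trans := by
        rintro π ρ σ ⟨U, hU⟩ ⟨V, hV⟩
        refine ⟨U.trans V, fun a v => ?_⟩
        simp [hU, hV] }

/-- The kernel of an irreducible representation. -/
def IrredRep.ker (π : IrredRep A) : TwoSidedIdeal A := TwoSidedIdeal.ker π.hom

theorem IrredRep.mem_ker (π : IrredRep A) (a : A) : a ∈ π.ker ↔ π.hom a = 0 :=
  TwoSidedIdeal.mem_ker π.hom

/-- `Prim(A)`: the primitive ideals of `A`, i.e. the kernels of irreducible representations. -/
def Prim (A : Type*) [NonUnitalCStarAlgebra A] : Type _ :=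
  {J : TwoSidedIdeal A // ∃ π : IrredRep A, π.ker = J}

/-- The primitive ideals that contain the set `M`. -/
def Prim.hull (M : Set A) : Set (Prim A) := {J | ∀ a ∈ M, a ∈ J.1}

/-- Irreducible representations are nondegenerate. -/
theorem IrredRep.eq_zero_of_forall (π : IrredRep A) (v : π.H) (h : ∀ a, π.hom a v = 0) :
    v = 0 := by
  let K : Submodule ℂ π.H := ⨅ a : A, LinearMap.ker (π.hom a : π.H →ₗ[ℂ] π.H)
  have hmem : ∀ w, w ∈ K ↔ ∀ a, π.hom a w = 0 := fun w => by simp [K, Submodule.mem_iInf]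
  have hcl : IsClosed (K : Set π.H) := by
    have : (K : Set π.H) = ⋂ a : A, (π.hom a) ⁻¹' {0} := by
      ext w; simp [hmem]
    rw [this]
    exact isClosed_iInter fun a => (isClosed_singleton).preimage (π.hom a).continuous
  rcases π.isIrred.irred K hcl (fun a w hw => (hmem _).2 fun b => by
    rw [(hmem w).1 hw a, map_zero]) with hK | hK
  · have := (hmem v).2 h
    rw [hK] at this
    simpa using this
  · exfalso
    apply π.isIrred.ne_zero
    ext a w
    have : w ∈ K := by rw [hK]; trivial
    simpa using (hmem w).1 this a

/-- Primitive ideals are prime. -/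
theorem IrredRep.prime (π : IrredRep A) (a b : A) (h : ∀ c, π.hom (a * c * b) = 0) :
    π.hom a = 0 ∨ π.hom b = 0 := by
  by_contra! hab
  obtain ⟨ha, hb⟩ := hab
  obtain ⟨v, hv⟩ : ∃ v, π.hom b v ≠ 0 := by
    by_contra! hv
    exact hb (ContinuousLinearMap.ext hv)
  let L : A →ₗ[ℂ] π.H :=
    { toFun := fun c => π.hom c (π.hom b v)
      map_add' := by intro x y; simp
      map_smul' := by intro x y; simp }
  have hinv : ∀ x : A, ∀ w ∈ (LinearMap.range L).topologicalClosure,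
      π.hom x w ∈ (LinearMap.range L).topologicalClosure := by
    intro x w hw
    have := map_mem_closure (π.hom x).continuous hw
      (t := ((LinearMap.range L : Submodule ℂ π.H) : Set π.H)) (by
        rintro _ ⟨c, rfl⟩
        exact ⟨x * c, by simp [L]⟩)
    exact this
  rcases π.isIrred.irred _ (Submodule.isClosed_topologicalClosure _) hinv with hK | hK
  · apply hv
    apply π.eq_zero_of_forall
    intro c
    have : L c ∈ (LinearMap.range L).topologicalClosure :=
      Submodule.le_topologicalClosure _ ⟨c, rfl⟩
    rw [hK] at this
    simpa [L] using this
  · apply ha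
    ext w
    have hw : w ∈ (LinearMap.range L).topologicalClosure := by rw [hK]; trivial
    have := map_mem_closure (π.hom a).continuous hw (t := {0}) (by
        rintro _ ⟨c, rfl⟩
        have := congrArg (fun T : π.H →L[ℂ] π.H => T v) (h c)
        simpa [L] using this)
    simpa using this

/-- The Jacobson topology: the closed sets are exactly the sets of all primitive ideals containing
some subset `M` of `A`. -/
instance Prim.jacobsonTopology (A : Type*) [NonUnitalCStarAlgebra A] :
    TopologicalSpace (Prim A) :=
  TopologicalSpace.ofClosed {S : Set (Prim A) | ∃ M : Set A, S = Prim.hull M}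
    (by
      refine ⟨Set.univ, ?_⟩
      symm
      rw [Set.eq_empty_iff_forall_notMem]
      rintro ⟨_, π, rfl⟩ hJ
      apply π.isIrred.ne_zero
      ext1 a
      exact (π.mem_ker a).1 (hJ a trivial))
    (by
      intro F hF
      have hF' : ∀ S ∈ F, ∃ M : Set A, S = Prim.hull M := fun S hS => hF hS
      choose! M hM using hF'
      refine ⟨⋃ S ∈ F, M S, ?_⟩
      ext J
      constructor
      · intro hJ a ha
        simp only [Set.mem_iUnion] at ha
        obtain ⟨S, hS, ha⟩ := ha
        have := hJ S hS
        rw [hM S hS] at this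
        exact this a ha
      · intro hJ S hS
        rw [hM S hS]
        intro a ha
        exact hJ a (Set.mem_biUnion hS ha))
    (by
      rintro _ ⟨M, rfl⟩ _ ⟨N, rfl⟩
      refine ⟨{x | ∃ a ∈ M, ∃ c, ∃ b ∈ N, x = a * c * b}, ?_⟩
      ext J
      constructor
      · rintro (hJ | hJ) _ ⟨a, ha, c, b, hb, rfl⟩
        · exact J.1.mul_mem_right _ _ (J.1.mul_mem_right _ _ (hJ a ha))
        · exact J.1.mul_mem_left _ _ (hJ b hb)
      · intro hJ
        by_contra hcon
        simp only [Set.mem_union, not_or, Prim.hull, Set.mem_ofPred_eq, not_forall] at hcon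
        obtain ⟨⟨a, ha, haJ⟩, b, hb, hbJ⟩ := hcon
        obtain ⟨J, π, rfl⟩ := J
        rcases π.prime a b (fun c => (π.mem_ker _).1 (hJ _ ⟨a, ha, c, b, hb, rfl⟩)) with h | h
        · exact haJ ((π.mem_ker _).2 h)
        · exact hbJ ((π.mem_ker _).2 h))

/-- The spectrum `Â`: unitary equivalence classes of irreducible representations of `A`. -/
def CSpectrum (A : Type*) [NonUnitalCStarAlgebra A] : Type _ := Quotient (IrredRep.setoid A)

/-- The class in `Â` of an irreducible representation. -/
def CSpectrum.mk {H : Type} [NormedAddCommGroup H] [InnerProductSpace ℂ H] [CompleteSpace H]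
    (π : A →⋆ₙₐ[ℂ] (H →L[ℂ] H)) (h : IsIrredRep π) : CSpectrum A :=
  Quotient.mk (IrredRep.setoid A) ⟨H, π, h⟩

/-- The canonical map `Â → Prim(A)`, sending the class of `π` to the kernel of `π`. -/
def CSpectrum.toPrim : CSpectrum A → Prim A :=
  Quotient.lift (fun π : IrredRep A => (⟨π.ker, π, rfl⟩ : Prim A)) (by
    rintro π ρ ⟨U, hU⟩
    apply Subtype.ext
    ext a
    rw [IrredRep.mem_ker, IrredRep.mem_ker]
    constructor
    · intro h
      ext v
      have := hU a (U.symm v)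
      rw [h] at this
      simpa using this.symm
    · intro h
      ext v
      have := hU a v
      rw [h] at this
      simpa using this)

/-- The topology of `Â`: the pullback of the Jacobson topology. -/
instance CSpectrum.topology (A : Type*) [NonUnitalCStarAlgebra A] :
    TopologicalSpace (CSpectrum A) :=
  TopologicalSpace.induced CSpectrum.toPrim (Prim.jacobsonTopology A)

end Spectrum

/-! ### The `C*`-algebras `A_q(n) = C(SU_q(n+1))`, `0 ≤ q < 1` -/

section Algebra

/-- The number of inversions of a permutation. -/
def invCount {N : ℕ} (σ : Equiv.Perm (Fin N)) : ℕ :=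
  (Finset.univ.filter fun p : Fin N × Fin N => p.1 < p.2 ∧ σ p.2 < σ p.1).card

/-- The defining relations of `C(SU_q(n+1))` for `0 < q < 1`: the matrix `z` is unitary, its entries
satisfy the quantum matrix relations, and its quantum determinant is `1`. -/
structure QuantumRel (n : ℕ) (q : ℝ) {B : Type*} [CStarAlgebra B]
    (z : Fin (n + 1) → Fin (n + 1) → B) : Prop where
  row : ∀ i j l : Fin (n + 1), j < l → z i j * z i l = (q : ℂ) • (z i l * z i j)
  col : ∀ i k j : Fin (n + 1), i < k → z i j * z k j = (q : ℂ) • (z k j * z i j)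
  anti : ∀ i k j l : Fin (n + 1), i < k → j < l → z i l * z k j = z k j * z i l
  diag : ∀ i k j l : Fin (n + 1), i < k → j < l →
    z i j * z k l - z k l * z i j = ((q : ℂ) - (q : ℂ)⁻¹) • (z i l * z k j)
  det : ∑ σ : Equiv.Perm (Fin (n + 1)),
    (-(q : ℂ)) ^ invCount σ • (List.ofFn fun i => z i (σ i)).prod = 1
  unitary_row : ∀ i j, ∑ k, z i k * star (z j k) = if i = j then 1 else 0
  unitary_col : ∀ i j, ∑ k, star (z k i) * z k j = if i = j then 1 else 0

/-- The defining relations of the crystallized algebra `C(SU_0(n+1))`. In the last one the product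
is taken over the order-preserving bijection from the rows other than `r` to the columns other than
`s`: for `r < s` it is
`(z_{11} ⋯ z_{r-1,r-1}) (z_{r+1,r} ⋯ z_{s,s-1}) (z_{s+1,s+1} ⋯ z_{n+1,n+1})`, and for `s < r` it is
`(z_{11} ⋯ z_{s-1,s-1}) (z_{s,s+1} ⋯ z_{r-1,r}) (z_{r+1,r+1} ⋯ z_{n+1,n+1})`. -/
structure CrystalRel (n : ℕ) {B : Type*} [CStarAlgebra B]
    (z : Fin (n + 1) → Fin (n + 1) → B) : Prop where
  row : ∀ i j l : Fin (n + 1), j < l → z i j * z i l = 0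
  col : ∀ i k j : Fin (n + 1), i < k → z i j * z k j = 0
  anti : ∀ i k j l : Fin (n + 1), i < k → j < l → z i l * z k j = z k j * z i l
  anti_zero : ∀ i k j l : Fin (n + 1), i < k → j < l → min k.val l.val ≤ max i.val j.val →
    z i l * z k j = 0
  diag : ∀ i k j l : Fin (n + 1), i < k → j < l → max i.val j.val + 1 = min k.val l.val →
    z i j * z k l - z k l * z i j = z i l * z k j
  diag_comm : ∀ i k j l : Fin (n + 1), i < k → j < l → max i.val j.val + 1 < min k.val l.val →
    z i j * z k l = z k l * z i j
  det : (List.ofFn fun i => z i i).prod = 1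
  star_eq : ∀ r s : Fin (n + 1),
    star (z r s) = (List.ofFn fun p : Fin n => z (r.succAbove p) (s.succAbove p)).prod

/-- The defining relations of `A_q(n)` for `0 ≤ q < 1`. -/
structure SURel (n : ℕ) (q : ℝ) {B : Type*} [CStarAlgebra B]
    (z : Fin (n + 1) → Fin (n + 1) → B) : Prop where
  quantum : q ≠ 0 → QuantumRel n q z
  crystal : q = 0 → CrystalRel n z


/-- A row sum identity in the crystallized algebra. -/
theorem crystal_sum {R : Type*} [Ring R] (Z : ℕ → ℕ → R) (n i : ℕ) (hi : i ≤ n)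
    (anti : ∀ i k j l : ℕ, i < k → j < l → k ≤ n → l ≤ n → Z i l * Z k j = Z k j * Z i l)
    (diag : ∀ i k j l : ℕ, i < k → j < l → k ≤ n → l ≤ n → max i j + 1 = min k l →
      Z i j * Z k l - Z k l * Z i j = Z i l * Z k j)
    (comm : ∀ i k j l : ℕ, i < k → j < l → k ≤ n → l ≤ n → max i j + 1 < min k l →
      Z i j * Z k l = Z k l * Z i j) (k : ℕ) (hk : k ≤ i) :
    ∑ m ∈ Finset.range (k + 1), Z i m * (((List.range' 0 m).map fun p => Z p p).prod *
      ((List.range' m (i - m)).map fun p => Z p (p + 1)).prod) =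
    ((List.range' 0 k).map fun p => Z p p).prod * Z i k *
      ((List.range' k (i - k)).map fun p => Z p (p + 1)).prod := by
  induction k with
  | zero => simp
  | succ k ih =>
    rw [Finset.sum_range_succ, ih (by omega)]
    have h1 : Z i (k + 1) * ((List.range' 0 k).map fun p => Z p p).prod =
        ((List.range' 0 k).map fun p => Z p p).prod * Z i (k + 1) := by
      apply Commute.list_prod_right
      intro x hx
      simp only [List.mem_map, List.mem_range'_1] at hx
      obtain ⟨p, hp, rfl⟩ := hx
      exact (comm p i p (k + 1) (by omega) (by omega) hi (by omega) (by omega)).symm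
    have h2 : ((List.range' k (i - k)).map fun p => Z p (p + 1)).prod =
        Z k (k + 1) * ((List.range' (k + 1) (i - (k + 1))).map fun p => Z p (p + 1)).prod := by
      rw [show i - k = (i - (k + 1)) + 1 by omega, List.range'_succ]
      simp
    have h3 := diag k i k (k + 1) (by omega) (by omega) hi (by omega) (by omega)
    have h4 := anti k i k (k + 1) (by omega) (by omega) hi (by omega)
    have h5 : ((List.range' 0 (k + 1)).map fun p => Z p p).prod =
        ((List.range' 0 k).map fun p => Z p p).prod * Z k k := by
      rw [List.range'_1_concat]; simp
    rw [h2, h5]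
    set D := ((List.range' 0 k).map fun p => Z p p).prod
    set E := ((List.range' (k + 1) (i - (k + 1))).map fun p => Z p (p + 1)).prod
    have h6 : Z i (k + 1) * Z k k = Z k k * Z i (k + 1) - Z i k * Z k (k + 1) := by
      rw [← h4, ← h3]; abel
    calc D * Z i k * (Z k (k + 1) * E) + Z i (k + 1) * (D * Z k k * E)
        = D * (Z i k * Z k (k + 1)) * E + (Z i (k + 1) * D) * Z k k * E := by noncomm_ring
      _ = D * (Z i k * Z k (k + 1)) * E + D * (Z i (k + 1) * Z k k) * E := by
          rw [h1]; noncomm_ring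
      _ = D * Z k k * Z i (k + 1) * E := by rw [h6]; noncomm_ring

theorem norm_le_one_of_sum {B : Type*} [CStarAlgebra B] {ι : Type*} (s : Finset ι) (x : ι → B)
    (h : ∑ k ∈ s, x k * star (x k) = 1) (k : ι) (hk : k ∈ s) : ‖x k‖ ≤ 1 := by
  let _ := CStarAlgebra.spectralOrder B
  have _ := CStarAlgebra.spectralOrderedRing B
  rcases subsingleton_or_nontrivial B with hB | hB
  · rw [Subsingleton.elim (x k) 0, norm_zero]; exact zero_le_one
  have h1 : x k * star (x k) ≤ 1 := by
    rw [← h]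
    exact Finset.single_le_sum (f := fun k => x k * star (x k))
      (fun i _ => mul_star_self_nonneg (x i)) hk
  have h2 := CStarAlgebra.norm_le_norm_of_nonneg_of_le (mul_star_self_nonneg (x k)) h1
  rw [CStarRing.norm_self_mul_star, norm_one] at h2
  nlinarith [norm_nonneg (x k)]

theorem crystal_norm_le {n : ℕ} {B : Type*} [CStarAlgebra B] {z : Fin (n + 1) → Fin (n + 1) → B}
    (h : CrystalRel n z) (i k : Fin (n + 1)) : ‖z i k‖ ≤ 1 := by
  let Z : ℕ → ℕ → B := fun a b => if h : a < n + 1 ∧ b < n + 1 then z ⟨a, h.1⟩ ⟨b, h.2⟩ else 0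
  have hZ : ∀ a b (ha : a < n + 1) (hb : b < n + 1), Z a b = z ⟨a, ha⟩ ⟨b, hb⟩ :=
    fun a b ha hb => dif_pos ⟨ha, hb⟩
  have hZ' : ∀ a b : Fin (n + 1), z a b = Z a b := fun a b => (hZ _ _ a.2 b.2).symm
  have hdet : ((List.range' 0 (n + 1)).map fun p => Z p p).prod = 1 := by
    rw [← h.det]
    congr 1
    apply List.ext_getElem
    · simp
    · intro m h1 h2
      simp only [List.getElem_map, List.getElem_range', List.getElem_ofFn, hZ']
      simp
  have hstar : ∀ a b : Fin (n + 1), b ≤ a → star (z a b) =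
      ((List.range' 0 b).map fun p => Z p p).prod *
      ((List.range' b (a - b)).map fun p => Z p (p + 1)).prod *
      ((List.range' (a + 1) (n - a)).map fun p => Z p p).prod := by
    intro a b hab
    rw [h.star_eq, ← List.prod_append, ← List.prod_append]
    congr 1
    have hab' : (b : ℕ) ≤ a := hab
    have ha := a.2
    apply List.ext_getElem
    · simp; omega
    · intro m h1 h2
      simp only [List.getElem_ofFn, List.getElem_append, List.length_append, List.length_map,
        List.length_range', List.getElem_map, List.getElem_range', hZ', Fin.succAbove,
        Fin.lt_def, Fin.val_castSucc]
      simp only [List.length_ofFn] at h1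
      split_ifs <;> first | omega | (simp; try (congr 1 <;> omega)) 
  have hle : ∀ a b : Fin (n + 1), b ≤ a → ‖z a b‖ ≤ 1 := by
    intro a b hab
    have hab' : (b : ℕ) ≤ a := hab
    have ha := a.2
    have hs := crystal_sum Z n a (by omega)
      (fun i k j l hik hjl hk hl => by
        rw [hZ i l (by omega) (by omega), hZ k j (by omega) (by omega)]
        exact h.anti _ _ _ _ hik hjl)
      (fun i k j l hik hjl hk hl hm => by
        rw [hZ i l (by omega) (by omega), hZ k j (by omega) (by omega),
          hZ i j (by omega) (by omega), hZ k l (by omega) (by omega)]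
        exact h.diag _ _ _ _ hik hjl hm)
      (fun i k j l hik hjl hk hl hm => by
        rw [hZ i j (by omega) (by omega), hZ k l (by omega) (by omega)]
        exact h.diag_comm _ _ _ _ hik hjl hm) a le_rfl
    have h1 : ∑ m ∈ Finset.range ((a : ℕ) + 1), Z a m * star (Z a m) = 1 := by
      rw [← hdet, show List.range' 0 (n + 1) = List.range' 0 (((a : ℕ) + 1) + (n - a)) by
        congr 1; omega, ← List.range'_append_1,
        List.map_append, List.prod_append, List.range'_1_concat]
      simp only [Nat.sub_self, List.range'_zero, List.map_nil, List.prod_nil, mul_one] at hs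
      simp only [List.map_append, List.prod_append, List.map_cons, List.map_nil, List.prod_cons,
        List.prod_nil, mul_one, zero_add]
      rw [← hs, Finset.sum_mul]
      apply Finset.sum_congr rfl
      intro m hm
      rw [Finset.mem_range] at hm
      have := hstar a ⟨m, by omega⟩ (by show m ≤ (a : ℕ); omega)
      rw [hZ'] at this
      rw [this]
      simp only [mul_assoc]
    rw [hZ']
    exact norm_le_one_of_sum (Finset.range ((a : ℕ) + 1)) (fun m => Z a m) h1 b
      (by rw [Finset.mem_range]; omega)
  rcases le_total k i with hki | hik
  · exact hle i k hki
  · rw [← norm_star, h.star_eq]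
    have hprod : ∀ L : List B, (∀ x ∈ L, ‖x‖ ≤ 1) → ‖L.prod‖ ≤ 1 := by
      rcases subsingleton_or_nontrivial B with hB | hB
      · intro L _
        rw [Subsingleton.elim L.prod 0, norm_zero]; exact zero_le_one
      intro L
      induction L with
      | nil => intro _; simp
      | cons x L ih =>
        intro hL
        rw [List.prod_cons]
        refine (norm_mul_le _ _).trans (mul_le_one₀ (hL x (by simp)) (norm_nonneg _) (ih ?_))
        intro y hy
        exact hL y (by simp [hy])
    apply hprod
    intro x hx
    rw [List.mem_ofFn] at hx
    obtain ⟨p, rfl⟩ := hx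
    apply hle
    have hik' : (i : ℕ) ≤ k := hik
    simp only [Fin.succAbove, Fin.le_def, Fin.lt_def, Fin.val_castSucc]
    split_ifs <;> simp <;> omega

/-- The relations force the generators to be contractions, so that the universal `C*`-algebra
exists. -/
theorem SURel.norm_le_one {n : ℕ} {q : ℝ} {B : Type*} [CStarAlgebra B]
    {z : Fin (n + 1) → Fin (n + 1) → B} (h : SURel n q z) (i j : Fin (n + 1)) : ‖z i j‖ ≤ 1 := by
  by_cases hq : q = 0
  · exact crystal_norm_le (h.crystal hq) i j
  · exact norm_le_one_of_sum Finset.univ (fun k => z i k)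
      (by simpa using (h.quantum hq).unitary_row i i) j (Finset.mem_univ j)

/-- A non-zero `C*`-algebra together with elements satisfying the relations of `A_q(n)`. -/
structure SUModel (n : ℕ) (q : ℝ) where
  B : Type
  [alg : CStarAlgebra B]
  [nontriv : Nontrivial B]
  z : Fin (n + 1) → Fin (n + 1) → B
  rel : SURel n q z

attribute [instance] SUModel.alg SUModel.nontriv

/-- The `ℓ^∞`-product of all `C*`-algebras with elements satisfying the relations. -/
abbrev SUProduct (n : ℕ) (q : ℝ) : Type 1 := lp (fun M : SUModel n q => M.B) ∞

instance SUProduct.cstarAlgebra (n : ℕ) (q : ℝ) : CStarAlgebra (SUProduct n q) where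

/-- The universal elements satisfying the relations. -/
def SUProduct.gen (n : ℕ) (q : ℝ) (i j : Fin (n + 1)) : SUProduct n q :=
  ⟨fun M => M.z i j, memℓp_infty ⟨1, by rintro _ ⟨M, rfl⟩; exact M.rel.norm_le_one i j⟩⟩

/-- The closed `*`-subalgebra generated by the universal elements. -/
def SUSub (n : ℕ) (q : ℝ) : StarSubalgebra ℂ (SUProduct n q) :=
  (StarAlgebra.adjoin ℂ
    (Set.range fun p : Fin (n + 1) × Fin (n + 1) => SUProduct.gen n q p.1 p.2)).topologicalClosure

/-- `A_q(n)`: the universal unital `C*`-algebra generated by `z_{i,j}`, `1 ≤ i, j ≤ n+1`, subject to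
the defining relations. Its universal property is `SUAlg.existsUnique_lift`. -/
def SUAlg (n : ℕ) (q : ℝ) : Type 1 := SUSub n q

instance SUAlg.cstarAlgebra (n : ℕ) (q : ℝ) : CStarAlgebra (SUAlg n q) :=
  haveI : IsClosed (SUSub n q : Set (SUProduct n q)) :=
    StarSubalgebra.isClosed_topologicalClosure _
  inferInstanceAs (CStarAlgebra (SUSub n q))

/-- The generators `z_{i,j}` of `A_q(n)`. -/
def SUAlg.gen (n : ℕ) (q : ℝ) (i j : Fin (n + 1)) : SUAlg n q :=
  ⟨SUProduct.gen n q i j,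
    StarSubalgebra.le_topologicalClosure _ (StarAlgebra.subset_adjoin _ _ ⟨(i, j), rfl⟩)⟩

/-- The universal property of `A_q(n)`. -/
theorem SUAlg.existsUnique_lift {n : ℕ} {q : ℝ} {B : Type} [CStarAlgebra B]
    {z : Fin (n + 1) → Fin (n + 1) → B} (h : SURel n q z) :
    ∃! φ : SUAlg n q →⋆ₐ[ℂ] B, ∀ i j, φ (SUAlg.gen n q i j) = z i j := by
  refine existsUnique_of_exists_of_unique ?_ ?_
  · rcases subsingleton_or_nontrivial B with hB | hB
    · exact ⟨
        { toFun := fun _ => 0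
          map_one' := Subsingleton.elim _ _
          map_mul' := fun _ _ => Subsingleton.elim _ _
          map_zero' := rfl
          map_add' := fun _ _ => Subsingleton.elim _ _
          commutes' := fun _ => Subsingleton.elim _ _
          map_star' := fun _ => Subsingleton.elim _ _ }, fun _ _ => Subsingleton.elim _ _⟩
    · let M : SUModel n q := { B := B, z := z, rel := h }
      exact ⟨
        { toFun := fun x => (x.1 : SUProduct n q) M
          map_one' := rfl
          map_mul' := fun _ _ => rfl
          map_zero' := rfl
          map_add' := fun _ _ => rfl
          commutes' := fun _ => rfl
          map_star' := fun _ => rfl }, fun _ _ => rfl⟩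
  · intro φ ψ hφ hψ
    have hc : ∀ χ : SUAlg n q →⋆ₐ[ℂ] B, Continuous χ := fun χ => by
      have : LipschitzWith 1 χ := AddMonoidHomClass.lipschitz_of_bound_nnnorm χ 1 fun a => by
        simpa using NonUnitalStarAlgHom.nnnorm_apply_le χ a
      exact this.continuous
    exact StarAlgHom.ext_topologicalClosure
      (S := StarAlgebra.adjoin ℂ
        (Set.range fun p : Fin (n + 1) × Fin (n + 1) => SUProduct.gen n q p.1 p.2))
      (hc φ) (hc ψ) (StarAlgHom.ext_adjoin (by
        rintro ⟨_, _⟩ ⟨p, rfl⟩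
        exact (hφ p.1 p.2).trans (hψ p.1 p.2).symm))

end Algebra

/-! ### The representations `π_{t,w}` -/

section Representations

/-- The Hilbert space `ℓ²(ℕ)^{⊗ l}`, realised as `ℓ²(ℕ^l)`; the elementary tensor
`e_{m_1} ⊗ ⋯ ⊗ e_{m_l}` is the basis vector at `m`. -/
abbrev TensorL2 (l : ℕ) : Type := lp (fun _ : Fin l → ℕ => ℂ) 2

theorem weighted_memlp {X : Type*} {g : X → X} (hg : Function.Injective g) {d : X → ℝ}
    (hd : ∀ x, |d x| ≤ 1) (f : lp (fun _ : X => ℂ) 2) :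
    Memℓp (fun x => (d x : ℂ) * f (g x)) 2 := by
  have h := (memℓp_gen_iff (p := 2) (by simp)).1 (lp.memℓp f)
  refine memℓp_gen ((h.comp_injective hg).of_nonneg_of_le (fun x => by positivity) fun x => ?_)
  have : ‖(d x : ℂ) * f (g x)‖ ≤ ‖f (g x)‖ := by
    rw [norm_mul, Complex.norm_real, Real.norm_eq_abs]
    exact mul_le_of_le_one_left (norm_nonneg _) (hd x)
  exact Real.rpow_le_rpow (norm_nonneg _) this (by simp)

/-- The operator `f ↦ d · (f ∘ g)` on `ℓ²(X)`, for injective `g` and `|d| ≤ 1`. -/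
def weightedComp {X : Type*} (g : X → X) (hg : Function.Injective g) (d : X → ℝ)
    (hd : ∀ x, |d x| ≤ 1) : lp (fun _ : X => ℂ) 2 →L[ℂ] lp (fun _ : X => ℂ) 2 :=
  LinearMap.mkContinuous
    { toFun := fun f => ⟨fun x => (d x : ℂ) * f (g x), weighted_memlp hg hd f⟩
      map_add' := fun f h => by
        ext x
        change (d x : ℂ) * (f (g x) + h (g x)) = d x * f (g x) + d x * h (g x)
        ring
      map_smul' := fun c f => by
        ext x
        change (d x : ℂ) * (c * f (g x)) = c * (d x * f (g x))
        ring } 1 (by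
    intro f
    rw [one_mul]
    have h := (memℓp_gen_iff (p := 2) (by simp)).1 (lp.memℓp f)
    have h' := (memℓp_gen_iff (p := 2) (by simp)).1 (weighted_memlp hg hd f)
    refine lp.norm_le_of_tsum_le (p := 2) (by simp) (norm_nonneg f) ?_
    rw [lp.norm_rpow_eq_tsum (p := 2) (by simp) f]
    refine le_trans ?_ (tsum_comp_le_tsum_of_inj h (fun x => by positivity) hg)
    refine h'.tsum_le_tsum (fun x => ?_) (h.comp_injective hg)
    have : ‖(d x : ℂ) * f (g x)‖ ≤ ‖f (g x)‖ := by
      rw [norm_mul, Complex.norm_real, Real.norm_eq_abs]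
      exact mul_le_of_le_one_left (norm_nonneg _) (hd x)
    exact Real.rpow_le_rpow (norm_nonneg _) this (by simp))

theorem weightedComp_apply {X : Type*} (g : X → X) (hg : Function.Injective g) (d : X → ℝ)
    (hd : ∀ x, |d x| ≤ 1) (f : lp (fun _ : X => ℂ) 2) (x : X) :
    weightedComp g hg d hd f x = (d x : ℂ) * f (g x) := rfl

theorem legShift_injective {l : ℕ} (p : Fin l) :
    Function.Injective fun m : Fin l → ℕ => Function.update m p (m p + 1) := by
  intro m m' h
  funext a
  have ha := congrFun h a
  by_cases hap : a = p
  · subst hap; simpa using ha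
  · simpa [hap] using ha

/-- The backward shift `S` on the `p`-th tensor factor: `S e_0 = 0`, `S e_{m+1} = e_m`. -/
def legShift {l : ℕ} (p : Fin l) : TensorL2 l →L[ℂ] TensorL2 l :=
  weightedComp (fun m => Function.update m p (m p + 1)) (legShift_injective p) (fun _ => 1)
    (fun _ => by simp)

/-- The operator `φ(N)`, `e_m ↦ φ(m) e_m`, on the `p`-th tensor factor. -/
def legDiag {l : ℕ} (p : Fin l) (φ : ℕ → ℝ) (hφ : ∀ m, |φ m| ≤ 1) :
    TensorL2 l →L[ℂ] TensorL2 l :=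
  weightedComp id Function.injective_id (fun m => φ (m p)) (fun m => hφ (m p))

theorem abs_pow_le_one_of_mem {q : ℝ} (hq : q ∈ Set.Ico (0 : ℝ) 1) (m : ℕ) : |q ^ m| ≤ 1 := by
  rw [abs_of_nonneg (pow_nonneg hq.1 m)]
  exact pow_le_one₀ hq.1 hq.2.le

theorem abs_sqrt_le_one_of_mem {q : ℝ} (hq : q ∈ Set.Ico (0 : ℝ) 1) (m : ℕ) :
    |Real.sqrt (1 - q ^ (2 * m))| ≤ 1 := by
  rw [abs_of_nonneg (Real.sqrt_nonneg _), Real.sqrt_le_iff]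
  have := pow_nonneg hq.1 (2 * m)
  constructor <;> linarith

/-- `π_{s_r}^{(q)}(z_{i,j})` for `0 ≤ q < 1`, acting on the `p`-th tensor factor. -/
def letterOp {n : ℕ} {q : ℝ} (hq : q ∈ Set.Ico (0 : ℝ) 1) {l : ℕ} (p : Fin l) (r : Fin n)
    (i j : Fin (n + 1)) : TensorL2 l →L[ℂ] TensorL2 l :=
  if q = 0 then
    if i = r.castSucc ∧ j = r.castSucc then legShift p
    else if i = r.succ ∧ j = r.succ then star (legShift p)
    else if (i = r.castSucc ∧ j = r.succ) ∨ (i = r.succ ∧ j = r.castSucc) then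
      1 - star (legShift p) * legShift p
    else if i = j then 1 else 0
  else
    if i = r.castSucc ∧ j = r.castSucc then
      legShift p * legDiag p (fun m => Real.sqrt (1 - q ^ (2 * m))) (abs_sqrt_le_one_of_mem hq)
    else if i = r.succ ∧ j = r.succ then
      legDiag p (fun m => Real.sqrt (1 - q ^ (2 * m))) (abs_sqrt_le_one_of_mem hq) *
        star (legShift p)
    else if i = r.castSucc ∧ j = r.succ then
      -((q : ℂ) • legDiag p (fun m => q ^ m) (abs_pow_le_one_of_mem hq))
    else if i = r.succ ∧ j = r.castSucc then
      legDiag p (fun m => q ^ m) (abs_pow_le_one_of_mem hq)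
    else if i = j then 1 else 0

/-- The values on generators of a convolution product of two representations that act on different
tensor factors, from the comultiplication `Δ(z_{ij}) = ∑_k z_{ik} ⊗ z_{kj}`, where `k` runs over all
indices if `q ≠ 0` and over `min{i,j} ≤ k ≤ max{i,j}` if `q = 0`. -/
def convMatrix {n : ℕ} (q : ℝ) {R : Type*} [Ring R] (X Y : Fin (n + 1) → Fin (n + 1) → R)
    (i j : Fin (n + 1)) : R :=
  if q = 0 then ∑ k ∈ Finset.Icc (min i j) (max i j), X i k * Y k j else ∑ k, X i k * Y k j

/-- `π_w^{(q)}(z_{i,j})` on `ℓ²(ℕ)^{⊗ l(w)}`, where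
`π_w^{(q)} = π_{s_{i_1}}^{(q)} * ⋯ * π_{s_{i_l}}^{(q)}` for the word `w = s_{i_1} ⋯ s_{i_l}`. -/
def wordOp {n : ℕ} {q : ℝ} (hq : q ∈ Set.Ico (0 : ℝ) 1) (w : List (Fin n)) :
    Fin (n + 1) → Fin (n + 1) → (TensorL2 w.length →L[ℂ] TensorL2 w.length) :=
  (List.finRange w.length).foldr (fun p Y => convMatrix q (letterOp hq p (w.get p)) Y)
    (fun i j => if i = j then 1 else 0)

/-- The scalar `χ_t(z_{i,i})`: it is `t_1` for `i = 1`, `conj(t_n)` for `i = n+1`, and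
`conj(t_{i-1}) t_i` otherwise. -/
def torusChar {n : ℕ} (t : Fin n → Circle) (i : Fin (n + 1)) : ℂ :=
  (if h : i.val < n then (t ⟨i.val, h⟩ : ℂ) else 1) *
    (if h : 0 < i.val then star (t ⟨i.val - 1, by omega⟩ : ℂ) else 1)

/-- `π_{t,w}^{(q)}(z_{i,j})`, where `π_{t,w}^{(q)} = χ_t^{(q)} * π_w^{(q)}`. -/
def torusWordOp {n : ℕ} {q : ℝ} (hq : q ∈ Set.Ico (0 : ℝ) 1) (t : Fin n → Circle)
    (w : List (Fin n)) (i j : Fin (n + 1)) : TensorL2 w.length →L[ℂ] TensorL2 w.length :=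
  torusChar t i • wordOp hq w i j

/-- The word `s_{[a,b]} = s_b s_{b-1} ⋯ s_a`. -/
def blockWord {n : ℕ} (a b : Fin n) : List (Fin n) :=
  ((List.finRange n).filter fun r => a ≤ r ∧ r ≤ b).reverse

/-- The reduced words `w = s_{[a_k,b_k]} ⋯ s_{[a_1,b_1]}` with `b_k < ⋯ < b_1` and `a_i ≤ b_i`. Every
permutation in `S_{n+1}` has exactly one such expression; that of the identity is the empty word. -/
def IsStandardWord {n : ℕ} (w : List (Fin n)) : Prop :=
  ∃ L : List (Fin n × Fin n), (L.map Prod.snd).Pairwise (· < ·) ∧ (∀ p ∈ L, p.1 ≤ p.2) ∧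
    w = L.flatMap fun p => blockWord p.1 p.2

end Representations

end

noncomputable section

/-! ### Shifts and diagonal operators on single tensor legs -/

section LegOperators

variable {l : ℕ}

/-! The closure of the point `π_{t,w}` contains the one-dimensional point `χ_t`. A closed set of the
spectrum is the preimage of a hull, so it suffices that `ker π_{t,w} ⊆ ker χ_t`. For `w ≠ 1` the two
representations are inequivalent because `ℓ²(ℕ)^{⊗ l(w)}` is not one-dimensional, so the singleton
of `π_{t,w}` is not closed. Already `w = s_1` then shows that the spectrum is not `T1`, let alone
Hausdorff.

Kernel inclusion. Far out in `ℕ^l` the shift is almost invertible and `q^N` almost zero, so every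
letter looks like the identity matrix. Concretely, the normalised indicators `ξ_k` of the boxes
`[k+1, 2k+2)^l` satisfy `π(a) ξ_k - χ_t(a) ξ_k → 0` for the generators (`asympEigen_torusWordOp`),
hence for all `a` by density (`asympEigen_torusWordHom`). As the `ξ_k` are unit vectors, `π(a) = 0`
forces `χ_t(a) = 0`.

Existence of the representation. By the universal property one has to check the relations, one
letter at a time: multiplying a solution on the left by a `2 × 2` block on a fresh leg gives a
solution again. For `q > 0` the quadratic relations are equivalent to an `R`-matrix identity, which
is stable under such products (`RMatrixRel.mul`); the determinant is treated by pairing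
permutations, and unitarity is a matrix computation (`QuantumRel.block_mul`). For `q = 0` the
truncated convolution leaves at most two terms in each entry, and every relation is checked by cases
(`CrystalRel.block_mul`).

Irreducibility. The projection onto a closed invariant subspace is a self-adjoint operator `T` that
commutes with all entries, so one must show that `T` is scalar. The last block `s_b ⋯ s_a` of the
standard word is the only one that moves the index `b + 1`, so row `b + 1` of the whole matrix is
that of the last block. Its diagonal entry yields the shift on the first leg of the block; the
factor `q^N` in the other entries can be cancelled, and the argument continues with `s_{b-1} ⋯ s_a`
(`commutesWithLeg_of_descending`). Once `T` commutes with the legs of the block, the block can be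
stripped off and the next one treated (`commutesWithLeg_of_standard`). At `q = 0` the entries on and
below the diagonal suffice. Finally, an operator commuting with all shifts and their adjoints
preserves the vacuum line, hence is scalar (`exists_eq_smul_one_of_commutesWithLeg`). -/

theorem legShift_apply (p : Fin l) (f : TensorL2 l) (m : Fin l → ℕ) :
    legShift p f m = f (Function.update m p (m p + 1)) := by
  simp [legShift, weightedComp_apply]

theorem legDiag_apply (p : Fin l) (φ : ℕ → ℝ) (hφ : ∀ m, |φ m| ≤ 1) (f : TensorL2 l)
    (m : Fin l → ℕ) : legDiag p φ hφ f m = φ (m p) * f m := rfl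

theorem update_pred_succ (p : Fin l) (m : Fin l → ℕ) (h : m p ≠ 0) :
    Function.update (Function.update m p (m p - 1)) p
      (Function.update m p (m p - 1) p + 1) = m := by
  simp [Nat.sub_add_cancel (Nat.one_le_iff_ne_zero.2 h)]

theorem legShift_single (p : Fin l) (m : Fin l → ℕ) :
    legShift p (lp.single 2 m (1 : ℂ)) =
      if m p = 0 then 0 else lp.single 2 (Function.update m p (m p - 1)) (1 : ℂ) := by
  ext x
  rw [legShift_apply, lp.single_apply]
  by_cases h : m p = 0
  · rw [if_pos h, Pi.single_eq_of_ne]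
    · rfl
    · intro hx
      have := congrFun hx p
      simp [h] at this
  · rw [if_neg h, lp.single_apply]
    by_cases hx : x = Function.update m p (m p - 1)
    · subst hx
      rw [update_pred_succ p m h]
      simp
    · rw [Pi.single_eq_of_ne hx, Pi.single_eq_of_ne]
      intro h2
      apply hx
      subst h2
      simp

/-- Coordinates are inner products with basis vectors, so the adjoint is read off from
`legShift_single`. -/
theorem star_legShift_apply (p : Fin l) (f : TensorL2 l) (m : Fin l → ℕ) :
    star (legShift p) f m = if m p = 0 then 0 else f (Function.update m p (m p - 1)) := by
  have h : inner ℂ (lp.single 2 m (1 : ℂ)) (star (legShift p) f) =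
      inner ℂ (legShift p (lp.single 2 m (1 : ℂ))) f := by
    rw [ContinuousLinearMap.star_eq_adjoint, ContinuousLinearMap.adjoint_inner_right]
  rw [lp.inner_single_left, legShift_single] at h
  split_ifs with h0
  · simpa [h0] using h
  · rw [if_neg h0, lp.inner_single_left] at h
    simpa using h

theorem star_legDiag (p : Fin l) (φ : ℕ → ℝ) (hφ : ∀ m, |φ m| ≤ 1) :
    star (legDiag p φ hφ) = legDiag p φ hφ := by
  rw [ContinuousLinearMap.star_eq_adjoint, eq_comm, ContinuousLinearMap.eq_adjoint_iff]
  intro f g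
  rw [lp.inner_eq_tsum, lp.inner_eq_tsum]
  refine tsum_congr fun m => ?_
  simp only [legDiag_apply, RCLike.inner_apply, map_mul, Complex.conj_ofReal]
  ring

theorem legShift_mul_star (p : Fin l) : legShift p * star (legShift p) = 1 := by
  ext f m
  simp [legShift_apply, star_legShift_apply]

theorem commute_legShift_legShift {p p' : Fin l} (h : p ≠ p') :
    Commute (legShift p) (legShift p') := by
  ext f m
  simp [legShift_apply, h, h.symm, Function.update_comm h]

theorem commute_legShift_star {p p' : Fin l} (h : p ≠ p') :
    Commute (legShift p) (star (legShift p')) := by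
  ext f m
  simp [legShift_apply, star_legShift_apply, h, h.symm, Function.update_comm h]

theorem commute_legDiag_legShift {p p' : Fin l} (h : p ≠ p') (φ : ℕ → ℝ) (hφ : ∀ m, |φ m| ≤ 1) :
    Commute (legDiag p φ hφ) (legShift p') := by
  ext f m
  simp [legShift_apply, legDiag_apply, h]

theorem commute_legDiag_legDiag (p p' : Fin l) (φ ψ : ℕ → ℝ) (hφ : ∀ m, |φ m| ≤ 1)
    (hψ : ∀ m, |ψ m| ≤ 1) : Commute (legDiag p φ hφ) (legDiag p' ψ hψ) := by
  ext f m
  simp [legDiag_apply, mul_left_comm]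

end LegOperators

/-! ### The representation of one letter as a 2 × 2 block -/

section Letters

variable {l n : ℕ} {q : ℝ}

/-- The operator `S √(1 - q^{2N})` on the `p`-th leg; it is `S` for `q = 0`. -/
def lowerOp (hq : q ∈ Set.Ico (0 : ℝ) 1) (p : Fin l) : TensorL2 l →L[ℂ] TensorL2 l :=
  legShift p * legDiag p (fun m => Real.sqrt (1 - q ^ (2 * m))) (abs_sqrt_le_one_of_mem hq)

/-- The operator `q^N` on the `p`-th leg; it is `P_0` for `q = 0`. -/
def powOp (hq : q ∈ Set.Ico (0 : ℝ) 1) (p : Fin l) : TensorL2 l →L[ℂ] TensorL2 l :=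
  legDiag p (fun m => q ^ m) (abs_pow_le_one_of_mem hq)

/-- The matrix that agrees with the identity matrix outside of the rows and columns `r`, `r + 1`,
where it is `a b; c d`. -/
def blockMat {R : Type*} [Ring R] (r : Fin n) (a b c d : R) (i j : Fin (n + 1)) : R :=
  if i = r.castSucc ∧ j = r.castSucc then a
  else if i = r.succ ∧ j = r.succ then d
  else if i = r.castSucc ∧ j = r.succ then b
  else if i = r.succ ∧ j = r.castSucc then c
  else if i = j then 1 else 0

theorem lowerOp_zero (h0 : (0 : ℝ) ∈ Set.Ico (0 : ℝ) 1) (p : Fin l) :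
    lowerOp h0 p = legShift p := by
  ext f m
  simp [lowerOp, legShift_apply, legDiag_apply]

theorem star_lowerOp (hq : q ∈ Set.Ico (0 : ℝ) 1) (p : Fin l) : star (lowerOp hq p) =
    legDiag p (fun m => Real.sqrt (1 - q ^ (2 * m))) (abs_sqrt_le_one_of_mem hq) *
      star (legShift p) := by
  rw [lowerOp, star_mul, star_legDiag]

theorem star_powOp (hq : q ∈ Set.Ico (0 : ℝ) 1) (p : Fin l) : star (powOp hq p) = powOp hq p :=
  star_legDiag _ _ _

/-- A uniform description of both regimes: since `0 ^ 0 = 1`, the operator `q^N` becomes `1 - S^* S`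
at `q = 0`, and only the upper right entry of the block still distinguishes the two cases. -/
theorem letterOp_eq (hq : q ∈ Set.Ico (0 : ℝ) 1) (p : Fin l) (r : Fin n) :
    letterOp hq p r = blockMat r (lowerOp hq p)
      (if q = 0 then powOp hq p else -((q : ℂ) • powOp hq p)) (powOp hq p)
      (star (lowerOp hq p)) := by
  funext i j
  by_cases h : q = 0
  · subst h
    have hP : 1 - star (legShift p) * legShift p = powOp hq p := by
      ext f m
      by_cases h0 : m p = 0
      · simp [powOp, star_legShift_apply, legDiag_apply, h0]
      · have := update_pred_succ p m h0
        simp [powOp, legShift_apply, star_legShift_apply, legDiag_apply, h0,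
          Nat.sub_add_cancel (Nat.one_le_iff_ne_zero.2 h0)]
    simp only [letterOp, blockMat, lowerOp_zero, hP, if_true]
    split_ifs <;> first | rfl | tauto
  · simp only [letterOp, blockMat, h, if_false, star_lowerOp]
    rfl

theorem one_sub_pow_nonneg (hq : q ∈ Set.Ico (0 : ℝ) 1) (m : ℕ) : 0 ≤ 1 - q ^ (2 * m) := by
  have := pow_le_one₀ (n := 2 * m) hq.1 hq.2.le
  linarith

theorem lowerOp_mul_powOp (hq : q ∈ Set.Ico (0 : ℝ) 1) (p : Fin l) :
    lowerOp hq p * powOp hq p = (q : ℂ) • (powOp hq p * lowerOp hq p) := by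
  ext f m
  simp only [lowerOp, powOp, smul_apply, mul_apply_eq_comp, lp.coeFn_smul, Pi.smul_apply,
    legShift_apply, legDiag_apply, Function.update_self, smul_eq_mul]
  push_cast
  ring

theorem lowerOp_mul_star (hq : q ∈ Set.Ico (0 : ℝ) 1) (p : Fin l) :
    lowerOp hq p * star (lowerOp hq p) + ((q : ℂ) ^ 2) • (powOp hq p * powOp hq p) = 1 := by
  ext f m
  rw [star_lowerOp]
  have h : ((Real.sqrt (1 - q ^ (2 * (m p + 1))) : ℝ) : ℂ) *
      (Real.sqrt (1 - q ^ (2 * (m p + 1))) : ℝ) = 1 - (q : ℂ) ^ (2 * (m p + 1)) := by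
    rw [← Complex.ofReal_mul, Real.mul_self_sqrt (one_sub_pow_nonneg hq _)]
    simp
  simp only [lowerOp, powOp, add_apply, smul_apply,
    mul_apply_eq_comp, lp.coeFn_add, lp.coeFn_smul, Pi.add_apply, Pi.smul_apply,
    legShift_apply, legDiag_apply, star_legShift_apply, one_apply_eq_self,
    Function.update_self, Function.update_idem, Function.update_eq_self, smul_eq_mul,
    Nat.add_sub_cancel, Nat.succ_ne_zero, if_false, ← mul_assoc, h]
  push_cast
  ring

theorem star_mul_lowerOp (hq : q ∈ Set.Ico (0 : ℝ) 1) (p : Fin l) :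
    star (lowerOp hq p) * lowerOp hq p + powOp hq p * powOp hq p = 1 := by
  ext f m
  rw [star_lowerOp]
  have h : ((Real.sqrt (1 - q ^ (2 * m p)) : ℝ) : ℂ) *
      (Real.sqrt (1 - q ^ (2 * m p)) : ℝ) = 1 - (q : ℂ) ^ (2 * m p) := by
    rw [← Complex.ofReal_mul, Real.mul_self_sqrt (one_sub_pow_nonneg hq _)]
    simp
  by_cases h0 : m p = 0
  · simp [lowerOp, powOp, legDiag_apply, star_legShift_apply, h0]
  · simp only [lowerOp, powOp, add_apply,
      mul_apply_eq_comp, lp.coeFn_add, Pi.add_apply,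
      legShift_apply, legDiag_apply, star_legShift_apply, one_apply_eq_self,
      Function.update_self, Function.update_idem, Function.update_eq_self,
      Nat.sub_add_cancel (Nat.one_le_iff_ne_zero.2 h0), h0, if_false, ← mul_assoc, h]
    push_cast
    ring

/-- The operators on the `p`-th leg commute with the operators on other legs. -/
theorem commute_of_legs {p : Fin l} {X : TensorL2 l →L[ℂ] TensorL2 l} (hq : q ∈ Set.Ico (0 : ℝ) 1)
    (hS : Commute X (legShift p)) (hS' : Commute X (star (legShift p)))
    (hD : ∀ φ hφ, Commute X (legDiag p φ hφ)) (r : Fin n) (i j : Fin (n + 1)) :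
    Commute X (letterOp hq p r i j) := by
  rw [letterOp_eq, blockMat]
  have h1 : Commute X (lowerOp hq p) := hS.mul_right (hD _ _)
  have h2 : Commute X (star (lowerOp hq p)) := by
    rw [star_lowerOp]; exact (hD _ _).mul_right hS'
  have h3 : Commute X (powOp hq p) := hD _ _
  split_ifs
  exacts [h1, h2, h3, (h3.smul_right _).neg_right, h3, Commute.one_right _, Commute.zero_right _]

theorem commute_letterOp {p p' : Fin l} (hq : q ∈ Set.Ico (0 : ℝ) 1) (h : p ≠ p') (r r' : Fin n)
    (i j i' j' : Fin (n + 1)) : Commute (letterOp hq p r i j) (letterOp hq p' r' i' j') := by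
  -- The adjoint form of `commute_legDiag_legShift`, as diagonal operators are self-adjoint.
  have key : ∀ {p p' : Fin l}, p ≠ p' → ∀ φ hφ,
      Commute (legDiag p φ hφ) (star (legShift p')) := fun {p p'} h φ hφ => by
    have := (commute_legDiag_legShift h φ hφ).star_star
    rwa [star_legDiag] at this
  refine commute_of_legs hq ?_ ?_ (fun φ hφ => ?_) _ _ _ <;> refine Commute.symm ?_ <;>
    refine commute_of_legs hq ?_ ?_ (fun ψ hψ => ?_) _ _ _
  · exact commute_legShift_legShift h.symm
  · exact commute_legShift_star h.symm
  · exact (commute_legDiag_legShift h _ _).symm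
  · exact (commute_legShift_star h).symm
  · exact (commute_legShift_legShift h.symm).star_star
  · exact (key h _ _).symm
  · exact commute_legDiag_legShift h.symm _ _
  · exact key h.symm _ _
  · exact commute_legDiag_legDiag _ _ _ _ _ _

end Letters

/-! ### Matrices that differ from the identity in one 2 × 2 block -/

section BlockMatrices

variable {n : ℕ}

theorem castSucc_or_succ (r : Fin n) (i : Fin (n + 1)) :
    i = r.castSucc ∨ i = r.succ ∨ (i ≠ r.castSucc ∧ i ≠ r.succ) := by
  tauto

section

variable {R : Type*} [Ring R]

theorem sum_blockMat_castSucc (r : Fin n) (a b c d : R) (y : Fin (n + 1) → R) :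
    ∑ k, blockMat r a b c d r.castSucc k * y k = a * y r.castSucc + b * y r.succ := by
  have h : r.castSucc ≠ r.succ := r.castSucc_lt_succ.ne
  rw [Fintype.sum_eq_add r.castSucc r.succ h]
  · simp [blockMat, h, h.symm]
  · rintro x ⟨h1, h2⟩
    simp [blockMat, h1, h2, h1.symm]

theorem sum_blockMat_succ (r : Fin n) (a b c d : R) (y : Fin (n + 1) → R) :
    ∑ k, blockMat r a b c d r.succ k * y k = c * y r.castSucc + d * y r.succ := by
  have h : r.castSucc ≠ r.succ := r.castSucc_lt_succ.ne
  rw [Fintype.sum_eq_add r.castSucc r.succ h]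
  · simp [blockMat, h, h.symm]
  · rintro x ⟨h1, h2⟩
    simp [blockMat, h1, h2, h2.symm]

theorem sum_blockMat_of_ne (r : Fin n) (a b c d : R) {i : Fin (n + 1)} (h1 : i ≠ r.castSucc)
    (h2 : i ≠ r.succ) (y : Fin (n + 1) → R) : ∑ k, blockMat r a b c d i k * y k = y i := by
  simp [blockMat, h1, h2]

theorem blockMat_mul (r : Fin n) (a b c d a' b' c' d' : R) (i j : Fin (n + 1)) :
    ∑ k, blockMat r a b c d i k * blockMat r a' b' c' d' k j =
      blockMat r (a * a' + b * c') (a * b' + b * d') (c * a' + d * c') (c * b' + d * d') i j := by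
  have h := r.castSucc_lt_succ.ne
  rcases castSucc_or_succ r i with rfl | rfl | ⟨hi, hi'⟩
  · rw [sum_blockMat_castSucc]
    rcases castSucc_or_succ r j with rfl | rfl | ⟨hj, hj'⟩
    · simp [blockMat, h, h.symm]
    · simp [blockMat, h, h.symm]
    · simp [blockMat, hj, hj', hj.symm, hj'.symm]
  · rw [sum_blockMat_succ]
    rcases castSucc_or_succ r j with rfl | rfl | ⟨hj, hj'⟩
    · simp [blockMat, h, h.symm]
    · simp [blockMat, h, h.symm]
    · simp [blockMat, hj, hj', hj.symm, hj'.symm]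
  · rw [sum_blockMat_of_ne _ _ _ _ _ hi hi']
    simp [blockMat, hi, hi']

theorem blockMat_one (r : Fin n) (i j : Fin (n + 1)) :
    blockMat r (1 : R) 0 0 1 i j = if i = j then 1 else 0 := by
  have h := r.castSucc_lt_succ.ne
  simp only [blockMat]
  split_ifs <;> grind

theorem star_blockMat [StarRing R] (r : Fin n) (a b c d : R) (i j : Fin (n + 1)) :
    star (blockMat r a b c d i j) =
      blockMat r (star a) (star c) (star b) (star d) j i := by
  have h := r.castSucc_lt_succ.ne
  simp only [blockMat]
  split_ifs <;> first | (simp; done) | (exfalso; grind)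

theorem blockMat_commute {r : Fin n} {a b c d x : R} (ha : Commute a x) (hb : Commute b x)
    (hc : Commute c x) (hd : Commute d x) (i j : Fin (n + 1)) :
    Commute (blockMat r a b c d i j) x := by
  simp only [blockMat]
  split_ifs
  exacts [ha, hd, hb, hc, Commute.one_left _, Commute.zero_left _]

end

section

variable {R : Type*} [Ring R] {a b c d : R}

theorem blockMat_row [Algebra ℂ R] {q : ℂ} (r : Fin n) (h1 : a * b = q • (b * a)) (h2 : c * d = q • (d * c))
    (i j l : Fin (n + 1)) (hjl : j < l) : blockMat r a b c d i j * blockMat r a b c d i l =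
      q • (blockMat r a b c d i l * blockMat r a b c d i j) := by
  have h : r.castSucc ≠ r.succ := r.castSucc_lt_succ.ne
  simp only [blockMat]
  split_ifs <;> grind [Fin.castSucc_lt_succ, smul_zero, mul_zero, zero_mul]

theorem blockMat_col [Algebra ℂ R] {q : ℂ} (r : Fin n) (h1 : a * c = q • (c * a)) (h2 : b * d = q • (d * b))
    (i k j : Fin (n + 1)) (hik : i < k) : blockMat r a b c d i j * blockMat r a b c d k j =
      q • (blockMat r a b c d k j * blockMat r a b c d i j) := by
  have h : r.castSucc ≠ r.succ := r.castSucc_lt_succ.ne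
  simp only [blockMat]
  split_ifs <;> grind [Fin.castSucc_lt_succ, smul_zero, mul_zero, zero_mul]

theorem blockMat_anti (r : Fin n) (h1 : b * c = c * b) (i k j l : Fin (n + 1)) (hik : i < k)
    (hjl : j < l) : blockMat r a b c d i l * blockMat r a b c d k j =
      blockMat r a b c d k j * blockMat r a b c d i l := by
  have h := r.castSucc_lt_succ
  rcases castSucc_or_succ r i with rfl | rfl | ⟨hi, hi'⟩ <;>
  rcases castSucc_or_succ r k with rfl | rfl | ⟨hk, hk'⟩ <;>
  rcases castSucc_or_succ r j with rfl | rfl | ⟨hj, hj'⟩ <;>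
  rcases castSucc_or_succ r l with rfl | rfl | ⟨hl, hl'⟩ <;>
  first
  | exact absurd hik (lt_irrefl _)
  | exact absurd hjl (lt_irrefl _)
  | exact absurd hik h.not_gt
  | exact absurd hjl h.not_gt
  | (simp [blockMat, h.ne, h.ne', *]; done)
  | (simp only [blockMat, *, h.ne, h.ne', and_false, if_false]
     split_ifs <;> simp)

theorem blockMat_diag [Algebra ℂ R] {q : ℂ} (r : Fin n) (h1 : a * d - d * a = (q - q⁻¹) • (b * c))
    (i k j l : Fin (n + 1)) (hik : i < k) (hjl : j < l) :
    blockMat r a b c d i j * blockMat r a b c d k l -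
      blockMat r a b c d k l * blockMat r a b c d i j =
      (q - q⁻¹) • (blockMat r a b c d i l * blockMat r a b c d k j) := by
  have h := r.castSucc_lt_succ
  -- Lets `omega` exclude an index strictly between `r` and `r + 1`.
  have hv : (r.castSucc : ℕ) + 1 = r.succ := by simp
  rcases castSucc_or_succ r i with rfl | rfl | ⟨hi, hi'⟩ <;>
  rcases castSucc_or_succ r k with rfl | rfl | ⟨hk, hk'⟩ <;>
  rcases castSucc_or_succ r j with rfl | rfl | ⟨hj, hj'⟩ <;>
  rcases castSucc_or_succ r l with rfl | rfl | ⟨hl, hl'⟩ <;>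
  first
  | exact absurd hik (lt_irrefl _)
  | exact absurd hjl (lt_irrefl _)
  | exact absurd hik h.not_gt
  | exact absurd hjl h.not_gt
  | (simp [blockMat, h.ne, h.ne', *]; done)
  | (simp only [blockMat, *, h.ne, h.ne', false_and, and_false, if_false]
     split_ifs <;> first | (simp; done) | (exfalso; clear h1; omega))

end

end BlockMatrices

/-! ### The quadratic relations as an R-matrix identity -/

section RMatrix

/-- The relation `R z₁ z₂ = z₂ z₁ R` for the `R`-matrix of type `A`, in coordinates. -/
def RMatrixRel {N : ℕ} {B : Type*} [Ring B] [Algebra ℂ B] (q : ℂ) (z : Fin N → Fin N → B) : Prop :=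
  ∀ i k j l, (if i = k then q else 1) • (z i j * z k l) +
      (if k < i then q - q⁻¹ else 0) • (z k j * z i l) =
    (if j = l then q else 1) • (z k l * z i j) + (if j < l then q - q⁻¹ else 0) • (z k j * z i l)

variable {N : ℕ} {B : Type*} [Ring B] [Algebra ℂ B] {q : ℂ}

/-- The nine relative positions of `(i, k)` and `(j, l)` reproduce the four families of relations.
The two orders of one relation differ by a factor `q`, which the term with `q - q⁻¹` absorbs through
`(q - q⁻¹) q = q² - 1`. -/
theorem RMatrixRel.of_relations {z : Fin N → Fin N → B} (hq : q ≠ 0)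
    (row : ∀ i j l, j < l → z i j * z i l = q • (z i l * z i j))
    (col : ∀ i k j, i < k → z i j * z k j = q • (z k j * z i j))
    (anti : ∀ i k j l, i < k → j < l → z i l * z k j = z k j * z i l)
    (diag : ∀ i k j l, i < k → j < l →
      z i j * z k l - z k l * z i j = (q - q⁻¹) • (z i l * z k j)) : RMatrixRel q z := by
  intro i k j l
  have h1 : (q - q⁻¹) * q = q * q - 1 := by field_simp
  rcases lt_trichotomy i k with hik | rfl | hik
  · rcases lt_trichotomy j l with hjl | rfl | hjl
    · have := diag i k j l hik hjl
      rw [anti i k j l hik hjl] at this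
      simp [hik.ne, hjl.ne, hik.not_gt, hjl, ← this]
    · simp [hik.ne, hik.not_gt, col i k j hik]
    · simp [hik.ne, hik.not_gt, hjl.ne', hjl.not_gt, anti i k l j hik hjl]
  · rcases lt_trichotomy j l with hjl | rfl | hjl
    · simp only [if_true, lt_irrefl, hjl.ne, hjl, if_false, zero_smul, add_zero, one_smul,
        row i j l hjl]
      rw [smul_smul, smul_smul, h1, sub_smul]
      simp
    · simp
    · simp [hjl.ne', hjl.not_gt, row i l j hjl]
  · rcases lt_trichotomy j l with hjl | rfl | hjl
    · simp [hik.ne', hjl.ne, hik, hjl, anti k i j l hik hjl]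
    · simp only [if_true, lt_irrefl, hik.ne', hik, if_false, zero_smul, add_zero, one_smul,
        col k i j hik]
      rw [smul_smul, h1, sub_smul, smul_smul]
      simp
    · have := diag k i l j hik hjl
      simp [hik.ne', hjl.ne', hik, hjl.not_gt, ← this]

theorem RMatrixRel.row {z : Fin N → Fin N → B} (h : RMatrixRel q z)
    (i j l : Fin N) (hjl : j < l) : z i j * z i l = q • (z i l * z i j) := by
  have := h i i l j
  simpa [hjl.ne', hjl.not_gt] using this.symm

theorem RMatrixRel.col {z : Fin N → Fin N → B} (h : RMatrixRel q z)
    (i k j : Fin N) (hik : i < k) : z i j * z k j = q • (z k j * z i j) := by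
  have := h i k j j
  simpa [hik.ne, hik.not_gt] using this

theorem RMatrixRel.anti {z : Fin N → Fin N → B} (h : RMatrixRel q z)
    (i k j l : Fin N) (hik : i < k) (hjl : j < l) : z i l * z k j = z k j * z i l := by
  have := h i k l j
  simpa [hik.ne, hik.not_gt, hjl.ne', hjl.not_gt] using this

theorem RMatrixRel.diag {z : Fin N → Fin N → B} (h : RMatrixRel q z)
    (i k j l : Fin N) (hik : i < k) (hjl : j < l) :
    z i j * z k l - z k l * z i j = (q - q⁻¹) • (z i l * z k j) := by
  have := h i k j l
  rw [h.anti i k j l hik hjl, sub_eq_iff_eq_add']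
  simpa [hik.ne, hik.not_gt, hjl.ne, hjl] using this

/-- This is `R x₁x₂y₁y₂ = x₂x₁ R y₁y₂ = x₂x₁y₂y₁ R`: commuting entries allow the `x`'s and the `y`'s
to be grouped, and `R` passes through one group after the other. -/
theorem RMatrixRel.mul {x y : Fin N → Fin N → B} (hx : RMatrixRel q x) (hy : RMatrixRel q y)
    (hc : ∀ i j k l, Commute (x i j) (y k l)) : RMatrixRel q fun i j => ∑ k, x i k * y k j := by
  have hmul : ∀ i j k l, (∑ a, x i a * y a j) * ∑ b, x k b * y b l =
      ∑ a, ∑ b, (x i a * x k b) * (y a j * y b l) := fun i j k l => by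
    rw [Finset.sum_mul_sum]
    refine Finset.sum_congr rfl fun a _ => Finset.sum_congr rfl fun b _ => ?_
    rw [mul_assoc, ← mul_assoc (y a j), ← (hc k b a j).eq]
    simp only [mul_assoc]
  intro i k j l
  simp only [hmul]
  -- `R` has passed the `x`'s and now stands in front of the `y`'s; the term without `q - q⁻¹` needs
  -- the summation indices exchanged.
  have hL : ∑ a, ∑ b, ((if i = k then q else 1) • (x i a * x k b) +
      (if k < i then q - q⁻¹ else 0) • (x k a * x i b)) * (y a j * y b l) =
      ∑ a, ∑ b, (x k a * x i b) * ((if b = a then q else 1) • (y b j * y a l) +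
        (if a < b then q - q⁻¹ else 0) • (y a j * y b l)) := by
    simp only [hx i k, add_mul, mul_add, Finset.sum_add_distrib, smul_mul_assoc, mul_smul_comm]
    congr 1
    rw [Finset.sum_comm]
  simp only [hy _ _ j l] at hL
  simpa only [add_mul, mul_add, Finset.sum_add_distrib, smul_mul_assoc, mul_smul_comm,
    ← Finset.smul_sum] using hL

end RMatrix

/-! ### Inversions and cancellation in the quantum determinant -/

section QuantumDeterminant

variable {n : ℕ}

/-- The list of all indices splits around two adjacent indices. -/
theorem exists_finRange_split {N : ℕ} {a b : Fin N} (hab : b.val = a.val + 1) :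
    ∃ A C : List (Fin N), (∀ x ∈ A, x ≠ a ∧ x ≠ b) ∧ (∀ x ∈ C, x ≠ a ∧ x ≠ b) ∧
    List.finRange N = A ++ a :: b :: C := by
  obtain ⟨b, hb⟩ := b
  simp only at hab
  subst hab
  have hnd := List.nodup_finRange N
  have h : List.finRange N = (List.finRange N).take a ++
      a :: ⟨a + 1, hb⟩ :: (List.finRange N).drop (a + 2) := by
    conv_lhs => rw [← List.take_append_drop a (List.finRange N)]
    rw [List.drop_eq_getElem_cons (by simp), List.drop_eq_getElem_cons (by simp; omega)]
    simp only [List.getElem_finRange]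
    rfl
  refine ⟨_, _, ?_, ?_, h⟩ <;>
  · rw [h] at hnd
    intro x hx
    simp only [List.nodup_append, List.nodup_cons] at hnd
    grind

/-- The map `s × s` carries the inversions of `σ` to those of `σ s` other than the pair `(r, r + 1)`
itself, which is the one new inversion. -/
theorem invCount_mul_swap (r : Fin n) (σ : Equiv.Perm (Fin (n + 1)))
    (h : σ r.castSucc < σ r.succ) :
    invCount (σ * Equiv.swap r.castSucc r.succ) = invCount σ + 1 := by
  set s := Equiv.swap r.castSucc r.succ with hs
  have hr := r.castSucc_lt_succ
  have hv : (r.succ : ℕ) = r.castSucc + 1 := by simp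
  -- A transposition of neighbours reverses the order of no pair besides its own.
  have key : ∀ x y : Fin (n + 1), x < y → (x, y) ≠ (r.castSucc, r.succ) → s x < s y := by
    intro x y hxy hne
    simp only [hs, Equiv.swap_apply_def]
    simp only [ne_eq, Prod.mk.injEq, not_and] at hne
    split_ifs <;> grind
  have hss : ∀ x, s (s x) = x := Equiv.swap_apply_self _ _
  have hsr : s r.castSucc = r.succ := Equiv.swap_apply_left _ _
  have hsr' : s r.succ = r.castSucc := Equiv.swap_apply_right _ _
  have hset : (Finset.univ.filter fun p : Fin (n + 1) × Fin (n + 1) =>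
      p.1 < p.2 ∧ (σ * s) p.2 < (σ * s) p.1) = insert (r.castSucc, r.succ)
      ((Finset.univ.filter fun p : Fin (n + 1) × Fin (n + 1) =>
        p.1 < p.2 ∧ σ p.2 < σ p.1).map (s.prodCongr s).toEmbedding) := by
    ext ⟨x, y⟩
    simp only [Finset.mem_filter, Finset.mem_univ, true_and, Finset.mem_insert, Finset.mem_map,
      Equiv.coe_toEmbedding, Equiv.prodCongr_apply, Prod.exists, Prod.map_apply, Prod.mk.injEq]
    change (x < y ∧ σ (s y) < σ (s x)) ↔ _
    constructor
    · rintro ⟨hxy, hσ⟩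
      by_cases he : (x, y) = (r.castSucc, r.succ)
      · left; simpa using he
      · exact Or.inr ⟨s x, s y, ⟨key x y hxy he, hσ⟩, hss x, hss y⟩
    · rintro (⟨rfl, rfl⟩ | ⟨u, v, ⟨huv, hσ⟩, rfl, rfl⟩)
      · exact ⟨hr, by rwa [hsr, hsr']⟩
      · rw [hss, hss]
        refine ⟨key u v huv ?_, hσ⟩
        rintro he
        simp only [Prod.mk.injEq] at he
        rw [he.1, he.2] at hσ
        exact lt_asymm h hσ
  rw [invCount, invCount, hset, Finset.card_insert_of_notMem, Finset.card_map]
  simp only [Finset.mem_map, Finset.mem_filter, Finset.mem_univ, true_and, Prod.exists,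
    Equiv.coe_toEmbedding, Equiv.prodCongr_apply, Prod.map_apply, Prod.mk.injEq, not_exists,
    not_and]
  rintro u v ⟨huv, -⟩ hu hv'
  rw [← hss u, ← hss v, hu, hv', hsr, hsr'] at huv
  exact lt_asymm hr huv

variable {B : Type*} [Ring B] [Algebra ℂ B] {q : ℂ}

/-- The terms of `σ` and `σ s_r` agree outside the two rows, and their weights differ by a factor
`-q`; the relation `h c d = q h d c` makes each such pair cancel. It is applied to the change that a
block causes in the product of two adjacent rows. -/
theorem sum_perm_eq_zero (r : Fin n) {A C : List (Fin (n + 1))}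
    (hA : ∀ x ∈ A, x ≠ r.castSucc ∧ x ≠ r.succ) (hC : ∀ x ∈ C, x ≠ r.castSucc ∧ x ≠ r.succ)
    (z : Fin (n + 1) → Fin (n + 1) → B) (h : Fin (n + 1) → Fin (n + 1) → B)
    (hh : ∀ c d, c < d → h c d = q • h d c) :
    ∑ σ : Equiv.Perm (Fin (n + 1)), (-q) ^ invCount σ • ((A.map fun i => z i (σ i)).prod *
      h (σ r.castSucc) (σ r.succ) * (C.map fun i => z i (σ i)).prod) = 0 := by
  have hr : r.castSucc ≠ r.succ := r.castSucc_lt_succ.ne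
  have hL : ∀ D : List (Fin (n + 1)), (∀ x ∈ D, x ≠ r.castSucc ∧ x ≠ r.succ) →
      ∀ σ : Equiv.Perm (Fin (n + 1)),
      (D.map fun i => z i ((σ * Equiv.swap r.castSucc r.succ) i)).prod =
        (D.map fun i => z i (σ i)).prod := fun D hD σ => by
    congr 1
    refine List.map_congr_left fun x hx => ?_
    rw [Equiv.Perm.mul_apply, Equiv.swap_apply_of_ne_of_ne (hD x hx).1 (hD x hx).2]
  have hpair : ∀ σ : Equiv.Perm (Fin (n + 1)), σ r.castSucc < σ r.succ →
      (-q) ^ invCount σ • ((A.map fun i => z i (σ i)).prod *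
        h (σ r.castSucc) (σ r.succ) * (C.map fun i => z i (σ i)).prod) +
      (-q) ^ (invCount σ + 1) • ((A.map fun i => z i (σ i)).prod *
        h (σ r.succ) (σ r.castSucc) * (C.map fun i => z i (σ i)).prod) = 0 := fun σ hσ => by
    rw [hh _ _ hσ, pow_succ, mul_smul, mul_smul_comm, smul_mul_assoc, ← smul_add, neg_smul,
      add_neg_cancel, smul_zero]
  refine Finset.sum_involution (fun σ _ => σ * Equiv.swap r.castSucc r.succ) ?_ ?_
    (fun _ _ => Finset.mem_univ _) ?_
  · intro σ _
    rcases lt_or_gt_of_ne (σ.injective.ne hr) with hσ | hσ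
    · rw [hL A hA, hL C hC, invCount_mul_swap r σ hσ]
      simpa using hpair σ hσ
    · have h1 : (σ * Equiv.swap r.castSucc r.succ) r.castSucc <
          (σ * Equiv.swap r.castSucc r.succ) r.succ := by simpa using hσ
      have h2 := hpair _ h1
      rw [← invCount_mul_swap r _ h1] at h2
      simp only [hL A hA, hL C hC, mul_assoc, Equiv.swap_mul_self, mul_one] at h2
      rw [hL A hA, hL C hC, add_comm]
      simpa [mul_assoc] using h2
  · intro σ _ _ he
    have := congrArg (fun τ : Equiv.Perm (Fin (n + 1)) => σ⁻¹ (τ r.castSucc)) he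
    simp at this
    exact hr this.symm
  · intro σ _
    simp [mul_assoc]

end QuantumDeterminant

/-! ### Stability of the relations for q > 0 under a block -/

section Product

variable {n : ℕ} {B : Type*} [CStarAlgebra B] {q : ℝ} {y : Fin (n + 1) → Fin (n + 1) → B}

/-- Multiplication by a `2 × 2` block that satisfies the relations of `SU_q(2)` preserves the
relations of `SU_q(n+1)`. -/
theorem QuantumRel.block_mul (hy : QuantumRel n q y) (hq : q ≠ 0) (r : Fin n) {a c : B}
    (hc : star c = c) (hac : a * c = (q : ℂ) • (c * a))
    (h1 : a * star a + ((q : ℂ) ^ 2) • (c * c) = 1) (h2 : star a * a + c * c = 1)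
    (hca : ∀ i j, Commute a (y i j)) (hca' : ∀ i j, Commute (star a) (y i j))
    (hcc : ∀ i j, Commute c (y i j)) :
    QuantumRel n q fun i j => ∑ k, blockMat r a (-((q : ℂ) • c)) c (star a) i k * y k j := by
  have hq' : (q : ℂ) ≠ 0 := by exact_mod_cast hq
  have hca2 : c * star a = (q : ℂ) • (star a * c) := by
    have := congrArg star hac
    simpa [hc] using this
  have hR : RMatrixRel (q : ℂ) fun i j => ∑ k, blockMat r a (-((q : ℂ) • c)) c (star a) i k * y k j := by
    refine RMatrixRel.mul (RMatrixRel.of_relations hq' (blockMat_row r ?_ ?_) (blockMat_col r ?_ ?_)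
      (blockMat_anti r ?_) (blockMat_diag r ?_))
      (RMatrixRel.of_relations hq' hy.row hy.col hy.anti hy.diag)
      (fun i j k l => blockMat_commute (hca _ _) ((hcc _ _).smul_left _).neg_left (hcc _ _)
        (hca' _ _) _ _)
    · simp [hac]
    · exact hca2
    · exact hac
    · simp [hca2]
    · simp
    · rw [eq_sub_of_add_eq h1, eq_sub_of_add_eq h2, neg_mul, smul_mul_assoc, smul_neg, smul_smul,
        sub_mul, inv_mul_cancel₀ hq', sub_smul, pow_two, one_smul]
      abel
  refine ⟨hR.row, hR.col, hR.anti, hR.diag, ?_, ?_, ?_⟩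
  · obtain ⟨A, C, hA, hC, hAC⟩ := exists_finRange_split (N := n + 1) (a := r.castSucc) (b := r.succ) (by simp)
    have hsplit : ∀ f : Fin (n + 1) → B, (List.ofFn f).prod =
        (A.map f).prod * (f r.castSucc * f r.succ) * (C.map f).prod := fun f => by
      rw [List.ofFn_eq_map, hAC]
      simp [mul_assoc]
    rw [← hy.det, ← sub_eq_zero, ← Finset.sum_sub_distrib]
    -- Only the factors from the rows `r` and `r + 1` change, so the difference of the two
    -- determinants has the form treated there, with the change of their product as `h`.
    rw [← sum_perm_eq_zero (q := (q : ℂ)) r hA hC y (fun u v =>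
      (a * y r.castSucc u + (-((q : ℂ) • c)) * y r.succ u) *
        (c * y r.castSucc v + star a * y r.succ v) - y r.castSucc u * y r.succ v)]
    · refine Finset.sum_congr rfl fun σ _ => ?_
      rw [hsplit, hsplit, ← smul_sub, sum_blockMat_castSucc, sum_blockMat_succ]
      have hD : ∀ D : List (Fin (n + 1)), (∀ x ∈ D, x ≠ r.castSucc ∧ x ≠ r.succ) →
          (D.map fun i => ∑ k, blockMat r a (-((q : ℂ) • c)) c (star a) i k * y k (σ i)) =
          D.map fun i => y i (σ i) := fun D hD => List.map_congr_left fun x hx =>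
        sum_blockMat_of_ne r _ _ _ _ (hD x hx).1 (hD x hx).2 _
      rw [hD A hA, hD C hC, mul_sub, sub_mul]
    · intro u v huv
      -- With the block entries moved to the left, each of the four terms is ordered by the
      -- relations of `y`; comparing coefficients then gives the exchange rule for `h`.
      have hexp : ∀ u v, (a * y r.castSucc u + (-((q : ℂ) • c)) * y r.succ u) *
          (c * y r.castSucc v + star a * y r.succ v) - y r.castSucc u * y r.succ v =
          (a * c) * (y r.castSucc u * y r.castSucc v)
          - (q : ℂ) • ((c * star a) * (y r.succ u * y r.succ v)) +
          (a * star a - 1) * (y r.castSucc u * y r.succ v) -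
          (q : ℂ) • ((c * c) * (y r.succ u * y r.castSucc v)) := fun u v => by
        have e1 : ∀ i j x, y i j * (a * x) = a * (y i j * x) := fun i j x => by
          rw [← mul_assoc, ← (hca i j).eq, mul_assoc]
        have e2 : ∀ i j x, y i j * (c * x) = c * (y i j * x) := fun i j x => by
          rw [← mul_assoc, ← (hcc i j).eq, mul_assoc]
        have e3 : ∀ i j x, y i j * (star a * x) = star a * (y i j * x) := fun i j x => by
          rw [← mul_assoc, ← (hca' i j).eq, mul_assoc]
        simp only [add_mul, mul_add, sub_mul, neg_mul, smul_mul_assoc, mul_assoc, e2, e3, one_mul]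
        abel
      have hr := r.castSucc_lt_succ
      have haa : a * star a - 1 = -(((q : ℂ) ^ 2) • (c * c)) := by
        rw [← h1]; abel
      have hd : y r.castSucc u * y r.succ v = y r.succ v * y r.castSucc u +
          ((q : ℂ) - (q : ℂ)⁻¹) • (y r.castSucc v * y r.succ u) := by
        rw [← hy.diag _ _ _ _ hr huv]; abel
      rw [hexp, hexp, hy.row r.castSucc u v huv, hy.row r.succ u v huv, haa, hd,
        hy.anti _ _ _ _ hr huv]
      simp only [mul_add, mul_smul_comm, smul_mul_assoc, neg_mul, smul_add, smul_sub, smul_neg,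
        smul_smul]
      have e : ((q : ℂ) - (q : ℂ)⁻¹) * (q : ℂ) ^ 2 = q ^ 3 - q := by field_simp
      rw [e]
      module
  all_goals
    set L : Matrix (Fin (n + 1)) (Fin (n + 1)) B :=
      Matrix.of (blockMat r a (-((q : ℂ) • c)) c (star a)) with hL
    set Y : Matrix (Fin (n + 1)) (Fin (n + 1)) B := Matrix.of y with hY
    have hqq : ∀ x : B, q • q • x = ((q : ℂ) ^ 2) • x := fun x => by
      rw [← Complex.coe_smul, ← Complex.coe_smul, smul_smul, pow_two]
  · have hY1 : Y * star Y = 1 := by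
      ext i j
      simpa [Matrix.mul_apply, Matrix.one_apply, hY] using hy.unitary_row i j
    have hL1 : L * star L = 1 := by
      ext i j
      simp only [Matrix.mul_apply, Matrix.star_apply, hL, Matrix.of_apply, star_blockMat,
        blockMat_mul, Matrix.one_apply]
      rw [← blockMat_one r]
      congr 1
      · simpa [hc, hqq] using h1
      · simp [hc, hac]
      · simp [hc, hca2]
      · simpa [hc, add_comm] using h2
    have hLY : (L * Y) * star (L * Y) = 1 := by
      rw [star_mul, mul_assoc, ← mul_assoc Y, hY1, one_mul, hL1]
    intro i j
    have := congrFun (congrFun hLY i) j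
    rw [Matrix.one_apply] at this
    exact this
  · have hY1 : star Y * Y = 1 := by
      ext i j
      simpa [Matrix.mul_apply, Matrix.one_apply, hY] using hy.unitary_col i j
    have hL1 : star L * L = 1 := by
      ext i j
      simp only [Matrix.mul_apply, Matrix.star_apply, hL, Matrix.of_apply, star_blockMat,
        blockMat_mul, Matrix.one_apply]
      rw [← blockMat_one r]
      congr 1
      · simpa [hc] using h2
      · simp [hc, hca2]
      · simp [hc, hac]
      · simpa [hc, hqq, add_comm] using h1
    have hLY : star (L * Y) * (L * Y) = 1 := by
      rw [star_mul, mul_assoc, ← mul_assoc (star L), hL1, one_mul, hY1]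
    intro i j
    have := congrFun (congrFun hLY i) j
    rw [Matrix.one_apply] at this
    exact this

end Product

/-! ### Stability of the crystal relations under a block: rows and columns -/

section CrystalProduct

variable {n : ℕ} {B : Type*}

section Rows

variable [Ring B] (r : Fin n) (a b c d : B) (y : Fin (n + 1) → Fin (n + 1) → B)

/-- Moving the truncation into the second factor turns the sum into one over all indices, to which
the row formulas for `blockMat` apply. -/
theorem convMatrix_zero_eq (x : Fin (n + 1) → Fin (n + 1) → B) (i j : Fin (n + 1)) :
    convMatrix 0 x y i j =
      ∑ k, x i k * (if k ∈ Finset.Icc (min i j) (max i j) then y k j else 0) := by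
  simp only [convMatrix, if_true, mul_ite, mul_zero, Finset.sum_ite_mem, Finset.univ_inter]

/-- The interval between `r` and `j` contains `r + 1` only if `j > r`, so the off-diagonal block
entry drops out here. This lemma and its three companions reduce all case checks at `q = 0` to the
position of the column relative to `r`. -/
theorem convMatrix_zero_castSucc_of_le {j : Fin (n + 1)} (hj : j.val ≤ r.val) :
    convMatrix 0 (blockMat r a b c d) y r.castSucc j = a * y r.castSucc j := by
  rw [convMatrix_zero_eq, sum_blockMat_castSucc, if_pos, if_neg, mul_zero, add_zero] <;>
  simp [Fin.le_def] <;> omega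

theorem convMatrix_zero_castSucc_of_lt {j : Fin (n + 1)} (hj : r.val < j.val) :
    convMatrix 0 (blockMat r a b c d) y r.castSucc j =
      a * y r.castSucc j + b * y r.succ j := by
  rw [convMatrix_zero_eq, sum_blockMat_castSucc, if_pos, if_pos] <;>
  simp [Fin.le_def] <;> omega

theorem convMatrix_zero_succ_of_le {j : Fin (n + 1)} (hj : j.val ≤ r.val) :
    convMatrix 0 (blockMat r a b c d) y r.succ j = c * y r.castSucc j + d * y r.succ j := by
  rw [convMatrix_zero_eq, sum_blockMat_succ, if_pos, if_pos] <;>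
  simp [Fin.le_def] <;> omega

theorem convMatrix_zero_succ_of_lt {j : Fin (n + 1)} (hj : r.val < j.val) :
    convMatrix 0 (blockMat r a b c d) y r.succ j = d * y r.succ j := by
  rw [convMatrix_zero_eq, sum_blockMat_succ, if_neg, if_pos, mul_zero, zero_add] <;>
  simp [Fin.le_def] <;> omega

theorem convMatrix_zero_of_ne {i : Fin (n + 1)} (h1 : i ≠ r.castSucc) (h2 : i ≠ r.succ)
    (j : Fin (n + 1)) : convMatrix 0 (blockMat r a b c d) y i j = y i j := by
  rw [convMatrix_zero_eq, sum_blockMat_of_ne _ _ _ _ _ h1 h2, if_pos]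
  simp

end Rows

/-- `s` is a coisometry with adjoint `t`, `p = 1 - t s`, and all of them commute with the entries
of `y`. -/
structure IsShiftBlock [CStarAlgebra B] (s t p : B) (y : Fin (n + 1) → Fin (n + 1) → B) :
    Prop where
  st : s * t = 1
  ts : t * s = 1 - p
  star_s : star s = t
  star_p : star p = p
  s_comm : ∀ i j, Commute s (y i j)
  t_comm : ∀ i j, Commute t (y i j)
  p_comm : ∀ i j, Commute p (y i j)

variable [CStarAlgebra B] {s t p : B} {y : Fin (n + 1) → Fin (n + 1) → B}

theorem IsShiftBlock.sp (h : IsShiftBlock s t p y) : s * p = 0 := by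
  have : p = 1 - t * s := by rw [h.ts]; abel
  rw [this, mul_sub, ← mul_assoc, h.st, one_mul, mul_one, sub_self]

theorem IsShiftBlock.pt (h : IsShiftBlock s t p y) : p * t = 0 := by
  have : p = 1 - t * s := by rw [h.ts]; abel
  rw [this, sub_mul, mul_assoc, h.st, one_mul, mul_one, sub_self]

theorem IsShiftBlock.pp (h : IsShiftBlock s t p y) : p * p = p := by
  have : p = 1 - t * s := by rw [h.ts]; abel
  nth_rw 1 [this]
  rw [sub_mul, mul_assoc, h.sp, mul_zero, one_mul, sub_zero]

/-- Normal form: block entries to the left, entries of `y` to the right. The variants below serve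
the same purpose. -/
theorem IsShiftBlock.mul_s (h : IsShiftBlock s t p y) (u : B) (i j k l : Fin (n + 1)) :
    (u * y i j) * (s * y k l) = (u * s) * (y i j * y k l) := by
  rw [mul_assoc, ← mul_assoc (y i j), ← (h.s_comm i j).eq]; simp only [mul_assoc]

theorem IsShiftBlock.mul_t (h : IsShiftBlock s t p y) (u : B) (i j k l : Fin (n + 1)) :
    (u * y i j) * (t * y k l) = (u * t) * (y i j * y k l) := by
  rw [mul_assoc, ← mul_assoc (y i j), ← (h.t_comm i j).eq]; simp only [mul_assoc]

theorem IsShiftBlock.mul_p (h : IsShiftBlock s t p y) (u : B) (i j k l : Fin (n + 1)) :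
    (u * y i j) * (p * y k l) = (u * p) * (y i j * y k l) := by
  rw [mul_assoc, ← mul_assoc (y i j), ← (h.p_comm i j).eq]; simp only [mul_assoc]

theorem IsShiftBlock.s_left (h : IsShiftBlock s t p y) (i j k l : Fin (n + 1)) :
    y i j * (s * y k l) = s * (y i j * y k l) := by
  rw [← mul_assoc, ← (h.s_comm i j).eq, mul_assoc]

theorem IsShiftBlock.t_left (h : IsShiftBlock s t p y) (i j k l : Fin (n + 1)) :
    y i j * (t * y k l) = t * (y i j * y k l) := by
  rw [← mul_assoc, ← (h.t_comm i j).eq, mul_assoc]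

theorem IsShiftBlock.p_left (h : IsShiftBlock s t p y) (i j k l : Fin (n + 1)) :
    y i j * (p * y k l) = p * (y i j * y k l) := by
  rw [← mul_assoc, ← (h.p_comm i j).eq, mul_assoc]

variable (hy : CrystalRel n y) (h : IsShiftBlock s t p y) (r : Fin n)
include hy h

theorem crystal_block_row (i j l : Fin (n + 1)) (hjl : j < l) :
    convMatrix 0 (blockMat r s p p t) y i j * convMatrix 0 (blockMat r s p p t) y i l = 0 := by
  -- Two columns on the same side of the cut between `r` and `r + 1` satisfy the condition of
  -- `anti_zero`, so the cross terms vanish. On different sides they disappear through `s p = 0` or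
  -- `p t = 0`.
  have key : ∀ j l : Fin (n + 1), j < l → (l.val ≤ r.val ∨ r.val < j.val) →
      y r.succ j * y r.castSucc l = 0 := fun j l hjl hc => by
    rw [← hy.anti _ _ _ _ r.castSucc_lt_succ hjl, hy.anti_zero _ _ _ _ r.castSucc_lt_succ hjl]
    rw [Fin.lt_def] at hjl
    simp; omega
  have hjl' := hjl
  rw [Fin.lt_def] at hjl'
  rcases castSucc_or_succ r i with rfl | rfl | ⟨hi, hi'⟩
  · rcases le_or_gt j.val r.val with hj | hj <;> rcases le_or_gt l.val r.val with hl | hl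
    · rw [convMatrix_zero_castSucc_of_le _ _ _ _ _ _ hj,
        convMatrix_zero_castSucc_of_le _ _ _ _ _ _ hl, h.mul_s, hy.row _ _ _ hjl, mul_zero]
    · rw [convMatrix_zero_castSucc_of_le _ _ _ _ _ _ hj,
        convMatrix_zero_castSucc_of_lt _ _ _ _ _ _ hl, mul_add, h.mul_s, h.mul_p,
        hy.row _ _ _ hjl, h.sp, mul_zero, zero_mul, add_zero]
    · omega
    · rw [convMatrix_zero_castSucc_of_lt _ _ _ _ _ _ hj,
        convMatrix_zero_castSucc_of_lt _ _ _ _ _ _ hl, mul_add, add_mul, add_mul, h.mul_s,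
        h.mul_s, h.mul_p, h.mul_p, hy.row _ _ _ hjl, hy.row _ _ _ hjl, h.sp,
        key j l hjl (Or.inr hj)]
      simp
  · rcases le_or_gt j.val r.val with hj | hj <;> rcases le_or_gt l.val r.val with hl | hl
    · rw [convMatrix_zero_succ_of_le _ _ _ _ _ _ hj,
        convMatrix_zero_succ_of_le _ _ _ _ _ _ hl, mul_add, add_mul, add_mul, h.mul_p,
        h.mul_p, h.mul_t, h.mul_t, hy.row _ _ _ hjl, hy.row _ _ _ hjl, h.pt,
        key j l hjl (Or.inl hl)]
      simp
    · rw [convMatrix_zero_succ_of_le _ _ _ _ _ _ hj,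
        convMatrix_zero_succ_of_lt _ _ _ _ _ _ hl, add_mul, h.mul_t, h.mul_t,
        hy.row _ _ _ hjl, h.pt, mul_zero, zero_mul, add_zero]
    · omega
    · rw [convMatrix_zero_succ_of_lt _ _ _ _ _ _ hj,
        convMatrix_zero_succ_of_lt _ _ _ _ _ _ hl, h.mul_t, hy.row _ _ _ hjl, mul_zero]
  · rw [convMatrix_zero_of_ne _ _ _ _ _ _ hi hi', convMatrix_zero_of_ne _ _ _ _ _ _ hi hi',
      hy.row _ _ _ hjl]

theorem crystal_block_col (i k j : Fin (n + 1)) (hik : i < k) :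
    convMatrix 0 (blockMat r s p p t) y i j * convMatrix 0 (blockMat r s p p t) y k j = 0 := by
  have hik' := hik
  rw [Fin.lt_def] at hik'
  rcases castSucc_or_succ r i with rfl | rfl | ⟨hi, hi'⟩ <;>
  rcases castSucc_or_succ r k with rfl | rfl | ⟨hk, hk'⟩
  · exact absurd hik (lt_irrefl _)
  · rcases le_or_gt j.val r.val with hj | hj
    · rw [convMatrix_zero_castSucc_of_le _ _ _ _ _ _ hj, convMatrix_zero_succ_of_le _ _ _ _ _ _ hj,
        mul_add, h.mul_p, h.mul_t, h.sp, hy.col _ _ _ hik, zero_mul, mul_zero, add_zero]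
    · rw [convMatrix_zero_castSucc_of_lt _ _ _ _ _ _ hj, convMatrix_zero_succ_of_lt _ _ _ _ _ _ hj,
        add_mul, h.mul_t, h.mul_t, h.pt, hy.col _ _ _ hik, zero_mul, mul_zero, add_zero]
  · have hik2 : r.succ < k := by
      rw [Fin.lt_def]; simp [Fin.ext_iff] at hik' hk' ⊢; omega
    rw [convMatrix_zero_of_ne _ _ _ _ _ _ hk hk']
    rcases le_or_gt j.val r.val with hj | hj
    · rw [convMatrix_zero_castSucc_of_le _ _ _ _ _ _ hj, mul_assoc, hy.col _ _ _ hik, mul_zero]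
    · rw [convMatrix_zero_castSucc_of_lt _ _ _ _ _ _ hj, add_mul, mul_assoc, mul_assoc,
        hy.col _ _ _ hik, hy.col _ _ _ hik2, mul_zero, mul_zero, add_zero]
  · simp at hik'
  · exact absurd hik (lt_irrefl _)
  · have hik2 : r.castSucc < k := r.castSucc_lt_succ.trans hik
    rw [convMatrix_zero_of_ne _ _ _ _ _ _ hk hk']
    rcases le_or_gt j.val r.val with hj | hj
    · rw [convMatrix_zero_succ_of_le _ _ _ _ _ _ hj, add_mul, mul_assoc, mul_assoc,
        hy.col _ _ _ hik, hy.col _ _ _ hik2, mul_zero, mul_zero, add_zero]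
    · rw [convMatrix_zero_succ_of_lt _ _ _ _ _ _ hj, mul_assoc, hy.col _ _ _ hik, mul_zero]
  · have hik2 : i < r.succ := hik.trans r.castSucc_lt_succ
    rw [convMatrix_zero_of_ne _ _ _ _ _ _ hi hi']
    rcases le_or_gt j.val r.val with hj | hj
    · rw [convMatrix_zero_castSucc_of_le _ _ _ _ _ _ hj, h.s_left, hy.col _ _ _ hik, mul_zero]
    · rw [convMatrix_zero_castSucc_of_lt _ _ _ _ _ _ hj, mul_add, h.s_left, h.p_left,
        hy.col _ _ _ hik, hy.col _ _ _ hik2, mul_zero, mul_zero, add_zero]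
  · have hik2 : i < r.castSucc := by
      rw [Fin.lt_def]; simp [Fin.ext_iff] at hik' hi ⊢; omega
    rw [convMatrix_zero_of_ne _ _ _ _ _ _ hi hi']
    rcases le_or_gt j.val r.val with hj | hj
    · rw [convMatrix_zero_succ_of_le _ _ _ _ _ _ hj, mul_add, h.p_left, h.t_left,
        hy.col _ _ _ hik, hy.col _ _ _ hik2, mul_zero, mul_zero, add_zero]
    · rw [convMatrix_zero_succ_of_lt _ _ _ _ _ _ hj, h.t_left, hy.col _ _ _ hik, mul_zero]
  · rw [convMatrix_zero_of_ne _ _ _ _ _ _ hi hi', convMatrix_zero_of_ne _ _ _ _ _ _ hk hk',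
      hy.col _ _ _ hik]

end CrystalProduct

/-! ### Stability of the crystal relations under a block: exchange relations -/

section CrystalProductExchange

variable {n : ℕ} {B : Type*} [CStarAlgebra B] {s t p : B} {y : Fin (n + 1) → Fin (n + 1) → B}

/-- An entry in row `r` or `r + 1` of the product is a combination of the entries of `y` in these
two rows and the same column, with coefficients that commute with `y`. -/
theorem IsShiftBlock.commute_conv (h : IsShiftBlock s t p y) (r : Fin n) {i j k l : Fin (n + 1)}
    (h0 : Commute (y i j) (y k l))
    (h1 : k = r.castSucc ∨ k = r.succ → Commute (y i j) (y r.castSucc l))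
    (h2 : k = r.castSucc ∨ k = r.succ → Commute (y i j) (y r.succ l)) :
    Commute (y i j) (convMatrix 0 (blockMat r s p p t) y k l) := by
  have hs := (h.s_comm i j).symm
  have ht := (h.t_comm i j).symm
  have hp := (h.p_comm i j).symm
  rcases castSucc_or_succ r k with rfl | rfl | ⟨hk, hk'⟩
  · rcases le_or_gt l.val r.val with hl | hl
    · rw [convMatrix_zero_castSucc_of_le _ _ _ _ _ _ hl]
      exact hs.mul_right (h1 (Or.inl rfl))
    · rw [convMatrix_zero_castSucc_of_lt _ _ _ _ _ _ hl]
      exact (hs.mul_right (h1 (Or.inl rfl))).add_right (hp.mul_right (h2 (Or.inl rfl)))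
  · rcases le_or_gt l.val r.val with hl | hl
    · rw [convMatrix_zero_succ_of_le _ _ _ _ _ _ hl]
      exact (hp.mul_right (h1 (Or.inr rfl))).add_right (ht.mul_right (h2 (Or.inr rfl)))
    · rw [convMatrix_zero_succ_of_lt _ _ _ _ _ _ hl]
      exact ht.mul_right (h2 (Or.inr rfl))
  · rw [convMatrix_zero_of_ne _ _ _ _ _ _ hk hk']
    exact h0

variable (hy : CrystalRel n y) (h : IsShiftBlock s t p y) (r : Fin n)
include hy h

theorem crystal_block_anti (i k j l : Fin (n + 1)) (hik : i < k) (hjl : j < l) :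
    convMatrix 0 (blockMat r s p p t) y i l * convMatrix 0 (blockMat r s p p t) y k j =
      convMatrix 0 (blockMat r s p p t) y k j * convMatrix 0 (blockMat r s p p t) y i l := by
  have hik' := hik
  have hjl' := hjl
  have hr := r.castSucc_lt_succ
  rw [Fin.lt_def] at hik' hjl'
  rcases castSucc_or_succ r i with rfl | rfl | ⟨hi, hi'⟩ <;>
  rcases castSucc_or_succ r k with rfl | rfl | ⟨hk, hk'⟩
  · exact absurd hik (lt_irrefl _)
  · have hz := hy.anti_zero _ _ _ _ hr hjl
    have ha := hy.anti _ _ _ _ hr hjl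
    rcases le_or_gt j.val r.val with hj | hj <;> rcases le_or_gt l.val r.val with hl | hl
    · have hz := hz (by simp; omega)
      rw [hz] at ha
      rw [convMatrix_zero_castSucc_of_le _ _ _ _ _ _ hl, convMatrix_zero_succ_of_le _ _ _ _ _ _ hj,
        mul_add, add_mul, h.mul_p, h.mul_t, h.mul_s, h.mul_s, hz, ← ha, h.sp, hy.row _ _ _ hjl]
      simp
    · have hd := hy.diag _ _ _ _ hr hjl (by simp; omega)
      rw [convMatrix_zero_castSucc_of_lt _ _ _ _ _ _ hl, convMatrix_zero_succ_of_le _ _ _ _ _ _ hj,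
        mul_add, add_mul, add_mul, mul_add, add_mul, add_mul, h.mul_p, h.mul_p, h.mul_t, h.mul_t,
        h.mul_s, h.mul_s, h.mul_p, h.mul_p, hy.row _ _ _ hjl, hy.row _ _ _ hjl, h.sp, h.st, h.pp,
        h.pt, h.ts, ← ha, sub_mul, ← hd]
      simp only [mul_sub, mul_zero, zero_mul, one_mul]
      abel
    · omega
    · have hz := hz (by simp; omega)
      rw [hz] at ha
      rw [convMatrix_zero_castSucc_of_lt _ _ _ _ _ _ hl, convMatrix_zero_succ_of_lt _ _ _ _ _ _ hj,
        mul_add, add_mul, h.mul_t, h.mul_t, h.mul_s, h.mul_p, hz, ← ha, h.pt, hy.row _ _ _ hjl]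
      simp
  · rw [convMatrix_zero_of_ne _ _ _ _ _ _ hk hk']
    have hik2 : r.succ < k := by
      rw [Fin.lt_def]; simp [Fin.ext_iff] at hik' hk' ⊢; omega
    refine (h.commute_conv r (hy.anti _ _ _ _ hik hjl).symm (fun _ => ?_) fun _ => ?_).symm
    exacts [(hy.anti _ _ _ _ hik hjl).symm, (hy.anti _ _ _ _ hik2 hjl).symm]
  · simp at hik'
  · exact absurd hik (lt_irrefl _)
  · rw [convMatrix_zero_of_ne _ _ _ _ _ _ hk hk']
    refine (h.commute_conv r (hy.anti _ _ _ _ hik hjl).symm (fun _ => ?_) fun _ => ?_).symm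
    exacts [(hy.anti _ _ _ _ (hr.trans hik) hjl).symm, (hy.anti _ _ _ _ hik hjl).symm]
  · rw [convMatrix_zero_of_ne _ _ _ _ _ _ hi hi']
    refine h.commute_conv r (hy.anti _ _ _ _ hik hjl) (fun _ => ?_) fun _ => ?_
    exacts [hy.anti _ _ _ _ hik hjl, hy.anti _ _ _ _ (hik.trans hr) hjl]
  · have hik2 : i < r.castSucc := by
      rw [Fin.lt_def]; simp [Fin.ext_iff] at hik' hi ⊢; omega
    rw [convMatrix_zero_of_ne _ _ _ _ _ _ hi hi']
    refine h.commute_conv r (hy.anti _ _ _ _ hik hjl) (fun _ => ?_) fun _ => ?_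
    exacts [hy.anti _ _ _ _ hik2 hjl, hy.anti _ _ _ _ hik hjl]
  · rw [convMatrix_zero_of_ne _ _ _ _ _ _ hi hi', convMatrix_zero_of_ne _ _ _ _ _ _ hk hk',
      hy.anti _ _ _ _ hik hjl]

theorem crystal_block_anti_zero (i k j l : Fin (n + 1)) (hik : i < k) (hjl : j < l)
    (hm : min k.val l.val ≤ max i.val j.val) :
    convMatrix 0 (blockMat r s p p t) y i l * convMatrix 0 (blockMat r s p p t) y k j = 0 := by
  have hik' := hik
  have hjl' := hjl
  have hr := r.castSucc_lt_succ
  rw [Fin.lt_def] at hik' hjl'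
  have hz := hy.anti_zero _ _ _ _ hik hjl hm
  rcases castSucc_or_succ r i with rfl | rfl | ⟨hi, hi'⟩ <;>
  rcases castSucc_or_succ r k with rfl | rfl | ⟨hk, hk'⟩
  · exact absurd hik (lt_irrefl _)
  · simp only [Fin.val_succ, Fin.val_castSucc] at hm
    rcases le_or_gt j.val r.val with hj | hj <;> rcases le_or_gt l.val r.val with hl | hl
    · rw [convMatrix_zero_castSucc_of_le _ _ _ _ _ _ hl, convMatrix_zero_succ_of_le _ _ _ _ _ _ hj,
        mul_add, h.mul_p, h.mul_t, hz, h.sp]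
      simp
    · omega
    · omega
    · rw [convMatrix_zero_castSucc_of_lt _ _ _ _ _ _ hl, convMatrix_zero_succ_of_lt _ _ _ _ _ _ hj,
        add_mul, h.mul_t, h.mul_t, hz, h.pt]
      simp
  · have hik2 : r.succ < k := by
      rw [Fin.lt_def]; simp [Fin.ext_iff] at hik' hk' ⊢; omega
    rw [convMatrix_zero_of_ne _ _ _ _ _ _ hk hk']
    rcases le_or_gt l.val r.val with hl | hl
    · rw [convMatrix_zero_castSucc_of_le _ _ _ _ _ _ hl, mul_assoc, hz, mul_zero]
    · rw [convMatrix_zero_castSucc_of_lt _ _ _ _ _ _ hl, add_mul, mul_assoc, mul_assoc, hz,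
        hy.anti_zero _ _ _ _ hik2 hjl (by simp at hm ⊢; omega), mul_zero, mul_zero, add_zero]
  · simp at hik'
  · exact absurd hik (lt_irrefl _)
  · rw [convMatrix_zero_of_ne _ _ _ _ _ _ hk hk']
    rcases le_or_gt l.val r.val with hl | hl
    · rw [convMatrix_zero_succ_of_le _ _ _ _ _ _ hl, add_mul, mul_assoc, mul_assoc, hz,
        hy.anti_zero _ _ _ _ (hr.trans hik) hjl (by simp at hm hik' ⊢; omega), mul_zero, mul_zero,
        add_zero]
    · rw [convMatrix_zero_succ_of_lt _ _ _ _ _ _ hl, mul_assoc, hz, mul_zero]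
  · rw [convMatrix_zero_of_ne _ _ _ _ _ _ hi hi']
    rcases le_or_gt j.val r.val with hj | hj
    · rw [convMatrix_zero_castSucc_of_le _ _ _ _ _ _ hj, h.s_left, hz, mul_zero]
    · rw [convMatrix_zero_castSucc_of_lt _ _ _ _ _ _ hj, mul_add, h.s_left, h.p_left, hz,
        hy.anti_zero _ _ _ _ (hik.trans hr) hjl (by simp; omega), mul_zero, mul_zero, add_zero]
  · have hik2 : i < r.castSucc := by
      rw [Fin.lt_def]; simp [Fin.ext_iff] at hik' hi ⊢; omega
    rw [convMatrix_zero_of_ne _ _ _ _ _ _ hi hi']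
    rcases le_or_gt j.val r.val with hj | hj
    · rw [convMatrix_zero_succ_of_le _ _ _ _ _ _ hj, mul_add, h.p_left, h.t_left, hz,
        hy.anti_zero _ _ _ _ hik2 hjl (by simp at hm ⊢; omega), mul_zero, mul_zero, add_zero]
    · rw [convMatrix_zero_succ_of_lt _ _ _ _ _ _ hj, h.t_left, hz, mul_zero]
  · rw [convMatrix_zero_of_ne _ _ _ _ _ _ hi hi', convMatrix_zero_of_ne _ _ _ _ _ _ hk hk', hz]

/-- For the rows `r`, `r + 1` the hypothesis forces `j ≤ r < l`, and `t s = 1 - p` supplies exactly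
the extra term `p y_{r+1,l} y_{r,j}` of the right-hand side. With one row outside the block, the
contribution of the additional row satisfies the same relation, commutes or vanishes, according to
the position of the columns. -/
theorem crystal_block_diag (i k j l : Fin (n + 1)) (hik : i < k) (hjl : j < l)
    (hm : max i.val j.val + 1 = min k.val l.val) :
    convMatrix 0 (blockMat r s p p t) y i j * convMatrix 0 (blockMat r s p p t) y k l -
      convMatrix 0 (blockMat r s p p t) y k l * convMatrix 0 (blockMat r s p p t) y i j =
    convMatrix 0 (blockMat r s p p t) y i l * convMatrix 0 (blockMat r s p p t) y k j := by
  have hik' := hik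
  have hjl' := hjl
  have hr := r.castSucc_lt_succ
  rw [Fin.lt_def] at hik' hjl'
  have hd := hy.diag _ _ _ _ hik hjl hm
  rcases castSucc_or_succ r i with rfl | rfl | ⟨hi, hi'⟩ <;>
  rcases castSucc_or_succ r k with rfl | rfl | ⟨hk, hk'⟩
  · exact absurd hik (lt_irrefl _)
  · simp only [Fin.val_succ, Fin.val_castSucc] at hm
    have hj : j.val ≤ r.val := by omega
    have hl : r.val < l.val := by omega
    rw [convMatrix_zero_castSucc_of_le _ _ _ _ _ _ hj, convMatrix_zero_castSucc_of_lt _ _ _ _ _ _ hl,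
      convMatrix_zero_succ_of_le _ _ _ _ _ _ hj, convMatrix_zero_succ_of_lt _ _ _ _ _ _ hl,
      mul_add, add_mul, add_mul, h.mul_p, h.mul_p, h.mul_t, h.mul_t, h.mul_t, h.mul_s, h.sp, h.st,
      h.pp, h.pt, h.ts, sub_mul, ← hd]
    simp only [zero_mul, one_mul]
    abel
  · have hik2 : r.succ < k := by
      rw [Fin.lt_def]; simp [Fin.ext_iff] at hik' hk' ⊢; omega
    simp only [Fin.val_castSucc] at hm
    have hl : r.val < l.val := by omega
    rw [convMatrix_zero_of_ne _ _ _ _ _ _ hk hk', convMatrix_zero_of_ne _ _ _ _ _ _ hk hk',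
      convMatrix_zero_castSucc_of_lt _ _ _ _ _ _ hl]
    rcases le_or_gt j.val r.val with hj | hj
    · rw [convMatrix_zero_castSucc_of_le _ _ _ _ _ _ hj, h.s_left, mul_assoc, ← mul_sub, hd,
        add_mul, mul_assoc, mul_assoc,
        hy.anti_zero _ _ _ _ hik2 hjl (by simp at hik2 ⊢; omega), mul_zero, add_zero]
    · rw [convMatrix_zero_castSucc_of_lt _ _ _ _ _ _ hj, mul_add, add_mul, add_mul, h.s_left,
        h.p_left, mul_assoc, mul_assoc, mul_assoc, mul_assoc, ← hd,
        ← hy.diag _ _ _ _ hik2 hjl (by simp; omega), mul_sub, mul_sub]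
      abel
  · simp at hik'
  · exact absurd hik (lt_irrefl _)
  · simp only [Fin.val_succ] at hm
    have hl : r.val < l.val := by omega
    rw [convMatrix_zero_of_ne _ _ _ _ _ _ hk hk', convMatrix_zero_of_ne _ _ _ _ _ _ hk hk',
      convMatrix_zero_succ_of_lt _ _ _ _ _ _ hl]
    rcases le_or_gt j.val r.val with hj | hj
    · rw [convMatrix_zero_succ_of_le _ _ _ _ _ _ hj, mul_add, add_mul, h.p_left, h.t_left,
        mul_assoc, mul_assoc, mul_assoc, ← hd,
        hy.diag_comm _ _ _ _ (hr.trans hik) hjl (by simp; omega), mul_sub]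
      abel
    · rw [convMatrix_zero_succ_of_lt _ _ _ _ _ _ hj, h.t_left, mul_assoc, mul_assoc, ← hd, mul_sub]
  · rw [convMatrix_zero_of_ne _ _ _ _ _ _ hi hi', convMatrix_zero_of_ne _ _ _ _ _ _ hi hi']
    simp only [Fin.val_castSucc] at hm
    have hj : j.val ≤ r.val := by omega
    rw [convMatrix_zero_castSucc_of_le _ _ _ _ _ _ hj, h.s_left]
    rcases le_or_gt l.val r.val with hl | hl
    · rw [convMatrix_zero_castSucc_of_le _ _ _ _ _ _ hl, h.s_left, mul_assoc, ← mul_sub, hd]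
    · rw [convMatrix_zero_castSucc_of_lt _ _ _ _ _ _ hl, mul_add, add_mul, h.s_left, h.p_left,
        mul_assoc, mul_assoc, ← hd,
        hy.diag_comm _ _ _ _ (hik.trans hr) hjl (by simp; omega), mul_sub]
      abel
  · have hik2 : i < r.castSucc := by
      rw [Fin.lt_def]; simp [Fin.ext_iff] at hik' hi ⊢; omega
    rw [convMatrix_zero_of_ne _ _ _ _ _ _ hi hi', convMatrix_zero_of_ne _ _ _ _ _ _ hi hi']
    simp only [Fin.val_succ] at hm
    have hj : j.val ≤ r.val := by omega
    rw [convMatrix_zero_succ_of_le _ _ _ _ _ _ hj, mul_add (y i l), h.p_left i l, h.t_left i l]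
    rcases le_or_gt l.val r.val with hl | hl
    · rw [convMatrix_zero_succ_of_le _ _ _ _ _ _ hl, mul_add, add_mul, h.p_left, h.t_left,
        mul_assoc, mul_assoc, ← hd, ← hy.diag _ _ _ _ hik2 hjl (by simp; omega), mul_sub, mul_sub]
      abel
    · rw [convMatrix_zero_succ_of_lt _ _ _ _ _ _ hl, h.t_left, mul_assoc, ← mul_sub, hd,
        hy.anti_zero _ _ _ _ hik2 hjl (by simp at hik2 ⊢; omega), mul_zero, zero_add]
  · rw [convMatrix_zero_of_ne _ _ _ _ _ _ hi hi', convMatrix_zero_of_ne _ _ _ _ _ _ hk hk',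
      convMatrix_zero_of_ne _ _ _ _ _ _ hi hi', convMatrix_zero_of_ne _ _ _ _ _ _ hk hk', hd]

theorem crystal_block_diag_comm (i k j l : Fin (n + 1)) (hik : i < k) (hjl : j < l)
    (hm : max i.val j.val + 1 < min k.val l.val) :
    convMatrix 0 (blockMat r s p p t) y i j * convMatrix 0 (blockMat r s p p t) y k l =
      convMatrix 0 (blockMat r s p p t) y k l * convMatrix 0 (blockMat r s p p t) y i j := by
  have hik' := hik
  have hjl' := hjl
  have hr := r.castSucc_lt_succ
  rw [Fin.lt_def] at hik' hjl'
  have hd := hy.diag_comm _ _ _ _ hik hjl hm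
  rcases castSucc_or_succ r i with rfl | rfl | ⟨hi, hi'⟩ <;>
  rcases castSucc_or_succ r k with rfl | rfl | ⟨hk, hk'⟩
  · exact absurd hik (lt_irrefl _)
  · simp at hm
  · have hik2 : r.succ < k := by
      rw [Fin.lt_def]; simp [Fin.ext_iff] at hik' hk' ⊢; omega
    simp only [Fin.val_castSucc] at hm
    rw [convMatrix_zero_of_ne _ _ _ _ _ _ hk hk']
    rcases le_or_gt j.val r.val with hj | hj
    · rw [convMatrix_zero_castSucc_of_le _ _ _ _ _ _ hj, h.s_left, mul_assoc, hd]
    · rw [convMatrix_zero_castSucc_of_lt _ _ _ _ _ _ hj, mul_add, add_mul, h.s_left,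
        h.p_left, mul_assoc, mul_assoc, hd, hy.diag_comm _ _ _ _ hik2 hjl (by simp; omega)]
  · simp at hik'
  · exact absurd hik (lt_irrefl _)
  · simp only [Fin.val_succ] at hm
    rw [convMatrix_zero_of_ne _ _ _ _ _ _ hk hk']
    refine (h.commute_conv r hd.symm (fun _ => ?_) fun _ => ?_).symm.eq
    exacts [(hy.diag_comm _ _ _ _ (hr.trans hik) hjl (by simp; omega)).symm, hd.symm]
  · simp only [Fin.val_castSucc] at hm
    rw [convMatrix_zero_of_ne _ _ _ _ _ _ hi hi']
    refine (h.commute_conv r hd (fun _ => hd) fun _ => ?_).eq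
    exact hy.diag_comm _ _ _ _ (hik.trans hr) hjl (by simp; omega)
  · have hik2 : i < r.castSucc := by
      rw [Fin.lt_def]; simp [Fin.ext_iff] at hik' hi ⊢; omega
    rw [convMatrix_zero_of_ne _ _ _ _ _ _ hi hi']
    simp only [Fin.val_succ] at hm
    rcases le_or_gt l.val r.val with hl | hl
    · rw [convMatrix_zero_succ_of_le _ _ _ _ _ _ hl, mul_add, add_mul, h.p_left, h.t_left,
        mul_assoc, mul_assoc, hd, hy.diag_comm _ _ _ _ hik2 hjl (by simp; omega)]
    · rw [convMatrix_zero_succ_of_lt _ _ _ _ _ _ hl, h.t_left, mul_assoc, hd]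
  · rw [convMatrix_zero_of_ne _ _ _ _ _ _ hi hi', convMatrix_zero_of_ne _ _ _ _ _ _ hk hk', hd]

end CrystalProductExchange

/-! ### Stability of the crystal relations under a block: adjoints and determinant -/

section CrystalStar

variable {n : ℕ} {B : Type*} [CStarAlgebra B] {s t p : B} {y : Fin (n + 1) → Fin (n + 1) → B}

/-- The product of two entries of the rows `r`, `r + 1` in increasing columns is not changed by a
shift block. -/
theorem crystal_block_adjacent (h : IsShiftBlock s t p y) (r : Fin n) {c d : Fin (n + 1)}
    (hcd : c < d) :
    convMatrix 0 (blockMat r s p p t) y r.castSucc c *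
      convMatrix 0 (blockMat r s p p t) y r.succ d = y r.castSucc c * y r.succ d := by
  rw [Fin.lt_def] at hcd
  rcases le_or_gt c.val r.val with hc | hc <;> rcases le_or_gt d.val r.val with hd | hd
  · rw [convMatrix_zero_castSucc_of_le _ _ _ _ _ _ hc, convMatrix_zero_succ_of_le _ _ _ _ _ _ hd,
      mul_add, h.mul_p, h.mul_t, h.sp, h.st, zero_mul, one_mul, zero_add]
  · rw [convMatrix_zero_castSucc_of_le _ _ _ _ _ _ hc, convMatrix_zero_succ_of_lt _ _ _ _ _ _ hd,
      h.mul_t, h.st, one_mul]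
  · omega
  · rw [convMatrix_zero_castSucc_of_lt _ _ _ _ _ _ hc, convMatrix_zero_succ_of_lt _ _ _ _ _ _ hd,
      add_mul, h.mul_t, h.mul_t, h.pt, h.st, zero_mul, one_mul, add_zero]

theorem commute_list_prod {x : B} {ι : Type*} {D : List ι} {f : ι → B}
    (h : ∀ i, Commute x (f i)) : Commute x (D.map f).prod :=
  Commute.list_prod_right _ _ fun z hz => by
    obtain ⟨i, -, rfl⟩ := List.mem_map.1 hz
    exact h i

/-- Moves a block entry from the middle of a product of entries of `y` to the front, to compare with
the adjoint formula for `y`. -/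
theorem IsShiftBlock.pull (h : IsShiftBlock s t p y) {x : B} (hx : x = s ∨ x = t ∨ x = p)
    {m : ℕ} (A C : List (Fin m)) (f g : Fin m → Fin (n + 1)) (u : B) :
    (A.map fun a => y (f a) (g a)).prod * (x * u) * (C.map fun a => y (f a) (g a)).prod =
      x * ((A.map fun a => y (f a) (g a)).prod * u * (C.map fun a => y (f a) (g a)).prod) := by
  have hc : ∀ i j, Commute x (y i j) := by
    rcases hx with rfl | rfl | rfl
    exacts [h.s_comm, h.t_comm, h.p_comm]
  rw [← mul_assoc _ x, ← (commute_list_prod fun _ => hc _ _).eq]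
  simp only [mul_assoc]

theorem crystal_block_star (hy : CrystalRel n y) (h : IsShiftBlock s t p y) (r : Fin n)
    (i j : Fin (n + 1)) : star (convMatrix 0 (blockMat r s p p t) y i j) =
      (List.ofFn fun a : Fin n =>
        convMatrix 0 (blockMat r s p p t) y (i.succAbove a) (j.succAbove a)).prod := by
  have hs := h.star_s
  have ht : star t = s := by rw [← hs, star_star]
  have hp := h.star_p
  have hs' : ∀ i j, star (s * y i j) = t * star (y i j) := fun i j => by
    rw [(h.s_comm i j).eq, star_mul, hs]
  have ht' : ∀ i j, star (t * y i j) = s * star (y i j) := fun i j => by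
    rw [(h.t_comm i j).eq, star_mul, ht]
  have hp' : ∀ i j, star (p * y i j) = p * star (y i j) := fun i j => by
    rw [(h.p_comm i j).eq, star_mul, hp]
  -- If the deleted row is `r` or `r + 1`, just one factor of the complementary product meets the
  -- block. Otherwise both rows survive as neighbours with increasing columns, and
  -- `crystal_block_adjacent` shows that their product is unchanged.
  by_cases hi : i = r.castSucc ∨ i = r.succ
  · obtain ⟨A, C, hAC⟩ := List.mem_iff_append.1 (List.mem_finRange r)
    have hnd := List.nodup_finRange n
    rw [hAC, List.nodup_append, List.nodup_cons] at hnd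
    have hA : ∀ x ∈ A, x ≠ r := fun x hx => hnd.2.2 x hx r (by simp)
    have hC : ∀ x ∈ C, x ≠ r := fun x hx he => hnd.2.1.1 (he ▸ hx)
    -- Deleting row `r` or row `r + 1` leaves the same rows at every position but the `r`-th.
    have hrow : ∀ x : Fin n, x ≠ r → r.castSucc.succAbove x = r.succ.succAbove x ∧
        r.castSucc.succAbove x ≠ r.castSucc ∧ r.castSucc.succAbove x ≠ r.succ := by
      intro x hx
      have hx' : x.val ≠ r.val := fun he => hx (Fin.ext he)
      have hlt : ∀ u v : Fin (n + 1), u.val < v.val → u < v := fun _ _ h => h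
      have hle : ∀ u v : Fin (n + 1), u.val ≤ v.val → u ≤ v := fun _ _ h => h
      have hne : ∀ u v : Fin (n + 1), u.val ≠ v.val → u ≠ v := fun _ _ h he => h (he ▸ rfl)
      rcases lt_or_gt_of_ne hx' with h0 | h0
      · rw [Fin.succAbove_of_castSucc_lt r.castSucc x (hlt _ _ h0),
          Fin.succAbove_of_castSucc_lt r.succ x (hlt _ _ (by simp; omega))]
        exact ⟨rfl, hne _ _ (by simpa using hx'), hne _ _ (by simp; omega)⟩
      · rw [Fin.succAbove_of_le_castSucc r.castSucc x (hle _ _ h0.le),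
          Fin.succAbove_of_le_castSucc r.succ x (hle _ _ (by simp; omega))]
        exact ⟨rfl, hne _ _ (by simp; omega), hne _ _ (by simpa using hx')⟩
    have h1 : r.castSucc.succAbove r = r.succ := by simp
    have h2 : r.succ.succAbove r = r.castSucc := by simp
    have hsplit : ∀ f : Fin n → B, (List.ofFn f).prod =
        (A.map f).prod * f r * (C.map f).prod := fun f => by
      rw [List.ofFn_eq_map, hAC]
      simp [mul_assoc]
    have hD : ∀ D : List (Fin n), (∀ x ∈ D, x ≠ r) → ∀ i, i = r.castSucc ∨ i = r.succ →
        (D.map fun a => convMatrix 0 (blockMat r s p p t) y (i.succAbove a) (j.succAbove a)) =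
        D.map fun a => y (r.castSucc.succAbove a) (j.succAbove a) := by
      rintro D hD i hi
      refine List.map_congr_left fun x hx => ?_
      have h3 := hrow x (hD x hx)
      rcases hi with rfl | rfl
      · rw [convMatrix_zero_of_ne _ _ _ _ _ _ h3.2.1 h3.2.2]
      · rw [← h3.1, convMatrix_zero_of_ne _ _ _ _ _ _ h3.2.1 h3.2.2]
    have hE : ∀ D : List (Fin n), (∀ x ∈ D, x ≠ r) →
        (D.map fun a => y (r.succ.succAbove a) (j.succAbove a)) =
        D.map fun a => y (r.castSucc.succAbove a) (j.succAbove a) := fun D hD =>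
      List.map_congr_left fun x hx => by rw [(hrow x (hD x hx)).1]
    have e1 := hy.star_eq r.castSucc j
    have e2 := hy.star_eq r.succ j
    rw [hsplit, h1] at e1
    rw [hsplit, h2, hE A hA, hE C hC] at e2
    rw [hsplit, hD A hA i hi, hD C hC i hi]
    rcases hi with rfl | rfl
    · rw [h1]
      rcases le_or_gt j.val r.val with hj | hj
      · have hjr : j.succAbove r = r.succ := Fin.succAbove_of_le_castSucc _ _ hj
        rw [hjr] at e1 ⊢
        rw [convMatrix_zero_castSucc_of_le _ _ _ _ _ _ hj,
          convMatrix_zero_succ_of_lt _ _ _ _ _ _ (by simp), hs', e1,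
          h.pull (Or.inr (Or.inl rfl))]
      · have hjr : j.succAbove r = r.castSucc := Fin.succAbove_of_castSucc_lt _ _ hj
        rw [hjr] at e1 e2 ⊢
        rw [convMatrix_zero_castSucc_of_lt _ _ _ _ _ _ hj,
          convMatrix_zero_succ_of_le _ _ _ _ _ _ (by simp), star_add, hs', hp', e1, e2, mul_add,
          add_mul, h.pull (Or.inr (Or.inl rfl)), h.pull (Or.inr (Or.inr rfl)), add_comm]
    · rw [h2]
      rcases le_or_gt j.val r.val with hj | hj
      · have hjr : j.succAbove r = r.succ := Fin.succAbove_of_le_castSucc _ _ hj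
        rw [hjr] at e1 e2 ⊢
        rw [convMatrix_zero_succ_of_le _ _ _ _ _ _ hj,
          convMatrix_zero_castSucc_of_lt _ _ _ _ _ _ (by simp), star_add, ht', hp', e1, e2, mul_add,
          add_mul, h.pull (Or.inl rfl), h.pull (Or.inr (Or.inr rfl)), add_comm]
      · have hjr : j.succAbove r = r.castSucc := Fin.succAbove_of_castSucc_lt _ _ hj
        rw [hjr] at e2 ⊢
        rw [convMatrix_zero_succ_of_lt _ _ _ _ _ _ hj,
          convMatrix_zero_castSucc_of_le _ _ _ _ _ _ (by simp), ht', e2, h.pull (Or.inl rfl)]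
  · push Not at hi
    -- Positions of the rows `r` and `r + 1` among the rows other than `i`; they are consecutive.
    obtain ⟨a, ha⟩ := Fin.exists_succAbove_eq hi.1.symm
    obtain ⟨b, hb⟩ := Fin.exists_succAbove_eq hi.2.symm
    have hab : b.val = a.val + 1 := by
      have ha' := ha
      have hb' := hb
      have h1 : i.val ≠ r.val := fun he => hi.1 (Fin.ext he)
      have h2 : i.val ≠ r.val + 1 := fun he => hi.2 (Fin.ext he)
      simp only [Fin.succAbove, Fin.lt_def, Fin.val_castSucc] at ha' hb'
      split_ifs at ha' hb' <;> simp only [Fin.ext_iff, Fin.val_castSucc, Fin.val_succ] at ha' hb' <;>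
        omega
    obtain ⟨A, C, hA, hC, hAC⟩ := exists_finRange_split hab
    have hsplit : ∀ f : Fin n → B, (List.ofFn f).prod =
        (A.map f).prod * (f a * f b) * (C.map f).prod := fun f => by
      rw [List.ofFn_eq_map, hAC]
      simp [mul_assoc]
    have hD : ∀ D : List (Fin n), (∀ x ∈ D, x ≠ a ∧ x ≠ b) →
        (D.map fun a => convMatrix 0 (blockMat r s p p t) y (i.succAbove a) (j.succAbove a)) =
        D.map fun a => y (i.succAbove a) (j.succAbove a) := fun D hD =>
      List.map_congr_left fun x hx => convMatrix_zero_of_ne _ _ _ _ _ _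
        (fun he => (hD x hx).1 (Fin.succAbove_right_injective (he.trans ha.symm)))
        (fun he => (hD x hx).2 (Fin.succAbove_right_injective (he.trans hb.symm))) _
    rw [convMatrix_zero_of_ne _ _ _ _ _ _ hi.1 hi.2, hy.star_eq, hsplit, hsplit, hD A hA, hD C hC,
      ha, hb, crystal_block_adjacent h]
    exact Fin.strictMono_succAbove _ (by rw [Fin.lt_def]; omega)

/-- Multiplication by a shift block preserves the relations of the crystallized algebra. -/
theorem CrystalRel.block_mul (hy : CrystalRel n y) (h : IsShiftBlock s t p y) (r : Fin n) :
    CrystalRel n (convMatrix 0 (blockMat r s p p t) y) where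
  row := crystal_block_row hy h r
  col := crystal_block_col hy h r
  anti := crystal_block_anti hy h r
  anti_zero := crystal_block_anti_zero hy h r
  diag := crystal_block_diag hy h r
  diag_comm := crystal_block_diag_comm hy h r
  star_eq := crystal_block_star hy h r
  det := by
    obtain ⟨A, C, hA, hC, hAC⟩ :=
      exists_finRange_split (N := n + 1) (a := r.castSucc) (b := r.succ) (by simp)
    have hsplit : ∀ f : Fin (n + 1) → B, (List.ofFn f).prod =
        (A.map f).prod * (f r.castSucc * f r.succ) * (C.map f).prod := fun f => by
      rw [List.ofFn_eq_map, hAC]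
      simp [mul_assoc]
    have hD : ∀ D : List (Fin (n + 1)), (∀ x ∈ D, x ≠ r.castSucc ∧ x ≠ r.succ) →
        (D.map fun i => convMatrix 0 (blockMat r s p p t) y i i) = D.map fun i => y i i :=
      fun D hD => List.map_congr_left fun x hx => convMatrix_zero_of_ne _ _ _ _ _ _
        (hD x hx).1 (hD x hx).2 _
    rw [← hy.det, hsplit, hsplit, hD A hA, hD C hC,
      crystal_block_adjacent h _ r.castSucc_lt_succ]

end CrystalStar

/-! ### The identity matrix satisfies the relations -/

section Identity

variable {n : ℕ} {B : Type*} [CStarAlgebra B]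

theorem QuantumRel.one {q : ℝ} :
    QuantumRel n q (fun i j : Fin (n + 1) => if i = j then (1 : B) else 0) where
  row i j l hjl := by
    by_cases h : i = j
    · simp [h, hjl.ne]
    · simp [h]
  col i k j hik := by
    by_cases h : i = j
    · simp [← h, hik.ne']
    · simp [h]
  anti i k j l hik hjl := by split_ifs <;> simp
  diag i k j l hik hjl := by
    have : ¬ (i = l ∧ k = j) := by rintro ⟨rfl, rfl⟩; exact lt_asymm hik hjl
    split_ifs <;> simp <;> tauto
  det := by
    rw [Finset.sum_eq_single 1]
    · have : invCount (1 : Equiv.Perm (Fin (n + 1))) = 0 := by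
        rw [invCount, Finset.card_eq_zero, Finset.filter_eq_empty_iff]
        rintro ⟨a, b⟩ - ⟨h1, h2⟩
        exact lt_asymm h1 h2
      rw [this]
      simp
    · intro σ _ hσ
      obtain ⟨i, hi⟩ : ∃ i, i ≠ σ i := by
        by_contra! hc
        exact hσ (Equiv.ext fun i => (hc i).symm)
      rw [List.prod_eq_zero, smul_zero]
      rw [List.mem_ofFn]
      exact ⟨i, if_neg hi⟩
    · simp
  unitary_row i j := by simp [apply_ite star]
  unitary_col i j := by simp [apply_ite star, eq_comm]

theorem CrystalRel.one :
    CrystalRel n (fun i j : Fin (n + 1) => if i = j then (1 : B) else 0) where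
  row i j l hjl := by
    by_cases h : i = j
    · simp [h, hjl.ne]
    · simp [h]
  col i k j hik := by
    by_cases h : i = j
    · simp [← h, hik.ne']
    · simp [h]
  anti i k j l hik hjl := by split_ifs <;> simp
  anti_zero i k j l hik hjl _ := by
    have : ¬ (i = l ∧ k = j) := by rintro ⟨rfl, rfl⟩; exact lt_asymm hik hjl
    split_ifs <;> simp <;> tauto
  diag i k j l hik hjl _ := by
    have : ¬ (i = l ∧ k = j) := by rintro ⟨rfl, rfl⟩; exact lt_asymm hik hjl
    split_ifs <;> simp <;> tauto
  diag_comm i k j l hik hjl _ := by split_ifs <;> simp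
  det := by simp
  star_eq i j := by
    by_cases h : i = j
    · subst h; simp
    · rw [if_neg h, star_zero, List.prod_eq_zero]
      rw [List.mem_ofFn]
      obtain ⟨a, ha⟩ := Fin.exists_succAbove_eq (Ne.symm h)
      refine ⟨a, if_neg fun he => ?_⟩
      rw [ha] at he
      exact Fin.succAbove_ne _ _ he.symm

end Identity

/-! ### Convolution along words of letters -/

section Words

variable {n l : ℕ} {q : ℝ}

/-- The convolution product of the representations attached to a list of pairs `(p, r)`, where the
letter `s_r` acts on the `p`-th leg. -/
def legWordOp (hq : q ∈ Set.Ico (0 : ℝ) 1) (ps : List (Fin l × Fin n)) :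
    Fin (n + 1) → Fin (n + 1) → (TensorL2 l →L[ℂ] TensorL2 l) :=
  ps.foldr (fun a Y => convMatrix q (letterOp hq a.1 a.2) Y) (fun i j => if i = j then 1 else 0)

theorem legWordOp_cons (hq : q ∈ Set.Ico (0 : ℝ) 1) (a : Fin l × Fin n)
    (ps : List (Fin l × Fin n)) :
    legWordOp hq (a :: ps) = convMatrix q (letterOp hq a.1 a.2) (legWordOp hq ps) := rfl

theorem legWordOp_nil (hq : q ∈ Set.Ico (0 : ℝ) 1) (i j : Fin (n + 1)) :
    legWordOp hq ([] : List (Fin l × Fin n)) i j = if i = j then 1 else 0 := rfl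

theorem wordOp_eq_legWordOp (hq : q ∈ Set.Ico (0 : ℝ) 1) (w : List (Fin n)) :
    wordOp hq w = legWordOp hq ((List.finRange w.length).map fun p => (p, w.get p)) := by
  rw [legWordOp, List.foldr_map]
  rfl

theorem Commute.convMatrix_right {R : Type*} [Ring R] {x : R} {X Y : Fin (n + 1) → Fin (n + 1) → R}
    (hX : ∀ i j, Commute x (X i j)) (hY : ∀ i j, Commute x (Y i j)) (i j : Fin (n + 1)) :
    Commute x (convMatrix q X Y i j) := by
  rw [convMatrix]
  split_ifs <;> exact Commute.sum_right _ _ _ fun k _ => (hX _ _).mul_right (hY _ _)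

theorem commute_legWordOp (hq : q ∈ Set.Ico (0 : ℝ) 1) {ps : List (Fin l × Fin n)}
    {x : TensorL2 l →L[ℂ] TensorL2 l}
    (hx : ∀ a ∈ ps, ∀ i j, Commute x (letterOp hq a.1 a.2 i j)) (i j : Fin (n + 1)) :
    Commute x (legWordOp hq ps i j) := by
  induction ps generalizing i j with
  | nil =>
    rw [legWordOp_nil]
    split_ifs
    exacts [Commute.one_right _, Commute.zero_right _]
  | cons a ps ih =>
    exact Commute.convMatrix_right (hx a (by simp))
      (ih fun b hb => hx b (List.mem_cons_of_mem _ hb)) i j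

theorem commute_letterOp_legWordOp (hq : q ∈ Set.Ico (0 : ℝ) 1) {ps : List (Fin l × Fin n)}
    {p : Fin l} (hp : p ∉ ps.map Prod.fst) (r : Fin n) (i j i' j' : Fin (n + 1)) :
    Commute (letterOp hq p r i' j') (legWordOp hq ps i j) :=
  commute_legWordOp hq (fun a ha _ _ => commute_letterOp hq
    (fun he => hp (List.mem_map.2 ⟨a, ha, he.symm⟩)) _ _ _ _ _ _) i j

theorem blockMat_entries {R : Type*} [Ring R] (r : Fin n) (a b c d : R) :
    blockMat r a b c d r.castSucc r.castSucc = a ∧ blockMat r a b c d r.castSucc r.succ = b ∧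
    blockMat r a b c d r.succ r.castSucc = c ∧ blockMat r a b c d r.succ r.succ = d := by
  have h := r.castSucc_lt_succ.ne
  simp [blockMat, h, h.symm]

/-- Distinct legs make the entries of each new letter commute with everything convolved so far, so
the block multiplication theorems apply letter by letter, starting from the identity matrix. -/
theorem legWordOp_rel (hq : q ∈ Set.Ico (0 : ℝ) 1) {ps : List (Fin l × Fin n)}
    (hps : (ps.map Prod.fst).Nodup) : SURel n q (legWordOp hq ps) := by
  induction ps with
  | nil => exact ⟨fun _ => QuantumRel.one, fun _ => CrystalRel.one⟩
  | cons a ps ih =>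
    rw [List.map_cons, List.nodup_cons] at hps
    have ih := ih hps.2
    have hc := fun i' j' i j => commute_letterOp_legWordOp hq hps.1 a.2 i j i' j'
    rw [letterOp_eq] at hc
    obtain ⟨e1, e2, e3, e4⟩ := blockMat_entries a.2 (lowerOp hq a.1)
      (if q = 0 then powOp hq a.1 else -((q : ℂ) • powOp hq a.1)) (powOp hq a.1)
      (star (lowerOp hq a.1))
    have h1 := hc a.2.castSucc a.2.castSucc
    have h3 := hc a.2.succ a.2.castSucc
    have h4 := hc a.2.succ a.2.succ
    rw [e1] at h1
    rw [e3] at h3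
    rw [e4] at h4
    have hm := lowerOp_mul_star hq a.1
    have hm' := star_mul_lowerOp hq a.1
    rw [legWordOp_cons, letterOp_eq]
    refine ⟨fun h0 => ?_, fun h0 => ?_⟩
    · have := (ih.quantum h0).block_mul h0 a.2 (star_powOp hq a.1) (lowerOp_mul_powOp hq a.1)
        hm hm' h1 h4 h3
      have e : ∀ X Y : Fin (n + 1) → Fin (n + 1) → (TensorL2 l →L[ℂ] TensorL2 l),
          convMatrix q X Y = fun i j => ∑ k, X i k * Y k j := fun X Y => by
        funext i j
        rw [convMatrix, if_neg h0]
      rw [if_neg h0, e]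
      exact this
    · have hpp : powOp hq a.1 * powOp hq a.1 = powOp hq a.1 := by
        subst h0
        ext f m
        rcases Nat.eq_zero_or_pos (m a.1) with h | h
        · simp [powOp, legDiag_apply, h]
        · simp [powOp, legDiag_apply, h.ne']
      rw [hpp] at hm'
      subst h0
      simp only [Complex.ofReal_zero, ne_eq, OfNat.ofNat_ne_zero, not_false_eq_true, zero_pow,
        zero_smul, add_zero] at hm
      rw [if_pos rfl]
      exact (ih.crystal rfl).block_mul ⟨hm, eq_sub_of_add_eq hm', rfl, star_powOp hq a.1,
        h1, h4, h3⟩ a.2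

end Words

/-! ### Twisting by the torus -/

section Torus

variable {n : ℕ}

theorem torusChar_mul_star (t : Fin n → Circle) (i : Fin (n + 1)) :
    torusChar t i * star (torusChar t i) = 1 := by
  have h : ‖torusChar t i‖ = 1 := by
    rw [torusChar, norm_mul]
    split_ifs <;> simp [Circle.norm_coe]
  have := RCLike.mul_conj (torusChar t i)
  rw [h] at this
  simpa using this

/-- Each `t_i` occurs once and its conjugate occurs once. -/
theorem prod_torusChar (t : Fin n → Circle) : ∏ i, torusChar t i = 1 := by
  have h' : ∀ u : Circle, (u : ℂ) * (starRingEnd ℂ) u = 1 := fun u => by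
    rw [Complex.mul_conj]; simp
  simp only [torusChar]
  rw [Finset.prod_mul_distrib, Fin.prod_univ_castSucc, Fin.prod_univ_succ (n := n)
    (f := fun i => if h : 0 < i.val then star (t ⟨i.val - 1, by omega⟩ : ℂ) else 1)]
  simp [← Finset.prod_mul_distrib, h']

variable {B : Type*} [CStarAlgebra B] {q : ℝ} {z : Fin (n + 1) → Fin (n + 1) → B}

theorem ofFn_smul_prod {m : ℕ} (c : Fin m → ℂ) (f : Fin m → B) :
    (List.ofFn fun i => c i • f i).prod = (∏ i, c i) • (List.ofFn f).prod := by
  induction m with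
  | zero => simp
  | succ m ih =>
    rw [List.ofFn_succ, List.prod_cons, ih, List.ofFn_succ, List.prod_cons, Fin.prod_univ_succ,
      smul_mul_smul_comm]

/-- The twist multiplies each row by a phase, under which the quadratic relations are homogeneous.
The phases have product `1`, which preserves the determinant and makes the conjugate of one phase
the product of the others, as the crystal adjoint formula requires. -/
theorem SURel.torus (hz : SURel n q z) (t : Fin n → Circle) :
    SURel n q fun i j => torusChar t i • z i j := by
  have hm := torusChar_mul_star t
  have hm' : ∀ i, star (torusChar t i) * torusChar t i = 1 := fun i => by rw [mul_comm, hm]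
  refine ⟨fun h0 => ?_, fun h0 => ?_⟩
  · have h := hz.quantum h0
    refine ⟨fun i j k hjl => ?_, fun i j k hik => ?_, fun i j k l hik hjl => ?_,
      fun i j k l hik hjl => ?_, ?_, fun i j => ?_, fun i j => ?_⟩
    · simp only [smul_mul_smul_comm]
      rw [h.row _ _ _ hjl, smul_comm]
    · simp only [smul_mul_smul_comm]
      rw [h.col _ _ _ hik, smul_comm, mul_comm]
    · simp only [smul_mul_smul_comm]
      rw [h.anti _ _ _ _ hik hjl, mul_comm]
    · simp only [smul_mul_smul_comm]
      rw [mul_comm (torusChar t j), ← smul_sub, h.diag _ _ _ _ hik hjl, smul_comm]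
    · simp only [ofFn_smul_prod, prod_torusChar, one_smul]
      exact h.det
    · simp only [star_smul, smul_mul_smul_comm, ← Finset.smul_sum, h.unitary_row]
      split_ifs with hij
      · rw [hij, hm, one_smul]
      · rw [smul_zero]
    · simp only [star_smul, smul_mul_smul_comm, hm', one_smul]
      exact h.unitary_col i j
  · have h := hz.crystal h0
    refine ⟨fun i j k hjl => ?_, fun i j k hik => ?_, fun i j k l hik hjl => ?_,
      fun i j k l hik hjl hm => ?_, fun i j k l hik hjl hm => ?_, fun i j k l hik hjl hm => ?_, ?_,
      fun i j => ?_⟩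
    · simp only [smul_mul_smul_comm]
      rw [h.row _ _ _ hjl, smul_zero]
    · simp only [smul_mul_smul_comm]
      rw [h.col _ _ _ hik, smul_zero]
    · simp only [smul_mul_smul_comm]
      rw [h.anti _ _ _ _ hik hjl, mul_comm]
    · simp only [smul_mul_smul_comm]
      rw [h.anti_zero _ _ _ _ hik hjl hm, smul_zero]
    · simp only [smul_mul_smul_comm]
      rw [mul_comm (torusChar t j), ← smul_sub, h.diag _ _ _ _ hik hjl hm]
    · simp only [smul_mul_smul_comm]
      rw [h.diag_comm _ _ _ _ hik hjl hm, mul_comm]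
    · simp only [ofFn_smul_prod, prod_torusChar, one_smul]
      exact h.det
    · rw [ofFn_smul_prod, star_smul, h.star_eq]
      congr 1
      have := prod_torusChar t
      rw [Fin.prod_univ_succAbove _ i] at this
      calc star (torusChar t i) = star (torusChar t i) *
            (torusChar t i * ∏ a, torusChar t (i.succAbove a)) := by rw [this, mul_one]
        _ = _ := by rw [← mul_assoc, hm', one_mul]

end Torus

theorem torusWordOp_rel {n : ℕ} {q : ℝ} (hq : q ∈ Set.Ico (0 : ℝ) 1) (t : Fin n → Circle)
    (w : List (Fin n)) : SURel n q (torusWordOp hq t w) := by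
  have h : SURel n q (wordOp hq w) := by
    rw [wordOp_eq_legWordOp]
    exact legWordOp_rel hq (by simpa [Function.comp_def] using List.nodup_finRange w.length)
  exact h.torus t

/-! ### Operators that commute with a single leg -/

section LegCommutant

variable {l : ℕ} {p : Fin l} {T X : TensorL2 l →L[ℂ] TensorL2 l}

/-- The operator commutes with the unilateral shift on the `p`-th leg and with its adjoint. -/
def CommutesWithLeg (T : TensorL2 l →L[ℂ] TensorL2 l) (p : Fin l) : Prop :=
  Commute T (legShift p) ∧ Commute T (star (legShift p))

theorem abs_indicator_le_one (k m : ℕ) : |if m = k then (1 : ℝ) else 0| ≤ 1 := by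
  split_ifs <;> simp

/-- The projection onto the vectors that are supported where the `p`-th coordinate is `k`. -/
def legProj (p : Fin l) (k : ℕ) : TensorL2 l →L[ℂ] TensorL2 l :=
  legDiag p (fun m => if m = k then 1 else 0) (abs_indicator_le_one k)

theorem legProj_apply (p : Fin l) (k : ℕ) (f : TensorL2 l) (m : Fin l → ℕ) :
    legProj p k f m = if m p = k then f m else 0 := by
  rw [legProj, legDiag_apply]
  split_ifs <;> simp

theorem legProj_mul_legDiag (p : Fin l) (k : ℕ) (φ : ℕ → ℝ) (hφ : ∀ m, |φ m| ≤ 1) :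
    legProj p k * legDiag p φ hφ = (φ k : ℂ) • legProj p k := by
  ext g x
  rw [mul_apply_eq_comp, legProj_apply, smul_apply, lp.coeFn_smul, Pi.smul_apply, legProj_apply,
    legDiag_apply]
  split_ifs with hx
  · rw [hx]; rfl
  · simp

theorem legProj_zero (p : Fin l) : legProj p 0 = 1 - star (legShift p) * legShift p := by
  ext f m
  by_cases h0 : m p = 0
  · simp [legProj_apply, star_legShift_apply, h0]
  · simp [legProj_apply, legShift_apply, star_legShift_apply, h0,
      Nat.sub_add_cancel (Nat.one_le_iff_ne_zero.2 h0)]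

theorem legProj_succ (p : Fin l) (k : ℕ) :
    legProj p (k + 1) = star (legShift p) * legProj p k * legShift p := by
  ext f m
  by_cases h0 : m p = 0
  · simp [legProj_apply, star_legShift_apply, h0]
  · have : m p - 1 = k ↔ m p = k + 1 := by omega
    simp [legProj_apply, legShift_apply, star_legShift_apply, h0,
      Nat.sub_add_cancel (Nat.one_le_iff_ne_zero.2 h0), this]

theorem CommutesWithLeg.legProj (h : CommutesWithLeg T p) (k : ℕ) : Commute T (legProj p k) := by
  induction k with
  | zero => rw [legProj_zero]; exact (Commute.one_right _).sub_right (h.2.mul_right h.1)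
  | succ k ih => rw [legProj_succ]; exact (h.2.mul_right ih).mul_right h.1

/-- The coordinate at `m` is visible after projecting to the slice where the `p`-th coordinate is `m
p`, and on a slice the diagonal operator is a scalar. This avoids any limit of finite linear
combinations of projections. -/
theorem commute_legDiag_of_legProj (h : ∀ k, Commute T (legProj p k)) (φ : ℕ → ℝ)
    (hφ : ∀ m, |φ m| ≤ 1) : Commute T (legDiag p φ hφ) := by
  ext f m
  have hD := legProj_mul_legDiag p (m p) φ hφ
  have h1 : ∀ g : TensorL2 l, g m = legProj p (m p) g m := fun g => by simp [legProj_apply]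
  calc (T * legDiag p φ hφ) f m = (legProj p (m p) * (T * legDiag p φ hφ)) f m := h1 _
    _ = (T * (legProj p (m p) * legDiag p φ hφ)) f m := by
        rw [← mul_assoc, ← (h _).eq, mul_assoc]
    _ = ((φ (m p) : ℂ) • (legProj p (m p) * T)) f m := by
        rw [hD, mul_smul_comm, (h _).eq]
    _ = (legDiag p φ hφ * T) f m := by
        rw [smul_apply, lp.coeFn_smul, Pi.smul_apply, mul_apply_eq_comp, ← h1]
        rfl

theorem CommutesWithLeg.legDiag (h : CommutesWithLeg T p) (φ : ℕ → ℝ) (hφ : ∀ m, |φ m| ≤ 1) :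
    Commute T (legDiag p φ hφ) :=
  commute_legDiag_of_legProj h.legProj φ hφ

theorem CommutesWithLeg.mul (hT : CommutesWithLeg T p) (hX : CommutesWithLeg X p) :
    CommutesWithLeg (T * X) p :=
  ⟨hT.1.mul_left hX.1, hT.2.mul_left hX.2⟩

/-- A diagonal operator on a leg with non-zero vacuum entry can be cancelled. -/
theorem CommutesWithLeg.cancel (hT : CommutesWithLeg T p) (hX : CommutesWithLeg X p) {φ : ℕ → ℝ}
    {hφ : ∀ m, |φ m| ≤ 1} (h0 : φ 0 ≠ 0) (h : Commute T (_root_.legDiag p φ hφ * X)) :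
    Commute T X := by
  set P := _root_.legProj p 0 with hP
  have hPD : P * _root_.legDiag p φ hφ = (φ 0 : ℂ) • P := legProj_mul_legDiag p 0 φ hφ
  have hPX : Commute T (P * X) := by
    have h1 : Commute T (P * (_root_.legDiag p φ hφ * X)) := (hT.legProj 0).mul_right h
    rw [← mul_assoc, hPD, smul_mul_assoc] at h1
    have h2 := h1.smul_right ((φ 0 : ℂ)⁻¹)
    rwa [smul_smul, inv_mul_cancel₀ (by exact_mod_cast h0), one_smul] at h2
  -- The commutator `Y` commutes with the leg and is killed by the vacuum projection, so `Y = S^* S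
  -- Y = S^* Y S`. Iterating pushes the support of every `Y f` off to infinity, hence `Y = 0`.
  set Y := T * X - X * T with hY
  have hYleg : CommutesWithLeg Y p :=
    ⟨(hT.mul hX).1.sub_left (hX.mul hT).1, (hT.mul hX).2.sub_left (hX.mul hT).2⟩
  have hPY : P * Y = 0 := by
    rw [hY, mul_sub, ← mul_assoc, ← (hT.legProj 0).eq, mul_assoc, hPX.eq, mul_assoc, sub_self]
  have hYS : Y = star (legShift p) * (Y * legShift p) := by
    rw [hYleg.1.eq, ← mul_assoc]
    have h1 : Y = P * Y + star (legShift p) * legShift p * Y := by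
      rw [hP, legProj_zero]; noncomm_ring
    rwa [hPY, zero_add] at h1
  have key : ∀ k (f : TensorL2 l) (m : Fin l → ℕ), m p = k → Y f m = 0 := by
    intro k
    induction k with
    | zero =>
      intro f m hm
      rw [hYS]
      simp [star_legShift_apply, hm]
    | succ k ih =>
      intro f m hm
      rw [hYS]
      simp only [mul_apply_eq_comp, star_legShift_apply, hm]
      rw [if_neg (Nat.succ_ne_zero k)]
      exact ih _ _ (by simp)
  have : Y = 0 := by
    ext f m
    simpa using key _ f m rfl
  exact sub_eq_zero.1 this

variable {q : ℝ} (hq : q ∈ Set.Ico (0 : ℝ) 1)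
include hq

/-- For `q > 0`, `T` commutes with `q^{2N}`, whose eigenvalues on the leg are distinct, hence with
its spectral projections and all diagonal operators; the weights of the lowering operator can then
be divided out to leave `S`. For `q = 0` there are no weights. -/
theorem commutesWithLeg_of_lowerOp (hsa : star T = T) (h : Commute T (lowerOp hq p)) :
    CommutesWithLeg T p := by
  suffices hS : Commute T (legShift p) by
    refine ⟨hS, ?_⟩
    have := hS.star_star
    rwa [hsa] at this
  rcases hq.1.eq_or_lt with h0 | h0
  · subst h0
    rwa [lowerOp_zero] at h
  have hstar : Commute T (star (lowerOp hq p)) := by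
    have := h.star_star
    rwa [hsa] at this
  have hC : Commute T (powOp hq p * powOp hq p) := by
    have h1 : Commute T (1 - star (lowerOp hq p) * lowerOp hq p) :=
      (Commute.one_right _).sub_right (hstar.mul_right h)
    rwa [← star_mul_lowerOp hq p, add_sub_cancel_left] at h1
  have hC' : ∀ (f : TensorL2 l) m, (powOp hq p * powOp hq p) f m = (q : ℂ) ^ (2 * m p) * f m := by
    intro f m
    simp [powOp, legDiag_apply]
    ring
  -- `T` maps the `q^{2k}`-eigenspace into itself; the adjoint of this identity turns invariance
  -- into commutation.
  have hproj : ∀ k, legProj p k * T * legProj p k = T * legProj p k := by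
    intro k
    ext f m
    rw [mul_assoc, mul_apply_eq_comp, legProj_apply]
    split_ifs with hm
    · rfl
    have h1 : (powOp hq p * powOp hq p) (legProj p k f) = ((q : ℂ) ^ (2 * k)) • legProj p k f := by
      ext x
      rw [hC', lp.coeFn_smul, Pi.smul_apply, legProj_apply]
      split_ifs with hx
      · rw [hx]; rfl
      · simp
    have h2 := congrArg (fun A : TensorL2 l →L[ℂ] TensorL2 l => A (legProj p k f) m) hC.eq
    simp only [mul_apply_eq_comp] at h2
    rw [← mul_apply_eq_comp (powOp hq p), h1, map_smul, ← mul_apply_eq_comp (powOp hq p), hC',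
      lp.coeFn_smul, Pi.smul_apply, smul_eq_mul] at h2
    have hne : (q : ℂ) ^ (2 * k) ≠ (q : ℂ) ^ (2 * m p) := by
      norm_cast
      intro he
      have := (pow_right_strictAnti₀ h0 hq.2).injective he
      omega
    have h3 : ((q : ℂ) ^ (2 * k) - (q : ℂ) ^ (2 * m p)) * T (legProj p k f) m = 0 := by
      rw [sub_mul, h2, sub_self]
    exact ((mul_eq_zero.1 h3).resolve_left (sub_ne_zero.2 hne)).symm
  have hP : ∀ k, Commute T (legProj p k) := by
    intro k
    have h1 := congrArg star (hproj k)
    have h2 : star (legProj p k) = legProj p k := star_legDiag _ _ _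
    rw [star_mul, star_mul, star_mul, hsa, h2, ← mul_assoc, hproj] at h1
    exact h1
  have hden : ∀ m : ℕ, 0 < Real.sqrt (1 - q ^ (2 * (m + 1))) := fun m =>
    Real.sqrt_pos.2 (sub_pos.2 (pow_lt_one₀ hq.1 hq.2 (by omega)))
  -- The inverse weights are rescaled by their smallest denominator, at `m = 0`, because `legDiag`
  -- admits only symbols bounded by `1`.
  have hφ : ∀ m : ℕ, |Real.sqrt (1 - q ^ (2 * 1)) / Real.sqrt (1 - q ^ (2 * (m + 1)))| ≤ 1 := by
    intro m
    rw [abs_of_nonneg (by positivity), div_le_one (hden m)]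
    exact Real.sqrt_le_sqrt (sub_le_sub_left (pow_le_pow_of_le_one hq.1 hq.2.le (by omega)) _)
  have h1 : Commute T (legDiag p _ hφ * lowerOp hq p) :=
    (commute_legDiag_of_legProj hP _ hφ).mul_right h
  have h2 : legDiag p _ hφ * lowerOp hq p = ((Real.sqrt (1 - q ^ (2 * 1)) : ℝ) : ℂ) • legShift p := by
    ext f m
    have := Complex.ofReal_ne_zero.2 (hden (m p)).ne'
    simp only [lowerOp, mul_apply_eq_comp, legDiag_apply, legShift_apply, smul_apply,
      lp.coeFn_smul, Pi.smul_apply, Function.update_self, smul_eq_mul]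
    push_cast
    field_simp
  rw [h2] at h1
  have h3 := h1.smul_right ((Real.sqrt (1 - q ^ (2 * 1)) : ℝ) : ℂ)⁻¹
  rwa [smul_smul, inv_mul_cancel₀ (Complex.ofReal_ne_zero.2 (hden 0).ne'), one_smul] at h3

theorem CommutesWithLeg.letterOp {n : ℕ} (h : CommutesWithLeg T p) (r : Fin n) (i j : Fin (n + 1)) :
    Commute T (letterOp hq p r i j) :=
  commute_of_legs hq h.1 h.2 h.legDiag r i j

theorem commutesWithLeg_legWordOp {n : ℕ} {ps : List (Fin l × Fin n)}
    (hp : p ∉ ps.map Prod.fst) (i j : Fin (n + 1)) : CommutesWithLeg (legWordOp hq ps i j) p := by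
  have hne : ∀ a ∈ ps, a.1 ≠ p := fun a ha he => hp (List.mem_map.2 ⟨a, ha, he⟩)
  constructor
  · refine (commute_legWordOp hq (fun a ha => ?_) i j).symm
    exact commute_of_legs hq (commute_legShift_legShift (hne a ha).symm)
      (commute_legShift_star (hne a ha).symm)
      (fun φ hφ => (commute_legDiag_legShift (hne a ha) φ hφ).symm) _
  · refine (commute_legWordOp hq (fun a ha => ?_) i j).symm
    refine commute_of_legs hq (commute_legShift_star (hne a ha)).symm
      (commute_legShift_legShift (hne a ha).symm).star_star (fun φ hφ => ?_) _
    have := (commute_legDiag_legShift (hne a ha) φ hφ).symm.star_star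
    rwa [star_legDiag] at this

end LegCommutant

/-! ### The joint commutant of all legs -/

section Scalars

variable {l : ℕ} {T : TensorL2 l →L[ℂ] TensorL2 l}

/-- A self-adjoint operator that commutes with all the shifts is a scalar. -/
theorem exists_eq_smul_one_of_commutesWithLeg (hsa : star T = T) (h : ∀ p, CommutesWithLeg T p) :
    ∃ c : ℂ, T = c • 1 := by
  set e : TensorL2 l := lp.single 2 0 (1 : ℂ) with he
  -- The vacuum `e` is fixed by every `legProj p 0`, hence so is `T e`, which is thus supported at
  -- the origin.
  have he0 : ∀ m, m ≠ 0 → T e m = 0 := by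
    intro m hm
    obtain ⟨p, hp⟩ := Function.ne_iff.1 hm
    replace hp : ¬ m p = 0 := hp
    have hpe : legProj p 0 e = e := by
      ext x
      rw [legProj_apply]
      split_ifs with hx
      · rfl
      · rw [he, lp.single_apply_ne]
        rintro rfl
        exact hx rfl
    rw [← hpe, ← mul_apply_eq_comp, ((h p).legProj 0).eq, mul_apply_eq_comp, legProj_apply,
      if_neg hp]
  have hTe : T e = T e 0 • e := by
    ext m
    rw [lp.coeFn_smul, Pi.smul_apply]
    by_cases hm : m = 0
    · rw [hm, he, lp.single_apply_self, smul_eq_mul, mul_one]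
    · rw [he0 m hm, he, lp.single_apply_ne _ _ _ hm, smul_zero]
  refine ⟨star (T e 0), ?_⟩
  -- The coordinate at the origin is the inner product with `e`, and `T` can be moved to the other
  -- side.
  have h0 : ∀ f : TensorL2 l, T f 0 = star (T e 0) * f 0 := by
    intro f
    have h1 : inner ℂ e (T f) = inner ℂ (T e) f := by
      nth_rw 2 [← hsa]
      rw [ContinuousLinearMap.star_eq_adjoint, ContinuousLinearMap.adjoint_inner_left]
    rw [hTe, inner_smul_left, he, lp.inner_single_left, lp.inner_single_left] at h1
    simpa using h1
  -- If `m p ≠ 0`, the coordinate at `m` is that of `S_p (T f) = T (S_p f)` at a point with smaller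
  -- coordinate sum, whence the induction on this sum.
  have key : ∀ k (m : Fin l → ℕ) (f : TensorL2 l), ∑ p, m p = k → T f m = star (T e 0) * f m := by
    intro k
    induction k with
    | zero =>
      intro m f hm
      obtain rfl : m = 0 := by
        funext p
        exact (Finset.sum_eq_zero_iff.1 hm) p (Finset.mem_univ p)
      exact h0 f
    | succ k ih =>
      intro m f hm
      obtain ⟨p, hp⟩ : ∃ p, m p ≠ 0 := by
        by_contra! hc
        simp [hc] at hm
      have hsum : ∑ a, Function.update m p (m p - 1) a = k := by
        rw [Finset.sum_update_of_mem (Finset.mem_univ p)]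
        rw [Finset.sum_eq_add_sum_sdiff_singleton_of_mem (Finset.mem_univ p)] at hm
        omega
      have h1 := ih _ (legShift p f) hsum
      rw [← mul_apply_eq_comp, (h p).1.eq, mul_apply_eq_comp, legShift_apply, legShift_apply,
        update_pred_succ p m hp] at h1
      exact h1
  ext f m
  rw [key _ m f rfl]
  rfl

end Scalars

/-! ### Associativity of convolution and letters that miss an index -/

section Convolution

variable {n : ℕ} {R : Type*} [Ring R] {q : ℝ}

theorem convMatrix_of_row_eq {X : Fin (n + 1) → Fin (n + 1) → R} {i : Fin (n + 1)}
    (h : ∀ k, X i k = if i = k then 1 else 0) (Y : Fin (n + 1) → Fin (n + 1) → R)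
    (j : Fin (n + 1)) : convMatrix q X Y i j = Y i j := by
  rw [convMatrix]
  split_ifs <;> simp [h]

theorem convMatrix_of_col_eq {Y : Fin (n + 1) → Fin (n + 1) → R} {j : Fin (n + 1)}
    (h : ∀ k, Y k j = if k = j then 1 else 0) (X : Fin (n + 1) → Fin (n + 1) → R)
    (i : Fin (n + 1)) : convMatrix q X Y i j = X i j := by
  rw [convMatrix]
  split_ifs <;> simp [h]

/-- In the truncated case both sides sum over monotone chains of indices from `i` to `j`, ascending
or descending. -/
theorem convMatrix_assoc (X Y Z : Fin (n + 1) → Fin (n + 1) → R) :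
    convMatrix q (convMatrix q X Y) Z = convMatrix q X (convMatrix q Y Z) := by
  funext i j
  simp only [convMatrix]
  split_ifs
  · simp only [Finset.sum_mul, Finset.mul_sum, mul_assoc]
    refine Finset.sum_comm' fun k m => ?_
    simp only [Finset.mem_Icc]
    rcases le_total i j with h | h
    · simp only [min_eq_left h, max_eq_right h]
      constructor
      · rintro ⟨⟨h1, h2⟩, h3, h4⟩
        rw [min_eq_left h1] at h3
        rw [max_eq_right h1] at h4
        exact ⟨⟨by rwa [min_eq_left (h4.trans h2)], by rwa [max_eq_right (h4.trans h2)]⟩, h3,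
          h4.trans h2⟩
      · rintro ⟨⟨h1, h2⟩, h3, h4⟩
        rw [min_eq_left h4] at h1
        rw [max_eq_right h4] at h2
        exact ⟨⟨h3.trans h1, h2⟩, by rwa [min_eq_left (h3.trans h1)],
          by rwa [max_eq_right (h3.trans h1)]⟩
    · simp only [min_eq_right h, max_eq_left h]
      constructor
      · rintro ⟨⟨h1, h2⟩, h3, h4⟩
        rw [min_eq_right h2] at h3
        rw [max_eq_left h2] at h4
        exact ⟨⟨by rwa [min_eq_right (h1.trans h3)], by rwa [max_eq_left (h1.trans h3)]⟩,
          h1.trans h3, h4⟩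
      · rintro ⟨⟨h1, h2⟩, h3, h4⟩
        rw [min_eq_right h3] at h1
        rw [max_eq_left h3] at h2
        exact ⟨⟨h1, h2.trans h4⟩, by rwa [min_eq_right (h2.trans h4)],
          by rwa [max_eq_left (h2.trans h4)]⟩
  · simp only [Finset.sum_mul, Finset.mul_sum, mul_assoc]
    exact Finset.sum_comm

variable {l : ℕ}

theorem legWordOp_append (hq : q ∈ Set.Ico (0 : ℝ) 1) (ps ps' : List (Fin l × Fin n)) :
    legWordOp hq (ps ++ ps') = convMatrix q (legWordOp hq ps) (legWordOp hq ps') := by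
  induction ps with
  | nil =>
    funext i j
    exact (convMatrix_of_row_eq (fun k => rfl) _ _).symm
  | cons a ps ih =>
    rw [List.cons_append, legWordOp_cons, legWordOp_cons, convMatrix_assoc, ih]

theorem letterOp_of_ne (hq : q ∈ Set.Ico (0 : ℝ) 1) (p : Fin l) (r : Fin n) {i j : Fin (n + 1)}
    (h : (i ≠ r.castSucc ∧ i ≠ r.succ) ∨ (j ≠ r.castSucc ∧ j ≠ r.succ)) :
    letterOp hq p r i j = if i = j then 1 else 0 := by
  rw [letterOp_eq, blockMat]
  rcases h with ⟨h1, h2⟩ | ⟨h1, h2⟩ <;> simp [h1, h2]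

/-- Rows not touched by any letter remain rows of the identity; this isolates the last block of a
standard word. -/
theorem legWordOp_row_of_ne (hq : q ∈ Set.Ico (0 : ℝ) 1) {ps : List (Fin l × Fin n)}
    {i : Fin (n + 1)} (h : ∀ a ∈ ps, i ≠ a.2.castSucc ∧ i ≠ a.2.succ) (j : Fin (n + 1)) :
    legWordOp hq ps i j = if i = j then 1 else 0 := by
  induction ps with
  | nil => rfl
  | cons a ps ih =>
    rw [legWordOp_cons, convMatrix_of_row_eq fun k => letterOp_of_ne hq _ _ (Or.inl (h a (by simp))),
      ih fun b hb => h b (List.mem_cons_of_mem _ hb)]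

theorem legWordOp_col_of_ne (hq : q ∈ Set.Ico (0 : ℝ) 1) {ps : List (Fin l × Fin n)}
    {j : Fin (n + 1)} (h : ∀ a ∈ ps, j ≠ a.2.castSucc ∧ j ≠ a.2.succ) (i : Fin (n + 1)) :
    legWordOp hq ps i j = if i = j then 1 else 0 := by
  induction ps generalizing i with
  | nil => rfl
  | cons a ps ih =>
    rw [legWordOp_cons, convMatrix_of_col_eq (ih fun b hb => h b (List.mem_cons_of_mem _ hb)),
      letterOp_of_ne hq _ _ (Or.inr (h a (by simp)))]

end Convolution

/-! ### Peeling off a standard word from the right -/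

section Irreducibility

variable {n l : ℕ} {q : ℝ} (hq : q ∈ Set.Ico (0 : ℝ) 1) {T : TensorL2 l →L[ℂ] TensorL2 l}
  (hsa : star T = T)
include hsa

/-- For a descending word `s_b s_{b-1} ⋯ s_a`, the row `b + 1` of the matrix generates all operators
on the legs. -/
theorem commutesWithLeg_of_descending (a : Fin l × Fin n) (ps : List (Fin l × Fin n))
    (hnd : ((a :: ps).map Prod.fst).Nodup)
    (hch : (a :: ps).IsChain fun x y => x.2.val = y.2.val + 1)
    (h : ∀ j ≤ a.2.succ, Commute T (legWordOp hq (a :: ps) a.2.succ j)) :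
    ∀ x ∈ a :: ps, CommutesWithLeg T x.1 := by
  induction ps generalizing a with
  | nil =>
    have h1 := h a.2.succ le_rfl
    rw [legWordOp_cons, convMatrix_of_col_eq (legWordOp_nil hq · _), letterOp_eq,
      (blockMat_entries _ _ _ _ _).2.2.2] at h1
    have h2 := h1.star_star
    rw [hsa, star_star] at h2
    simpa using commutesWithLeg_of_lowerOp hq hsa h2
  | cons b ps ih =>
    have hlt : ∀ x ∈ b :: ps, x.2 < a.2 := by
      have h1 : (a :: b :: ps).IsChain fun x y => y.2 < x.2 :=
        hch.imp fun x y hxy => by rw [Fin.lt_def]; omega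
      have : IsTrans (Fin l × Fin n) fun x y => y.2 < x.2 := ⟨fun x y z h1 h2 => h2.trans h1⟩
      exact (List.pairwise_cons.1 (List.isChain_iff_pairwise.1 h1)).1
    -- The later letters are smaller, so only the first letter touches the index `b + 1`, the top
    -- index of the block.
    have hun : ∀ x ∈ b :: ps, a.2.succ ≠ x.2.castSucc ∧ a.2.succ ≠ x.2.succ := by
      intro x hx
      have h1 := hlt x hx
      rw [Fin.lt_def] at h1
      constructor <;> intro he <;> have := congrArg Fin.val he <;> simp at this <;> omega
    have hrow := legWordOp_row_of_ne hq hun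
    have hcol := legWordOp_col_of_ne hq hun
    rw [List.map_cons, List.nodup_cons] at hnd
    have ha : CommutesWithLeg T a.1 := by
      have h1 := h a.2.succ le_rfl
      rw [legWordOp_cons, convMatrix_of_col_eq hcol, letterOp_eq,
        (blockMat_entries _ _ _ _ _).2.2.2] at h1
      have h2 := h1.star_star
      rw [hsa, star_star] at h2
      exact commutesWithLeg_of_lowerOp hq hsa h2
    have hb : a.2.castSucc = b.2.succ := by
      have := (List.isChain_cons_cons.1 hch).1
      exact Fin.ext (by simpa using this)
    -- The rest of the word has no entry from `b + 1` to `j`, so the path must step down at the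
    -- first letter. That leaves `q^N` on its leg times the top row of the shorter descending word,
    -- and `q^N` has vacuum entry `1` even for `q = 0`.
    have hz : ∀ j ≤ a.2.castSucc, legWordOp hq (a :: b :: ps) a.2.succ j =
        powOp hq a.1 * legWordOp hq (b :: ps) a.2.castSucc j := by
      intro j hj
      have hj' : a.2.succ ≠ j := (hj.trans_lt a.2.castSucc_lt_succ).ne'
      have h0 : legWordOp hq (b :: ps) a.2.succ j = 0 := by rw [hrow, if_neg hj']
      rw [legWordOp_cons, letterOp_eq]
      by_cases hq0 : q = 0
      · subst hq0
        rw [convMatrix_zero_succ_of_le _ _ _ _ _ _ hj, h0, mul_zero, add_zero]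
      · rw [convMatrix, if_neg hq0, sum_blockMat_succ, h0, mul_zero, add_zero]
    have hps : ∀ x ∈ b :: ps, CommutesWithLeg T x.1 := by
      refine ih b hnd.2 (List.isChain_cons_cons.1 hch).2 fun j hj => ?_
      rw [← hb] at hj ⊢
      have h1 := h j (hj.trans a.2.castSucc_lt_succ.le)
      rw [hz j hj] at h1
      exact ha.cancel (commutesWithLeg_legWordOp hq hnd.1 _ _) (by simp) h1
    intro x hx
    rcases List.mem_cons.1 hx with rfl | hx
    exacts [ha, hps x hx]

/-- A last letter can be removed if the operator commutes with its leg. -/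
theorem commute_legWordOp_of_append_singleton {ps : List (Fin l × Fin n)} {a : Fin l × Fin n}
    (ha : CommutesWithLeg T a.1)
    (h : ∀ i j, (q = 0 → j ≤ i) → Commute T (legWordOp hq (ps ++ [a]) i j)) (i k : Fin (n + 1))
    (hik : q = 0 → k ≤ i) : Commute T (legWordOp hq ps i k) := by
  rw [legWordOp_append] at h
  have hone : legWordOp hq [a] = letterOp hq a.1 a.2 := by
    funext i j
    rw [legWordOp_cons]
    exact convMatrix_of_col_eq (legWordOp_nil hq · _) _ _
  have hL := fun i j => ha.letterOp hq a.2 i j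
  by_cases hq0 : q = 0
  · replace hik := hik hq0
    subst hq0
    have hP : Commute T (powOp hq a.1) := ha.legDiag _ _
    have hcol : ∀ j, convMatrix 0 (legWordOp hq ps) (legWordOp hq [a]) i j =
        ∑ m, (if m ∈ Finset.Icc (min i j) (max i j) then legWordOp hq ps i m else 0) *
          blockMat a.2 (legShift a.1) (powOp hq a.1) (powOp hq a.1) (star (legShift a.1)) m j := by
      intro j
      rw [hone, letterOp_eq, lowerOp_zero, if_pos rfl, convMatrix, if_pos rfl]
      simp only [ite_mul, zero_mul, Finset.sum_ite_mem, Finset.univ_inter]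
    have hr := a.2.castSucc_lt_succ
    have hc1 : ∀ j ≤ i, j = a.2.castSucc → convMatrix 0 (legWordOp hq ps) (legWordOp hq [a]) i j =
        legWordOp hq ps i a.2.castSucc * legShift a.1 +
          (if a.2.succ ≤ i then legWordOp hq ps i a.2.succ else 0) * powOp hq a.1 := by
      rintro j hj rfl
      rw [hcol, Fintype.sum_eq_add a.2.castSucc a.2.succ hr.ne]
      · simp only [(blockMat_entries _ _ _ _ _).1, (blockMat_entries _ _ _ _ _).2.2.1]
        simp [hj, hr.le]
      · rintro x ⟨h1, h2⟩
        simp [blockMat, h1, h2]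
    have hc2 : ∀ j ≤ i, j = a.2.succ → convMatrix 0 (legWordOp hq ps) (legWordOp hq [a]) i j =
          legWordOp hq ps i a.2.succ * star (legShift a.1) := by
      rintro j hj rfl
      rw [hcol, Fintype.sum_eq_single a.2.succ]
      · simp only [(blockMat_entries _ _ _ _ _).2.2.2]
        simp [hj]
      · rintro x h2
        by_cases h1 : x = a.2.castSucc
        · subst h1
          simp [(hr.trans_le hj).not_ge]
        · simp [blockMat, h1, h2]
    have hst := legShift_mul_star a.1
    have hP0 : powOp hq a.1 = 1 - star (legShift a.1) * legShift a.1 := by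
      rw [← legProj_zero]
      ext f m
      rw [powOp, legDiag_apply, legProj_apply]
      split_ifs with hm <;> simp [hm]
    have hPt : powOp hq a.1 * star (legShift a.1) = 0 := by
      rw [hP0, sub_mul, mul_assoc, hst]; simp
    have hsP : legShift a.1 * powOp hq a.1 = 0 := by
      rw [hP0, mul_sub, ← mul_assoc, hst]; simp
    have hPP : powOp hq a.1 * powOp hq a.1 = powOp hq a.1 := by
      nth_rw 1 [hP0]
      rw [sub_mul, mul_assoc, hsP]; simp
    rcases castSucc_or_succ a.2 k with rfl | rfl | ⟨hk, hk'⟩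
    -- Column `r` is recovered by multiplying with `S^*` on the right, since `S S^* = 1` and `P_0
    -- S^* = 0`.
    · have h1 := (h i _ fun _ => hik).mul_right ha.2
      rw [hc1 _ hik rfl, add_mul, mul_assoc, mul_assoc, hst, hPt, mul_zero, add_zero, mul_one] at h1
      exact h1
    -- Column `r + 1` is recovered as column `r + 1` times `S` plus column `r` times `P_0`, since `S
    -- P_0 = 0` and `S^* S + P_0 = 1`. Both columns stay on or below the diagonal.
    · have h1 := (h i _ fun _ => hik).mul_right ha.1
      have h2 := (h i _ fun _ => hr.le.trans hik).mul_right hP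
      have h3 := h1.add_right h2
      rw [hc2 _ hik rfl, hc1 _ (hr.le.trans hik) rfl, if_pos hik, add_mul, mul_assoc, mul_assoc,
        mul_assoc, hsP, hPP, mul_zero, zero_add, ← mul_add, hP0, add_sub_cancel, mul_one] at h3
      exact h3
    · have h1 := h i k fun _ => hik
      rw [hcol, Fintype.sum_eq_single k] at h1
      · simpa [blockMat, hk, hk'] using h1
      · intro x hx
        simp [blockMat, hk, hk', hx]
  · have hu := ((legWordOp_rel hq (ps := [a]) (by simp)).quantum hq0).unitary_row
    -- For `q > 0` the letter matrix is unitary, so it is undone by its adjoint.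
    have hX : legWordOp hq ps i k = ∑ j, convMatrix q (legWordOp hq ps) (legWordOp hq [a]) i j *
        star (legWordOp hq [a] k j) := by
      simp only [convMatrix, if_neg hq0, Finset.sum_mul, mul_assoc]
      rw [Finset.sum_comm]
      simp only [← Finset.mul_sum, hu]
      simp
    rw [hX]
    refine Commute.sum_right _ _ _ fun j _ => (h i j fun h0 => absurd h0 hq0).mul_right ?_
    have h1 := (hL k j).star_star
    rw [hsa] at h1
    rwa [hone]

theorem commute_legWordOp_of_append {ps ps' : List (Fin l × Fin n)}
    (ha : ∀ a ∈ ps', CommutesWithLeg T a.1)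
    (h : ∀ i j, (q = 0 → j ≤ i) → Commute T (legWordOp hq (ps ++ ps') i j)) (i k : Fin (n + 1))
    (hik : q = 0 → k ≤ i) : Commute T (legWordOp hq ps i k) := by
  induction ps' using List.reverseRecOn with
  | nil => rw [List.append_nil] at h; exact h i k hik
  | append_singleton ps' a ih =>
    rw [← List.append_assoc] at h
    exact ih (fun b hb => ha b (List.mem_append_left _ hb))
      fun i j hij => commute_legWordOp_of_append_singleton hq hsa (ha a (by simp)) h i j hij

omit hsa in
theorem map_val_blockWord {a b : Fin n} (hab : a ≤ b) :
    (blockWord a b).map Fin.val = (List.range' a (b - a + 1)).reverse := by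
  rw [blockWord, List.map_reverse]
  congr 1
  rw [Fin.le_def] at hab
  refine List.Perm.eq_of_pairwise (le := (· < ·)) (fun x y _ _ h1 h2 => absurd h1 h2.not_gt) ?_ ?_ ?_
  · rw [List.pairwise_map]
    exact (List.pairwise_lt_finRange n).filter _
  · exact List.pairwise_lt_range'
  · refine (List.perm_ext_iff_of_nodup ?_ List.nodup_range').2 fun x => ?_
    · exact ((List.nodup_finRange n).filter _).map Fin.val_injective
    · simp only [List.mem_map, List.mem_filter, List.mem_finRange, true_and, List.mem_range'_1,
        decide_eq_true_eq, Fin.le_def]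
      constructor
      · rintro ⟨y, ⟨h1, h2⟩, rfl⟩
        omega
      · rintro ⟨h1, h2⟩
        exact ⟨⟨x, by omega⟩, ⟨h1, by simp only; omega⟩, rfl⟩

omit hsa in
theorem blockWord_spec {a b : Fin n} (hab : a ≤ b) :
    (blockWord a b).IsChain (fun x y => x.val = y.val + 1) ∧ ∃ v, blockWord a b = b :: v := by
  have h := map_val_blockWord hab
  constructor
  · have h1 : ((blockWord a b).map Fin.val).IsChain fun x y => x = y + 1 := by
      rw [h, List.isChain_reverse]
      exact List.isChain_range' _ _ _
    rwa [List.isChain_map] at h1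
  · rw [Fin.le_def] at hab
    rw [List.range'_1_concat, List.reverse_append] at h
    cases hw : blockWord a b with
    | nil => rw [hw] at h; simp at h
    | cons x v =>
      rw [hw] at h
      simp only [List.map_cons, List.reverse_singleton, List.cons_append, List.nil_append,
        List.cons.injEq] at h
      exact ⟨v, by rw [show x = b from Fin.ext (by omega)]⟩

/-- The blocks have increasing top letters from left to right, so row `b + 1` of the product sees
only the last block. Descending along it gives its legs; the block is then removed and the induction
proceeds with the shorter list. -/
theorem commutesWithLeg_of_standard (L : List (Fin n × Fin n))
    (hL : (L.map Prod.snd).Pairwise (· < ·)) (hL' : ∀ p ∈ L, p.1 ≤ p.2)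
    (ps : List (Fin l × Fin n)) (hps : ps.map Prod.snd = L.flatMap fun p => blockWord p.1 p.2)
    (hnd : (ps.map Prod.fst).Nodup)
    (h : ∀ i j, (q = 0 → j ≤ i) → Commute T (legWordOp hq ps i j)) :
    ∀ a ∈ ps, CommutesWithLeg T a.1 := by
  induction L using List.reverseRecOn generalizing ps with
  | nil =>
    simp at hps
    simp [hps]
  | append_singleton L ab ih =>
    obtain ⟨c, b⟩ := ab
    rw [List.flatMap_append, List.map_eq_append_iff] at hps
    obtain ⟨ps₁, ps₂, rfl, h1, h2⟩ := hps
    simp only [List.flatMap_cons, List.flatMap_nil, List.append_nil] at h2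
    obtain ⟨hch, v, hv⟩ := blockWord_spec (hL' (c, b) (by simp))
    rw [List.map_append, List.pairwise_append] at hL
    rw [List.map_append, List.nodup_append] at hnd
    simp only [List.map_cons, List.map_nil, List.mem_singleton, forall_eq] at hL
    have hlt : ∀ x ∈ ps₁, x.2 < b := by
      intro x hx
      have hx' : x.2 ∈ ps₁.map Prod.snd := List.mem_map_of_mem hx
      rw [h1, List.mem_flatMap] at hx'
      obtain ⟨p, hp, hxp⟩ := hx'
      have h3 := hL.2.2 p.2 (List.mem_map_of_mem hp)
      simp only [blockWord, List.mem_reverse, List.mem_filter, decide_eq_true_eq] at hxp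
      exact hxp.2.2.trans_lt h3
    have hlegs : ∀ a ∈ ps₂, CommutesWithLeg T a.1 := by
      cases ps₂ with
      | nil => simp
      | cons a ps₂ =>
        rw [hv, List.map_cons, List.cons.injEq] at h2
        have hch' : (a :: ps₂).IsChain fun x y => x.2.val = y.2.val + 1 := by
          rw [hv, ← h2.1, ← h2.2, ← List.map_cons, List.isChain_map] at hch
          exact hch
        refine commutesWithLeg_of_descending hq hsa a ps₂ hnd.2.1 hch' fun j hj => ?_
        have h3 := h a.2.succ j fun _ => hj
        rw [legWordOp_append, convMatrix_of_row_eq] at h3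
        · exact h3
        · refine legWordOp_row_of_ne hq fun x hx => ?_
          have h4 := hlt x hx
          rw [show b = a.2 from h2.1.symm, Fin.lt_def] at h4
          constructor <;> intro he <;> have := congrArg Fin.val he <;> simp at this <;> omega
    have h5 := ih hL.1 (fun p hp => hL' p (List.mem_append_left _ hp)) ps₁ h1 hnd.1
      (commute_legWordOp_of_append hq hsa hlegs h)
    intro a ha
    rcases List.mem_append.1 ha with ha | ha
    exacts [h5 a ha, hlegs a ha]

end Irreducibility

/-! ### The representations of the algebra and their irreducibility -/

section Representation

variable {n : ℕ} {q : ℝ} (hq : q ∈ Set.Ico (0 : ℝ) 1) (t : Fin n → Circle) (w : List (Fin n))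

/-- The representation `π_{t,w}` of `A_q(n)`. -/
def torusWordHom : SUAlg n q →⋆ₐ[ℂ] (TensorL2 w.length →L[ℂ] TensorL2 w.length) :=
  (SUAlg.existsUnique_lift (torusWordOp_rel hq t w)).choose

theorem torusWordHom_gen (i j : Fin (n + 1)) :
    torusWordHom hq t w (SUAlg.gen n q i j) = torusWordOp hq t w i j :=
  (SUAlg.existsUnique_lift (torusWordOp_rel hq t w)).choose_spec.1 i j

instance (l : ℕ) : Nontrivial (TensorL2 l) :=
  ⟨lp.single 2 0 (1 : ℂ), 0, fun h => by
    have := congrArg (fun f : TensorL2 l => f 0) h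
    simp at this⟩

/-- Invariance under `A` and `A^*` reads `P A P = A P` and `P A^* P = A^* P`; the adjoint of the
second is `P A P = P A`. -/
theorem commute_starProjection {H : Type*} [NormedAddCommGroup H] [InnerProductSpace ℂ H]
    [CompleteSpace H] (K : Submodule ℂ H) [K.HasOrthogonalProjection] (A : H →L[ℂ] H)
    (h : ∀ v ∈ K, A v ∈ K) (h' : ∀ v ∈ K, star A v ∈ K) : Commute K.starProjection A := by
  have hsa : star K.starProjection = K.starProjection := isSelfAdjoint_starProjection K
  have key : ∀ B : H →L[ℂ] H, (∀ v ∈ K, B v ∈ K) →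
      K.starProjection * B * K.starProjection = B * K.starProjection := by
    intro B hB
    ext v
    exact Submodule.starProjection_eq_self_iff.2 (hB _ (Submodule.starProjection_apply_mem K v))
  have h1 := congrArg star (key _ h')
  rw [star_mul, star_mul, star_mul, hsa, star_star, ← mul_assoc, key _ h] at h1
  exact h1.symm

theorem exists_eq_smul_one_of_standard (hw : IsStandardWord w)
    {T : TensorL2 w.length →L[ℂ] TensorL2 w.length} (hsa : star T = T)
    (h : ∀ i j, Commute T (wordOp hq w i j)) : ∃ c : ℂ, T = c • 1 := by
  rw [wordOp_eq_legWordOp] at h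
  obtain ⟨L, hL, hL', hL''⟩ := hw
  have hps : ((List.finRange w.length).map fun p => (p, w.get p)).map Prod.snd = w := by
    rw [List.map_map]
    exact List.map_get_finRange w
  have hnd : ((List.finRange w.length).map fun p => (p, w.get p)).map Prod.fst =
      List.finRange w.length := by
    rw [List.map_map]
    exact List.map_id _
  revert h hps hnd
  generalize ((List.finRange w.length).map fun p => (p, w.get p)) = ps
  intro h hps hnd
  have hlegs := commutesWithLeg_of_standard hq hsa L hL hL' ps (hps.trans hL'')
    (hnd ▸ List.nodup_finRange _) fun i j _ => h i j
  refine exists_eq_smul_one_of_commutesWithLeg hsa fun p => ?_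
  have hp : p ∈ ps.map Prod.fst := hnd ▸ List.mem_finRange p
  obtain ⟨a, ha, hap⟩ := List.mem_map.1 hp
  exact hap ▸ hlegs a ha

theorem eq_bot_or_top_of_invariant (hw : IsStandardWord w) (K : Submodule ℂ (TensorL2 w.length))
    (hK : IsClosed (K : Set (TensorL2 w.length)))
    (hinv : ∀ i j, ∀ v ∈ K, torusWordOp hq t w i j v ∈ K)
    (hinv' : ∀ i j, ∀ v ∈ K, star (torusWordOp hq t w i j) v ∈ K) : K = ⊥ ∨ K = ⊤ := by
  have : CompleteSpace K := hK.completeSpace_coe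
  have hsa : star K.starProjection = K.starProjection := isSelfAdjoint_starProjection K
  have hword : ∀ i j, Commute K.starProjection (wordOp hq w i j) := fun i j => by
    have h1 := commute_starProjection K _ (hinv i j) (hinv' i j)
    rw [torusWordOp] at h1
    -- The torus phase is a unit scalar and does not affect the commutant.
    have h2 := h1.smul_right (star (torusChar t i))
    rwa [smul_smul, mul_comm, torusChar_mul_star, one_smul] at h2
  obtain ⟨c, hc⟩ := exists_eq_smul_one_of_standard hq w hw hsa hword
  by_cases h0 : c = 0
  · left
    rw [Submodule.eq_bot_iff]
    intro v hv
    rw [← Submodule.starProjection_eq_self_iff.2 hv, hc, h0]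
    simp
  · right
    rw [Submodule.eq_top_iff']
    intro v
    -- The projection is multiplication by `c ≠ 0`, so it maps `c⁻¹ • v` to `v`.
    have h1 := Submodule.starProjection_apply_mem K (c⁻¹ • v)
    rw [hc] at h1
    simpa [h0] using h1

theorem isIrredRep_torusWordHom (hw : IsStandardWord w) :
    IsIrredRep (torusWordHom hq t w).toNonUnitalStarAlgHom where
  ne_zero h := by
    have h1 := DFunLike.congr_fun h 1
    have h2 : torusWordHom hq t w 1 = 0 := h1
    rw [map_one] at h2
    exact one_ne_zero h2
  irred K hK hinv := by
    refine eq_bot_or_top_of_invariant hq t w hw K hK (fun i j v hv => ?_) fun i j v hv => ?_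
    · rw [← torusWordHom_gen]
      exact hinv (SUAlg.gen n q i j) v hv
    · rw [← torusWordHom_gen, ← map_star]
      exact hinv (star (SUAlg.gen n q i j)) v hv

end Representation

/-! ### Induction on elements of the universal algebra -/

section Density

/-- A closed property that is stable under the `*`-algebra operations holds on `A_q(n)` if it holds
for the generators. -/
theorem SUAlg.induction {n : ℕ} {q : ℝ} (P : SUAlg n q → Prop) (hcl : IsClosed {a | P a})
    (hgen : ∀ i j, P (SUAlg.gen n q i j)) (hone : ∀ c : ℂ, P (c • 1))
    (hadd : ∀ a b, P a → P b → P (a + b)) (hmul : ∀ a b, P a → P b → P (a * b))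
    (hstar : ∀ a, P a → P (star a)) (a : SUAlg n q) : P a := by
  set M := StarAlgebra.adjoin ℂ
    (Set.range fun p : Fin (n + 1) × Fin (n + 1) => SUProduct.gen n q p.1 p.2) with hM
  have hle : M ≤ SUSub n q := StarSubalgebra.le_topologicalClosure _
  have h1 : ∀ x (hx : x ∈ M), P ⟨x, hle hx⟩ := by
    intro x hx
    induction hx using StarAlgebra.adjoin_induction with
    | mem x h => obtain ⟨p, rfl⟩ := h; exact hgen p.1 p.2
    | algebraMap c =>
      have h := hone c
      rwa [show c • (1 : SUAlg n q) = ⟨algebraMap ℂ (SUProduct n q) c,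
        hle (algebraMap_mem M c)⟩ from
        Subtype.ext (Algebra.algebraMap_eq_smul_one c).symm] at h
    | add x y hx hy h1 h2 => exact hadd _ _ h1 h2
    | mul x y hx hy h1 h2 => exact hmul _ _ h1 h2
    | star x hx h1 => exact hstar _ h1
  obtain ⟨x, hx⟩ := a
  have hx' : x ∈ closure (M : Set (SUProduct n q)) := hx
  obtain ⟨u, hu, hux⟩ := mem_closure_iff_seq_limit.1 hx'
  refine hcl.mem_of_tendsto (f := fun k => (⟨u k, hle (hu k)⟩ : SUAlg n q)) (b := Filter.atTop) ?_
    (Filter.Eventually.of_forall fun k => h1 _ (hu k))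
  exact tendsto_subtype_rng.2 hux

end Density

/-! ### Asymptotic joint eigenvectors -/

section ApproximateEigenvectors

open Filter Topology

variable {H : Type*} [NormedAddCommGroup H] [InnerProductSpace ℂ H] [CompleteSpace H]

/-- `ξ` is asymptotically an eigenvector of `A` and of its adjoint. -/
def AsympEigen (ξ : ℕ → H) (A : H →L[ℂ] H) (c : ℂ) : Prop :=
  Tendsto (fun k => A (ξ k) - c • ξ k) atTop (𝓝 0) ∧
    Tendsto (fun k => star A (ξ k) - star c • ξ k) atTop (𝓝 0)

variable {ξ : ℕ → H} {A B : H →L[ℂ] H} {c d : ℂ}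

theorem AsympEigen.star (h : AsympEigen ξ A c) : AsympEigen ξ (star A) (star c) :=
  ⟨h.2, by simpa only [star_star] using h.1⟩

theorem AsympEigen.add (hA : AsympEigen ξ A c) (hB : AsympEigen ξ B d) :
    AsympEigen ξ (A + B) (c + d) := by
  constructor
  · have := hA.1.add hB.1
    rw [add_zero] at this
    refine this.congr fun k => ?_
    rw [add_apply, add_smul]; abel
  · have := hA.2.add hB.2
    rw [add_zero] at this
    refine this.congr fun k => ?_
    rw [star_add, star_add, add_apply, add_smul]; abel

omit [CompleteSpace H] in
theorem tendsto_mul_apply_sub (hA : Tendsto (fun k => A (ξ k) - c • ξ k) atTop (𝓝 0))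
    (hB : Tendsto (fun k => B (ξ k) - d • ξ k) atTop (𝓝 0)) :
    Tendsto (fun k => (A * B) (ξ k) - (c * d) • ξ k) atTop (𝓝 0) := by
  have h1 := (A.continuous.tendsto 0).comp hB
  rw [map_zero] at h1
  have := h1.add (hA.const_smul d)
  rw [smul_zero, add_zero] at this
  refine this.congr fun k => ?_
  simp only [Function.comp_apply, map_sub, map_smul, mul_apply_eq_comp, smul_sub, smul_smul]
  rw [mul_comm d c]; abel

theorem AsympEigen.mul (hA : AsympEigen ξ A c) (hB : AsympEigen ξ B d) :
    AsympEigen ξ (A * B) (c * d) := by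
  refine ⟨tendsto_mul_apply_sub hA.1 hB.1, ?_⟩
  rw [star_mul, star_mul]
  exact tendsto_mul_apply_sub hB.2 hA.2

theorem AsympEigen.smul_one (c : ℂ) : AsympEigen ξ (c • (1 : H →L[ℂ] H)) c := by
  constructor <;> simp

theorem AsympEigen.one : AsympEigen ξ (1 : H →L[ℂ] H) 1 := by
  simpa using AsympEigen.smul_one (ξ := ξ) 1

theorem AsympEigen.zero : AsympEigen ξ (0 : H →L[ℂ] H) 0 := by
  simpa using AsympEigen.smul_one (ξ := ξ) 0

theorem AsympEigen.smul (hA : AsympEigen ξ A c) (d : ℂ) : AsympEigen ξ (d • A) (d * c) := by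
  simpa using (AsympEigen.smul_one d).mul hA

theorem AsympEigen.sum {ι : Type*} (s : Finset ι) {F : ι → H →L[ℂ] H} {f : ι → ℂ}
    (h : ∀ i ∈ s, AsympEigen ξ (F i) (f i)) : AsympEigen ξ (∑ i ∈ s, F i) (∑ i ∈ s, f i) := by
  classical
  induction s using Finset.induction_on with
  | empty => simpa using AsympEigen.zero
  | insert a s ha ih =>
    rw [Finset.sum_insert ha, Finset.sum_insert ha]
    exact (h a (by simp)).add (ih fun i hi => h i (by simp [hi]))

/-- The source of the kernel inclusion: for unit vectors the asymptotic eigenvalue of the zero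
operator can only be zero. -/
theorem AsympEigen.eq_of_norm_eq_one (hξ : ∀ k, ‖ξ k‖ = 1) (hA : AsympEigen ξ A c)
    (hA' : A = 0) : c = 0 := by
  have h := hA.1.norm
  subst hA'
  simp only [zero_apply, zero_sub, norm_neg, norm_smul, hξ, mul_one, norm_zero] at h
  exact norm_eq_zero.1 (tendsto_nhds_unique tendsto_const_nhds h)

theorem isClosed_asympEigen {𝓐 : Type*} [CStarAlgebra 𝓐] (hξ : ∀ k, ‖ξ k‖ = 1)
    (φ : 𝓐 → (H →L[ℂ] H)) (χ : 𝓐 → ℂ) (hφ : Continuous φ) (hχ : Continuous χ) :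
    IsClosed {a | AsympEigen ξ (φ a) (χ a)} := by
  have key : ∀ (φ : 𝓐 → (H →L[ℂ] H)) (χ : 𝓐 → ℂ), Continuous φ → Continuous χ →
      IsClosed {a | Tendsto (fun k => φ a (ξ k) - χ a • ξ k) atTop (𝓝 0)} := by
    intro φ χ hφ hχ
    refine isClosed_of_closure_subset fun a ha => ?_
    rw [Set.mem_ofPred_eq, Metric.tendsto_atTop]
    intro ε hε
    -- The error of replacing `a` by a nearby `b` is uniform in `k`, as the `ξ k` are unit vectors.
    have h1 : ∀ᶠ b in 𝓝 a, ‖(φ a - χ a • (1 : H →L[ℂ] H)) - (φ b - χ b • 1)‖ < ε / 2 := by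
      have hc : Continuous fun b => φ b - χ b • (1 : H →L[ℂ] H) :=
        hφ.sub (hχ.smul continuous_const)
      have := (Metric.tendsto_nhds.1 (hc.tendsto a)) (ε / 2) (by positivity)
      filter_upwards [this] with b hb
      rwa [dist_comm, dist_eq_norm] at hb
    obtain ⟨b, hb, hb'⟩ := (mem_closure_iff_frequently.1 ha).and_eventually h1 |>.exists
    obtain ⟨N, hN⟩ := (Metric.tendsto_atTop.1 hb) (ε / 2) (by positivity)
    refine ⟨N, fun k hk => ?_⟩
    have h2 := hN k hk
    rw [dist_zero_right] at h2 ⊢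
    have h3 := ((φ a - χ a • (1 : H →L[ℂ] H)) - (φ b - χ b • 1)).le_opNorm (ξ k)
    rw [hξ, mul_one] at h3
    have h4 : φ a (ξ k) - χ a • ξ k = ((φ a - χ a • (1 : H →L[ℂ] H)) - (φ b - χ b • 1)) (ξ k) +
        (φ b (ξ k) - χ b • ξ k) := by
      simp
    rw [h4]
    refine (norm_add_le _ _).trans_lt ?_
    linarith
  have h := (key φ χ hφ hχ).inter (key (fun a => Star.star (φ a)) (fun a => Star.star (χ a))
    hφ.star hχ.star)
  exact h

end ApproximateEigenvectors

/-! ### Box vectors are asymptotically fixed by every letter -/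

section BoxVectors

open Filter Topology

theorem lp_norm_sq_of_support {X : Type*} (s : Finset X) (f : lp (fun _ : X => ℂ) 2)
    (h0 : ∀ m ∉ s, f m = 0) : ‖f‖ ^ 2 = ∑ m ∈ s, ‖f m‖ ^ 2 := by
  have h := lp.norm_rpow_eq_tsum (p := 2) (by simp) f
  simp only [ENNReal.toReal_ofNat, Real.rpow_ofNat] at h
  rw [h]
  exact tsum_eq_sum fun m hm => by simp [h0 m hm]

theorem lp_norm_sq_le_of_support {X : Type*} (s : Finset X) (f : lp (fun _ : X => ℂ) 2) {C : ℝ}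
    (h0 : ∀ m ∉ s, f m = 0) (hC : ∀ m ∈ s, ‖f m‖ ≤ C) : ‖f‖ ^ 2 ≤ s.card * C ^ 2 := by
  rw [lp_norm_sq_of_support s f h0, ← nsmul_eq_mul]
  exact Finset.sum_le_card_nsmul _ _ _ fun m hm =>
    pow_le_pow_left₀ (norm_nonneg _) (hC m hm) 2

/-- The box `[k + 1, 2 k + 2)^l`. -/
def box (l k : ℕ) : Finset (Fin l → ℕ) := Fintype.piFinset fun _ => Finset.Ico (k + 1) (2 * k + 2)

theorem mem_box {l k : ℕ} {m : Fin l → ℕ} :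
    m ∈ box l k ↔ ∀ p, k + 1 ≤ m p ∧ m p < 2 * k + 2 := by
  simp [box]

theorem update_mem_box {l k : ℕ} {m : Fin l → ℕ} (p : Fin l) (a : ℕ) :
    Function.update m p a ∈ box l k ↔ (k + 1 ≤ a ∧ a < 2 * k + 2) ∧
      ∀ p' ≠ p, k + 1 ≤ m p' ∧ m p' < 2 * k + 2 := by
  rw [mem_box]
  constructor
  · intro h
    refine ⟨by simpa using h p, fun p' hp => by simpa [hp] using h p'⟩
  · rintro ⟨h1, h2⟩ p'
    by_cases hp : p' = p
    · subst hp
      simpa using h1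
    · simpa [hp] using h2 p' hp

/-- The value of `boxVec l k` on the box. -/
def boxVal (l k : ℕ) : ℝ := (Real.sqrt ((k + 1) ^ l))⁻¹

theorem boxVal_nonneg (l k : ℕ) : 0 ≤ boxVal l k := inv_nonneg.2 (Real.sqrt_nonneg _)

theorem boxVal_sq (l k : ℕ) : ((k : ℝ) + 1) ^ l * boxVal l k ^ 2 = 1 := by
  rw [boxVal, inv_pow, Real.sq_sqrt (by positivity)]
  exact mul_inv_cancel₀ (by positivity)

/-- The normalised indicator function of a box. -/
def boxVec (l k : ℕ) : TensorL2 l := ∑ m ∈ box l k, lp.single 2 m (boxVal l k : ℂ)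

theorem boxVec_apply (l k : ℕ) (m : Fin l → ℕ) :
    boxVec l k m = if m ∈ box l k then (boxVal l k : ℂ) else 0 := by
  rw [boxVec, lp.coeFn_sum, Finset.sum_apply]
  simp [lp.single_apply, Pi.single_apply]

theorem norm_boxVal (l k : ℕ) : ‖(boxVal l k : ℂ)‖ = boxVal l k := by
  rw [Complex.norm_real, Real.norm_of_nonneg (boxVal_nonneg l k)]

theorem card_box (l k : ℕ) : (box l k).card = (k + 1) ^ l := by
  rw [box, Fintype.card_piFinset]
  simp only [Nat.card_Ico, Finset.prod_const, Finset.card_univ, Fintype.card_fin]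
  congr 1
  omega

theorem norm_boxVec (l k : ℕ) : ‖boxVec l k‖ = 1 := by
  have h := lp_norm_sq_of_support (box l k) (boxVec l k) fun m hm => by simp [boxVec_apply, hm]
  rw [Finset.sum_congr rfl fun m hm => by rw [boxVec_apply, if_pos hm, norm_boxVal],
    Finset.sum_const, card_box, nsmul_eq_mul, Nat.cast_pow, Nat.cast_add, Nat.cast_one,
    boxVal_sq] at h
  exact (pow_eq_one_iff_of_nonneg (norm_nonneg _) two_ne_zero).1 h

/-- A vector that is supported on two faces of a box has small norm. -/
theorem norm_sq_le_of_faces {l : ℕ} (p : Fin l) (k a b : ℕ) (f : TensorL2 l)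
    (h0 : ∀ m, f m ≠ 0 → (m p = a ∨ m p = b) ∧ ∀ p' ≠ p, k + 1 ≤ m p' ∧ m p' < 2 * k + 2)
    (hC : ∀ m, ‖f m‖ ≤ boxVal l k) : ‖f‖ ^ 2 ≤ 2 * (1 / ((k : ℝ) + 1)) := by
  classical
  set F : Fin l → Finset ℕ :=
    Function.update (fun _ => Finset.Ico (k + 1) (2 * k + 2)) p {a, b} with hF
  have h1 := lp_norm_sq_le_of_support (Fintype.piFinset F) f (C := boxVal l k) (fun m hm => by
    by_contra hne
    obtain ⟨h1, h2⟩ := h0 m hne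
    refine hm (Fintype.mem_piFinset.2 fun p' => ?_)
    by_cases hp : p' = p
    · subst hp
      simpa [hF] using h1
    · simpa [hF, hp] using h2 p' hp) fun m _ => hC m
  -- Two faces hold at most `2 (k + 1)^{l-1}` points; multiplying by `k + 1` avoids the exponent `l
  -- - 1`.
  have h2 : (Fintype.piFinset F).card * (k + 1) ≤ 2 * (k + 1) ^ l := by
    rw [Fintype.card_piFinset, ← Finset.mul_prod_erase _ _ (Finset.mem_univ p),
      Finset.prod_congr rfl fun p' hp' => by
        rw [hF, Function.update_of_ne (Finset.ne_of_mem_erase hp')], Finset.prod_const,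
      Finset.card_erase_of_mem (Finset.mem_univ p), Finset.card_univ, Fintype.card_fin, hF,
      Function.update_self, Nat.card_Ico, show 2 * k + 2 - (k + 1) = k + 1 by omega, mul_assoc,
      pow_sub_one_mul (Fin.pos p).ne']
    exact Nat.mul_le_mul_right _ Finset.card_le_two
  have h3 : ((Fintype.piFinset F).card : ℝ) * (k + 1) ≤ 2 * (k + 1) ^ l := by exact_mod_cast h2
  have h4 := boxVal_sq l k
  have hk : (0 : ℝ) < k + 1 := by positivity
  refine h1.trans ?_
  rw [mul_one_div, le_div_iff₀ hk]
  calc ((Fintype.piFinset F).card : ℝ) * boxVal l k ^ 2 * (k + 1)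
      = ((Fintype.piFinset F).card * (k + 1)) * boxVal l k ^ 2 := by ring
    _ ≤ (2 * (k + 1) ^ l) * boxVal l k ^ 2 := mul_le_mul_of_nonneg_right h3 (sq_nonneg _)
    _ = 2 := by rw [mul_assoc, h4, mul_one]

theorem tendsto_zero_of_norm_sq_le {E : Type*} [SeminormedAddCommGroup E] {u : ℕ → E} {b : ℕ → ℝ}
    (h : ∀ k, ‖u k‖ ^ 2 ≤ b k) (hb : Tendsto b atTop (𝓝 0)) : Tendsto u atTop (𝓝 0) := by
  rw [tendsto_zero_iff_norm_tendsto_zero]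
  have h1 : Tendsto (fun k => ‖u k‖ ^ 2) atTop (𝓝 0) :=
    squeeze_zero (fun k => sq_nonneg _) h hb
  have h2 := h1.sqrt
  simpa only [Real.sqrt_sq (norm_nonneg _), Real.sqrt_zero] using h2

theorem norm_sq_sub_boxVec_le {l : ℕ} (p : Fin l) (k a b : ℕ) (f : TensorL2 l)
    (P : (Fin l → ℕ) → Prop) [DecidablePred P]
    (hf : ∀ m, f m = if P m then (boxVal l k : ℂ) else 0)
    (h : ∀ m, ¬ (P m ↔ m ∈ box l k) →
      (m p = a ∨ m p = b) ∧ ∀ p' ≠ p, k + 1 ≤ m p' ∧ m p' < 2 * k + 2) :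
    ‖f - boxVec l k‖ ^ 2 ≤ 2 * (1 / ((k : ℝ) + 1)) := by
  have h1 : ∀ m, (f - boxVec l k) m = (if P m then (boxVal l k : ℂ) else 0) -
      if m ∈ box l k then (boxVal l k : ℂ) else 0 := fun m => by
    rw [← hf, ← boxVec_apply]
    rfl
  refine norm_sq_le_of_faces p k a b _ (fun m hm => h m fun hP => hm ?_) fun m => ?_
  · rw [h1]
    simp only [hP, sub_self]
  · rw [h1]
    have h2 := boxVal_nonneg l k
    split_ifs <;> simp [abs_of_nonneg h2, h2]

/-- Shifting the box by one step in direction `p` changes its indicator on two faces only, a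
proportion of order `1 / (k + 1)` of the box. -/
theorem asympEigen_legShift {l : ℕ} (p : Fin l) :
    AsympEigen (boxVec l) (legShift p) 1 := by
  have hb : Tendsto (fun k : ℕ => 2 * (1 / ((k : ℝ) + 1))) atTop (𝓝 0) := by
    simpa using (tendsto_one_div_add_atTop_nhds_zero_nat (𝕜 := ℝ)).const_mul 2
  have hm (k : ℕ) (m : Fin l → ℕ) : m ∈ box l k ↔ (k + 1 ≤ m p ∧ m p < 2 * k + 2) ∧
      ∀ p' ≠ p, k + 1 ≤ m p' ∧ m p' < 2 * k + 2 := by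
    rw [← update_mem_box p (m p), Function.update_eq_self]
  constructor
  · simp only [one_smul]
    -- The image under `S` lives on `[k, 2k + 1)` in direction `p`: the slice `k` is gained and the
    -- slice `2k + 1` lost.
    refine tendsto_zero_of_norm_sq_le (fun k => norm_sq_sub_boxVec_le p k k (2 * k + 1) _
      (fun m => Function.update m p (m p + 1) ∈ box l k)
      (fun m => by rw [legShift_apply, boxVec_apply]) fun m => ?_) hb
    rw [update_mem_box, hm]
    generalize (∀ p' ≠ p, k + 1 ≤ m p' ∧ m p' < 2 * k + 2) = Q
    by_cases hQ : Q
    · simp only [hQ, and_true]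
      omega
    · simp only [hQ, and_false, not_true, false_implies]
  · simp only [star_one, one_smul]
    -- For `S^*` the slice `k + 1` is lost and the slice `2k + 2` gained.
    refine tendsto_zero_of_norm_sq_le (fun k => norm_sq_sub_boxVec_le p k (k + 1) (2 * k + 2) _
      (fun m => m p ≠ 0 ∧ Function.update m p (m p - 1) ∈ box l k)
      (fun m => by
        rw [star_legShift_apply, boxVec_apply]
        by_cases h : m p = 0 <;> simp [h]) fun m => ?_) hb
    rw [update_mem_box, hm]
    generalize (∀ p' ≠ p, k + 1 ≤ m p' ∧ m p' < 2 * k + 2) = Q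
    by_cases hQ : Q
    · simp only [hQ, and_true]
      omega
    · simp only [hQ, and_false, not_true, false_implies]

/-- All coordinates of the `k`-th box exceed `k`, so there the symbol is uniformly close to its
limit. -/
theorem asympEigen_legDiag {l : ℕ} (p : Fin l) (φ : ℕ → ℝ) (hφ : ∀ m, |φ m| ≤ 1) {c : ℝ}
    (h : Tendsto φ atTop (𝓝 c)) : AsympEigen (boxVec l) (legDiag p φ hφ) (c : ℂ) := by
  have key : Tendsto (fun k => legDiag p φ hφ (boxVec l k) - (c : ℂ) • boxVec l k) atTop
      (𝓝 0) := by
    rw [Metric.tendsto_atTop] at h ⊢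
    intro ε hε
    obtain ⟨N, hN⟩ := h (ε / 2) (half_pos hε)
    refine ⟨N, fun k hk => ?_⟩
    rw [dist_zero_right]
    refine lt_of_le_of_lt ?_ (half_lt_self hε)
    have hval (m : Fin l → ℕ) : (legDiag p φ hφ (boxVec l k) - (c : ℂ) • boxVec l k) m =
        ((φ (m p) - c : ℝ) : ℂ) * boxVec l k m := by
      change (φ (m p) : ℂ) * boxVec l k m - (c : ℂ) * boxVec l k m = _
      rw [Complex.ofReal_sub, sub_mul]
    refine (sq_le_sq₀ (norm_nonneg _) (half_pos hε).le).1 ?_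
    refine (lp_norm_sq_le_of_support (box l k) _ (C := ε / 2 * boxVal l k) (fun m hm => ?_)
      fun m hm => ?_).trans ?_
    · rw [hval, boxVec_apply, if_neg hm, mul_zero]
    · have h1 := (hN (m p) (by have := (mem_box.1 hm p).1; omega)).le
      rw [Real.dist_eq] at h1
      rw [hval, boxVec_apply, if_pos hm, norm_mul, norm_boxVal, Complex.norm_real, Real.norm_eq_abs]
      exact mul_le_mul_of_nonneg_right h1 (boxVal_nonneg l k)
    · rw [card_box, mul_pow, Nat.cast_pow, Nat.cast_add, Nat.cast_one, mul_left_comm, boxVal_sq,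
        mul_one]
  refine ⟨key, ?_⟩
  rw [star_legDiag]
  simpa using key

variable {n : ℕ} {q : ℝ} (hq : q ∈ Set.Ico (0 : ℝ) 1)

theorem asympEigen_powOp {l : ℕ} (p : Fin l) : AsympEigen (boxVec l) (powOp hq p) 0 := by
  have h := asympEigen_legDiag p _ (abs_pow_le_one_of_mem hq)
    (tendsto_pow_atTop_nhds_zero_of_lt_one hq.1 hq.2)
  rwa [Complex.ofReal_zero] at h

theorem asympEigen_lowerOp {l : ℕ} (p : Fin l) : AsympEigen (boxVec l) (lowerOp hq p) 1 := by
  have h1 : Tendsto (fun m : ℕ => Real.sqrt (1 - q ^ (2 * m))) atTop (𝓝 1) := by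
    have h2 : Tendsto (fun m : ℕ => q ^ (2 * m)) atTop (𝓝 0) :=
      (tendsto_pow_atTop_nhds_zero_of_lt_one hq.1 hq.2).comp
        (tendsto_id.const_mul_atTop' two_pos)
    simpa using (h2.const_sub 1).sqrt
  have h := (asympEigen_legShift p).mul
    (asympEigen_legDiag p _ (abs_sqrt_le_one_of_mem hq) h1)
  rwa [Complex.ofReal_one, mul_one] at h

/-- In the limit `q^N → 0` and `√(1 - q^{2N}) → 1`, so the block degenerates to the identity matrix.
-/
theorem asympEigen_letterOp {l : ℕ} (p : Fin l) (r : Fin n) (i j : Fin (n + 1)) :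
    AsympEigen (boxVec l) (letterOp hq p r i j) (if i = j then 1 else 0) := by
  have h1 := asympEigen_powOp hq p
  have h2 := asympEigen_lowerOp hq p
  have h3 : AsympEigen (boxVec l) (if q = 0 then powOp hq p else -((q : ℂ) • powOp hq p)) 0 := by
    split_ifs
    · exact h1
    · have h := h1.smul (-(q : ℂ))
      rwa [neg_smul, mul_zero] at h
  have h4 := h2.star
  rw [star_one] at h4
  rw [letterOp_eq, ← blockMat_one r]
  generalize (if q = 0 then powOp hq p else -((q : ℂ) • powOp hq p)) = b at h3
  unfold blockMat
  split_ifs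
  exacts [h2, h4, h3, h1, AsympEigen.one, AsympEigen.zero]

theorem AsympEigen.convMatrix {H : Type*} [NormedAddCommGroup H] [InnerProductSpace ℂ H]
    [CompleteSpace H] {ξ : ℕ → H} {X Y : Fin (n + 1) → Fin (n + 1) → H →L[ℂ] H}
    (hX : ∀ i j, AsympEigen ξ (X i j) (if i = j then 1 else 0))
    (hY : ∀ i j, AsympEigen ξ (Y i j) (if i = j then 1 else 0)) (i j : Fin (n + 1)) :
    AsympEigen ξ (_root_.convMatrix q X Y i j) (if i = j then 1 else 0) := by
  unfold _root_.convMatrix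
  split_ifs with h0 hij hij
  · have := AsympEigen.sum (Finset.Icc (min i j) (max i j)) fun k _ => (hX i k).mul (hY k j)
    simpa [hij] using this
  · have := AsympEigen.sum (Finset.Icc (min i j) (max i j)) fun k _ => (hX i k).mul (hY k j)
    simpa [hij] using this
  · have := AsympEigen.sum Finset.univ fun k _ => (hX i k).mul (hY k j)
    simpa [hij] using this
  · have := AsympEigen.sum Finset.univ fun k _ => (hX i k).mul (hY k j)
    simpa [hij] using this

theorem asympEigen_legWordOp {l : ℕ} (ps : List (Fin l × Fin n)) (i j : Fin (n + 1)) :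
    AsympEigen (boxVec l) (legWordOp hq ps i j) (if i = j then 1 else 0) := by
  induction ps generalizing i j with
  | nil =>
    rw [legWordOp_nil]
    split_ifs
    exacts [AsympEigen.one, AsympEigen.zero]
  | cons a ps ih =>
    rw [legWordOp_cons]
    exact AsympEigen.convMatrix (asympEigen_letterOp hq a.1 a.2) ih i j

theorem asympEigen_torusWordOp (t : Fin n → Circle) (w : List (Fin n)) (i j : Fin (n + 1)) :
    AsympEigen (boxVec w.length) (torusWordOp hq t w i j)
      (torusChar t i * if i = j then 1 else 0) := by
  rw [torusWordOp, wordOp_eq_legWordOp]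
  exact (asympEigen_legWordOp hq _ i j).smul _

end BoxVectors

/-! ### A criterion for a point of the spectrum not to be closed -/

section Closure

variable {A : Type*} [NonUnitalCStarAlgebra A]

/-- A hull that contains `ker π` contains every larger primitive ideal. If the singleton were
closed, `ρ` would lie in it and be unitarily equivalent to `π`. -/
theorem CSpectrum.not_isClosed_singleton {H H' : Type} [NormedAddCommGroup H]
    [InnerProductSpace ℂ H] [CompleteSpace H] [NormedAddCommGroup H'] [InnerProductSpace ℂ H']
    [CompleteSpace H'] {π : A →⋆ₙₐ[ℂ] (H →L[ℂ] H)} {ρ : A →⋆ₙₐ[ℂ] (H' →L[ℂ] H')}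
    (hπ : IsIrredRep π) (hρ : IsIrredRep ρ) (hker : ∀ a, π a = 0 → ρ a = 0)
    (hne : IsEmpty (H' ≃ₗᵢ[ℂ] H)) : ¬ IsClosed {CSpectrum.mk π hπ} := by
  intro h
  obtain ⟨F, hF, hF'⟩ := isClosed_induced_iff.1 h
  obtain ⟨M, rfl⟩ : ∃ M : Set A, F = Prim.hull M := by
    obtain ⟨M, hM⟩ : ∃ M : Set A, Fᶜᶜ = Prim.hull M := hF.isOpen_compl
    exact ⟨M, (compl_compl F).symm.trans hM⟩
  have hmem : CSpectrum.mk π hπ ∈ CSpectrum.toPrim ⁻¹' Prim.hull M := by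
    rw [hF']
    rfl
  have hmem' : CSpectrum.mk ρ hρ ∈ CSpectrum.toPrim ⁻¹' Prim.hull M := fun a ha =>
    (IrredRep.mem_ker ⟨H', ρ, hρ⟩ a).2
      (hker a ((IrredRep.mem_ker ⟨H, π, hπ⟩ a).1 (hmem a ha)))
  rw [hF'] at hmem'
  obtain ⟨U, -⟩ := Quotient.exact (s := IrredRep.setoid A) hmem'
  exact hne.false U

end Closure

/-! ### The torus characters in the closure -/

section Torus

open scoped CStarAlgebra

variable {n : ℕ} {q : ℝ} (hq : q ∈ Set.Ico (0 : ℝ) 1) (t : Fin n → Circle)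

theorem SURel.diagonal : SURel n q fun i j => torusChar t i • (if i = j then (1 : ℂ) else 0) :=
  SURel.torus ⟨fun _ => QuantumRel.one, fun _ => CrystalRel.one⟩ t

variable (q) in
/-- The character `χ_t` of `A_q(n)`. -/
def torusHom : SUAlg n q →⋆ₐ[ℂ] ℂ :=
  (SUAlg.existsUnique_lift (SURel.diagonal (q := q) t)).choose

theorem torusHom_gen (i j : Fin (n + 1)) :
    torusHom q t (SUAlg.gen n q i j) = torusChar t i • if i = j then 1 else 0 :=
  (SUAlg.existsUnique_lift (SURel.diagonal (q := q) t)).choose_spec.1 i j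

variable (q) in
/-- The character `χ_t` as a representation on `ℂ`. -/
def torusRep : SUAlg n q →⋆ₙₐ[ℂ] (ℂ →L[ℂ] ℂ) where
  toFun a := torusHom q t a • 1
  map_smul' c a := by simp [smul_smul]
  map_zero' := by ext; simp
  map_add' a b := by ext; simp
  map_mul' a b := by ext; simp [mul_comm]
  map_star' a := by ext; simp [map_star (torusHom q t)]

theorem isIrredRep_torusRep : IsIrredRep (torusRep q t) where
  ne_zero h := by
    have h1 : torusHom q t 1 • (1 : ℂ →L[ℂ] ℂ) = 0 := DFunLike.congr_fun h 1
    rw [map_one, one_smul] at h1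
    exact one_ne_zero h1
  irred K _ _ := eq_bot_or_eq_top K

theorem asympEigen_torusWordHom (w : List (Fin n)) (a : SUAlg n q) :
    AsympEigen (boxVec w.length) (torusWordHom hq t w a) (torusHom q t a) := by
  induction a using SUAlg.induction with
  | hcl =>
    exact isClosed_asympEigen (norm_boxVec _) _ _ (map_continuous (torusWordHom hq t w))
      (map_continuous (torusHom q t))
  | hgen i j =>
    rw [torusWordHom_gen, torusHom_gen]
    exact asympEigen_torusWordOp hq t w i j
  | hone c =>
    rw [map_smul, map_smul, map_one, map_one, smul_eq_mul, mul_one]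
    exact AsympEigen.smul_one c
  | hadd a b ha hb => rw [map_add, map_add]; exact ha.add hb
  | hmul a b ha hb => rw [map_mul, map_mul]; exact ha.mul hb
  | hstar a ha => rw [map_star, map_star]; exact ha.star

/-- For `l ≠ 0` there are two orthogonal basis vectors, whereas two non-zero complex numbers are
never orthogonal. -/
theorem isEmpty_linearIsometryEquiv_tensorL2 {l : ℕ} (hl : l ≠ 0) :
    IsEmpty (ℂ ≃ₗᵢ[ℂ] TensorL2 l) := by
  refine ⟨fun U => ?_⟩
  obtain ⟨l, rfl⟩ := Nat.exists_eq_succ_of_ne_zero hl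
  have h0 : ∀ m : Fin (l + 1) → ℕ, U.symm (lp.single 2 m (1 : ℂ)) ≠ 0 := by
    intro m h
    have h1 := congrArg norm h
    rw [U.symm.norm_map, lp.norm_single (by simp)] at h1
    simp at h1
  have h := U.symm.inner_map_map (lp.single 2 (fun _ => 0) (1 : ℂ)) (lp.single 2 (fun _ => 1) (1 : ℂ))
  rw [lp.inner_single_left, lp.single_apply, Pi.single_eq_of_ne (fun h => by
    simpa using congrFun h 0), inner_zero_right] at h
  simp [h0] at h

theorem not_isClosed_torusWordHom {w : List (Fin n)} (hw : IsStandardWord w) (hw' : w ≠ []) :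
    ¬ IsClosed {CSpectrum.mk _ (isIrredRep_torusWordHom hq t w hw)} := by
  refine CSpectrum.not_isClosed_singleton _ (isIrredRep_torusRep (q := q) t) (fun a ha => ?_)
    (isEmpty_linearIsometryEquiv_tensorL2 (mt List.length_eq_zero_iff.1 hw'))
  have h : torusHom q t a = 0 :=
    (asympEigen_torusWordHom hq t w a).eq_of_norm_eq_one (norm_boxVec _) ha
  change torusHom q t a • (1 : ℂ →L[ℂ] ℂ) = 0
  ext
  simp [h]

end Torus

theorem corollaryt1 (n : ℕ) (hn : 2 ≤ n) (q : ℝ) (hq : q ∈ Set.Ico (0 : ℝ) 1) :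
    ¬ T2Space (CSpectrum (SUAlg n q)) ∧
    ∀ (t : Fin n → Circle) (w : List (Fin n)), IsStandardWord w → w ≠ [] →
      ∃ (π : SUAlg n q →⋆ₙₐ[ℂ] (TensorL2 w.length →L[ℂ] TensorL2 w.length)) (h : IsIrredRep π),
        (∀ i j, π (SUAlg.gen n q i j) = torusWordOp hq t w i j) ∧
        ¬ IsClosed {CSpectrum.mk π h} := by
  refine ⟨fun h => ?_, fun t w hw hw' => ⟨_, isIrredRep_torusWordHom hq t w hw,
    torusWordHom_gen hq t w, not_isClosed_torusWordHom hq t hw hw'⟩⟩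
  -- The word `s_1` of length one already provides a point that is not closed, whereas Hausdorff
  -- spaces have closed points.
  let r : Fin n := ⟨0, by omega⟩
  have hr : blockWord r r ≠ [] := by
    obtain ⟨-, v, hv⟩ := blockWord_spec (le_refl r)
    rw [hv]
    exact List.cons_ne_nil _ _
  have hr' : IsStandardWord (blockWord r r) := ⟨[(r, r)], by simp, by simp, by simp⟩
  exact not_isClosed_torusWordHom hq (fun _ => 1) hr' hr isClosed_singleton

end
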